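/- Let $d\ge 1$ be an integer and let $\kappa\ge 0$, $\tau>0$, $\beta\ge 0$, $\alpha\in\mathbb R$ satisfy $\beta<1+d/2$ and $\alpha+\beta>d/2$; if $\kappa=0$, assume also $\alpha+\beta<1+d/2$. For $L>0$ let $\mathcal D_L=[-L/2,L/2]^d$, and let $\Delta$ be the Laplacian on $\mathcal D_L$ with homogeneous Neumann boundary conditions, i.e. with domain $\{f\in H^2(\mathcal D_L):\partial f/\partial\nu=0 \text{ on }\partial\mathcal D_L\}$. An intrinsic Gaussian random field on a set $D\subset\mathbb R^d$ is a field $u$, considered up to adding a (random) constant, such that for all distinct $s_1,\dots,s_k\in D$ and all $0\ne c\in\mathbb R^k$ with $\sum_i c_i=0$, the variable $\sum_i c_iu(s_i)$ is centered Gaussian with positive variance. Its variogram is $(s,t)\mapsto\operatorname{Var}(u(s)-u(t))$. The intrinsic Whittle–Matérn field on $\mathcal D_L$ is the mean-square continuous, square-integrable intrinsic Gaussian random field $u$ on $\mathcal D_L$ that solves $$(-\Delta)^{\beta/2}(\kappa^2-\Delta)^{\alpha/2}(\tau u)=\mathcal W\quad\text{on }\mathcal D_L$$ modulo constants, where $\mathcal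 W$ is Gaussian white noise on $L_2(\mathcal D_L)$ and the fractional powers are taken in the spectral sense; that is, for every eigenfunction $f$ of $-\Delta$ with eigenvalue $\lambda\neq0$, almost surely $\lambda^{\beta/2}(\kappa^2+\lambda)^{\alpha/2}\int_{\mathcal D_L}\tau u f\,{\rm d}s=\mathcal W(f)$. Then for every $L>0$ such a field exists and its variogram $\gamma_L$ is uniquely determined on $\mathcal D_L\times\mathcal D_L$. For all $s,t\in\mathbb R^d$, $$\lim_{L\to\infty}\gamma_L(s,t)=\gamma(\|s-t\|),\qquad \gamma(h):=\frac{4}{\tau^2 2^d\pi^{d/2}\Gamma(d/2)}\int_0^\infty\bigl(1-\Lambda_d(hr)\bigr)\frac{r^{d-1}}{r^{2\beta}(\kappa^2+r^2)^\alpha}\,{\rm d}r ,$$ where $\Lambda_d(z)=2^{(d-2)/2}\,\Gamma\!\left(\tfrac d2\right)\dfrac{J_{(d-2)/2}(z)}{z^{(d-2)/2}}$ for $z>0$, $\Lambda_d(0)=1$ (its limit at $0$), and $J_m$ is the Bessel function of the first kind of order $m$. The integral converges absolutely for every $h\ge0$, and $(s,t)\mapsto\gamma(\|s-t\|)$ is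 a stationary and isotropic variogram on $\mathbb R^d$, i.e. it is the variogram of an intrinsic Gaussian random field on $\mathbb R^d$. -/

import Mathlib

open MeasureTheory ProbabilityTheory Filter Topology
open scoped NNReal

universe w

/-! ## Special functions and the limiting variogram -/

/-- Bessel function of the first kind of real order `ν`, by its power series (for `z ≥ 0`):
`J_ν(z) = ∑ₘ (-1)^m / (m! Γ(m + ν + 1)) (z / 2)^(2m + ν)`. -/
noncomputable def besselJ (ν z : ℝ) : ℝ :=
  ∑' m : ℕ, (-1 : ℝ) ^ m / ((m.factorial : ℝ) * Real.Gamma (m + ν + 1)) *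
    (z / 2) ^ (2 * (m : ℝ) + ν)

/-- `Λ_d(z) = 2^((d-2)/2) Γ(d/2) J_((d-2)/2)(z) / z^((d-2)/2)` for `z > 0`, extended by its limit
`1` to `z = 0`. -/
noncomputable def besselLambda (d : ℕ) (z : ℝ) : ℝ :=
  if z = 0 then 1
  else (2 : ℝ) ^ (((d : ℝ) - 2) / 2) * Real.Gamma ((d : ℝ) / 2) *
    (besselJ (((d : ℝ) - 2) / 2) z / z ^ (((d : ℝ) - 2) / 2))

/-- The integrand `(1 - Λ_d(h r)) r^(d-1) / (r^(2β) (κ² + r²)^α)`. -/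
noncomputable def limitIntegrand (d : ℕ) (κ α β h r : ℝ) : ℝ :=
  (1 - besselLambda d (h * r)) *
    (r ^ ((d : ℝ) - 1) / (r ^ (2 * β) * (κ ^ 2 + r ^ 2) ^ α))

/-- The limiting variogram as a function of the distance `h`. -/
noncomputable def limitVariogram (d : ℕ) (κ τ α β h : ℝ) : ℝ :=
  4 / (τ ^ 2 * 2 ^ d * Real.pi ^ ((d : ℝ) / 2) * Real.Gamma ((d : ℝ) / 2)) *
    ∫ r in Set.Ioi (0 : ℝ), limitIntegrand d κ α β h r

/-! ## The Neumann Laplacian -/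

/-- The closed cube `[-L/2, L/2]^d`. -/
def cube (d : ℕ) (L : ℝ) : Set (EuclideanSpace ℝ (Fin d)) :=
  {x | ∀ i, x i ∈ Set.Icc (-(L / 2)) (L / 2)}

/-- `f` lies in `H¹` of (the interior of) `D`, with weak partial derivatives `G i`. -/
structure IsWeakGradient {d : ℕ} (D : Set (EuclideanSpace ℝ (Fin d)))
    (f : EuclideanSpace ℝ (Fin d) → ℝ) (G : Fin d → EuclideanSpace ℝ (Fin d) → ℝ) : Prop where
  memLp : MemLp f 2 (volume.restrict D)
  memLp_grad : ∀ i, MemLp (G i) 2 (volume.restrict D)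
  weak_deriv : ∀ (i : Fin d) (φ : EuclideanSpace ℝ (Fin d) → ℝ), ContDiff ℝ (⊤ : ℕ∞) φ →
    HasCompactSupport φ → tsupport φ ⊆ interior D →
    ∫ x in D, f x * fderiv ℝ φ x (EuclideanSpace.single i 1) = -∫ x in D, G i x * φ x

/-- `f ∈ H²(D)`, its normal derivative vanishes on the boundary, and `Δ f = g`.
The boundary condition is expressed by Green's formula having no boundary term: for every
`φ ∈ H¹(D)`, `∫_D ∇f · ∇φ = -∫_D (Δ f) φ`. -/
def IsNeumannLaplacian {d : ℕ} (D : Set (EuclideanSpace ℝ (Fin d)))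
    (f g : EuclideanSpace ℝ (Fin d) → ℝ) : Prop :=
  ∃ (G : Fin d → EuclideanSpace ℝ (Fin d) → ℝ)
    (H : Fin d → Fin d → EuclideanSpace ℝ (Fin d) → ℝ),
    IsWeakGradient D f G ∧ (∀ i, IsWeakGradient D (G i) (H i)) ∧
    (∀ᵐ x ∂(volume.restrict D), g x = ∑ i, H i i x) ∧
    ∀ (φ : EuclideanSpace ℝ (Fin d) → ℝ) (Φ : Fin d → EuclideanSpace ℝ (Fin d) → ℝ),
      IsWeakGradient D φ Φ →
      ∫ x in D, ∑ i, G i x * Φ i x = -∫ x in D, g x * φ x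

/-- `-Δ f = lam f` for the Neumann Laplacian on `D`. -/
def IsNeumannEigenfunction {d : ℕ} (D : Set (EuclideanSpace ℝ (Fin d)))
    (f : EuclideanSpace ℝ (Fin d) → ℝ) (lam : ℝ) : Prop :=
  IsNeumannLaplacian D f (fun x => -(lam * f x))

/-! ## Random fields -/

/-- Gaussian white noise on `L²(D)`: a linear map `W` from `L²(D)` to random variables with
`W f ∼ N(0, ‖f‖²)`. -/
def IsGaussianWhiteNoise {d : ℕ} (D : Set (EuclideanSpace ℝ (Fin d))) {Ω : Type*}
    [MeasurableSpace Ω] (P : Measure Ω)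
    (W : Lp ℝ 2 (volume.restrict D) →ₗ[ℝ] Lp ℝ 2 P) : Prop :=
  ∀ f, P.map (W f) = gaussianReal 0 (‖f‖₊ ^ 2)

/-- `u` represents a (centered, first-order) intrinsic Gaussian random field on `D`: every
non-trivial contrast `∑ cᵢ u(sᵢ)`, `∑ cᵢ = 0`, at distinct points of `D` is a centered
non-degenerate Gaussian variable. Equivalently, for distinct `s₁, …, sₖ ∈ D`, the vector of the
`u(sᵢ)`, taken modulo constant vectors, is centered Gaussian with a precision matrix of rank
`k - 1` whose kernel is spanned by the vector of ones. -/
def IsIntrinsicGaussianField {d : ℕ} (D : Set (EuclideanSpace ℝ (Fin d))) {Ω : Type*}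
    [MeasurableSpace Ω] (P : Measure Ω) (u : EuclideanSpace ℝ (Fin d) → Ω → ℝ) : Prop :=
  ∀ (k : ℕ) (s : Fin k → EuclideanSpace ℝ (Fin d)) (c : Fin k → ℝ),
    (∀ i, s i ∈ D) → Function.Injective s → ∑ i, c i = 0 → c ≠ 0 →
    ∃ v : ℝ≥0, v ≠ 0 ∧ P.map (fun ω => ∑ i, c i * u (s i) ω) = gaussianReal 0 v

/-- `u` represents the intrinsic Whittle–Matérn field on `D`: a mean-square continuous, square
integrable intrinsic Gaussian random field that solves
`(-Δ)^(β/2) (κ² - Δ)^(α/2) (τ u) = W` modulo constants, with `Δ` the Neumann Laplacian. The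
fractional powers are taken in the spectral sense, so that the equation says that both sides have
the same component along every eigenfunction with a nonzero eigenvalue (those orthogonal to the
constants). Adding a random constant to `u` is allowed. -/
structure IsIntrinsicWhittleMatern {d : ℕ} (D : Set (EuclideanSpace ℝ (Fin d)))
    (κ τ α β : ℝ) {Ω : Type*} [MeasurableSpace Ω] (P : Measure Ω)
    (u : EuclideanSpace ℝ (Fin d) → Ω → ℝ) : Prop where
  intrinsic : IsIntrinsicGaussianField D P u
  memLp : MemLp (fun p : EuclideanSpace ℝ (Fin d) × Ω => u p.1 p.2) 2
    ((volume.restrict D).prod P)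
  meanSquare_continuous : ∀ s ∈ D,
    Tendsto (fun t => ∫ ω, (u t ω - u s ω) ^ 2 ∂P) (𝓝[D] s) (𝓝 0)
  solves : ∃ W : Lp ℝ 2 (volume.restrict D) →ₗ[ℝ] Lp ℝ 2 P, IsGaussianWhiteNoise D P W ∧
    ∀ (f : Lp ℝ 2 (volume.restrict D)) (lam : ℝ), IsNeumannEigenfunction D f lam → lam ≠ 0 →
      ∀ᵐ ω ∂P, lam ^ (β / 2) * (κ ^ 2 + lam) ^ (α / 2) * ∫ s in D, (τ * u s ω) * f s = W f ω

/-- On `D`, `γ` is the variogram `Var(u(s) - u(t))` of the intrinsic Whittle–Matérn field: such a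
field exists, and all of them have the variogram `γ`. -/
def IsWhittleMaternVariogram {d : ℕ} (D : Set (EuclideanSpace ℝ (Fin d))) (κ τ α β : ℝ)
    (γ : EuclideanSpace ℝ (Fin d) → EuclideanSpace ℝ (Fin d) → ℝ) : Prop :=
  (∃ (Ω : Type) (_ : MeasurableSpace Ω) (P : Measure Ω) (_ : IsProbabilityMeasure P)
    (u : EuclideanSpace ℝ (Fin d) → Ω → ℝ), IsIntrinsicWhittleMatern D κ τ α β P u) ∧
  ∀ (Ω : Type w) [MeasurableSpace Ω] (P : Measure Ω) [IsProbabilityMeasure P]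
    (u : EuclideanSpace ℝ (Fin d) → Ω → ℝ), IsIntrinsicWhittleMatern D κ τ α β P u →
    ∀ s ∈ D, ∀ t ∈ D, variance (fun ω => u s ω - u t ω) P = γ s t

/-- `(s, t) ↦ g ‖s - t‖` is the variogram of an intrinsic Gaussian random field on `ℝ^d` (which is
then stationary and isotropic). -/
def IsStationaryIsotropicVariogram (d : ℕ) (g : ℝ → ℝ) : Prop :=
  ∃ (Ω : Type) (_ : MeasurableSpace Ω) (P : Measure Ω) (_ : IsProbabilityMeasure P)
    (u : EuclideanSpace ℝ (Fin d) → Ω → ℝ), IsIntrinsicGaussianField Set.univ P u ∧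
    ∀ s t, variance (fun ω => u s ω - u t ω) P = g ‖s - t‖

/-! ## Isonormal Gaussian processes -/

section Isonormal

variable {Ω : Type*} [MeasurableSpace Ω] {P : Measure Ω}

/-! On the cube everything is diagonal in the tensor cosines `neumannCos L n`, with eigenvalues `λ_n
= ‖π n / L‖²`. The equation forces the component of `u` along each nonconstant cosine to be `a_n`
times a white noise coordinate, where `a_n = τ⁻¹ λ_n^(-β/2) (κ² + λ_n)^(-α/2)`. Since `λ_n` grows
like `|n|²`, the condition `α + β > d/2` makes `∑ a_n²` finite. So the series defines a field, and
completeness of the cosines together with mean-square continuity determines its increments: the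
variogram is `∑ a_n² (e_n(s) - e_n(t))²` (`exists_isIntrinsicWhittleMatern`,
`IsIntrinsicWhittleMatern.variance_eq`).

For the limit, the phase `nⱼ π/2` created by centring the cube at the origin turns each cosine
factor, up to sign, into `cos` or `sin` of `(π nⱼ/L) sⱼ` according to the parity of `nⱼ`. Within one
of the `2^d` parity classes the series is a Riemann sum of a fixed function of frequency. It is
exactly the integral of that function after rounding the frequency to the lattice, because the cell
volumes reproduce the normalising constants of the cosines (`wmVariogram_eq_sum_integral`).
Dominated convergence then gives `L → ∞`. The squared increments are `O(min(1, |ξ|²))`, which leaves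
`|ξ|^(2-2β)` at the origin (`|ξ|^(2-2(α+β))` if `κ = 0`) and `|ξ|^(-2(α+β))` at infinity; these are
integrable precisely under the hypotheses (`exists_spectralDensity_mul_le`).

Summing over parities produces `2 (1 - ∏ cos(xⱼ(sⱼ - tⱼ)))`. The product is the mean of the plane
waves `cos ⟪x, δ⟫` over all sign changes `δ` of `s - t`. All these `δ` have the same norm, and the
spectral density is radial, so each contributes the same integral. Polar coordinates turn it into
the Bessel integral, since the spherical mean of a plane wave is `besselLambda`
(`integral_toSphere_cos`, proved by matching even moments, which come from Gaussian integrals).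

The limiting variogram belongs to the white noise integral of a real spectral kernel on `ℝ^d`. Its
contrasts are nondegenerate because distinct characters are linearly independent. -/

lemma continuous_integral_cexp_mul_I_Lp [IsProbabilityMeasure P] (t : ℝ) :
    Continuous fun f : Lp ℝ 2 P => ∫ ω, Complex.exp (t * f ω * Complex.I) ∂P := by
  refine continuous_iff_seqContinuous.2 fun u f hu => ?_
  -- Dominated convergence needs almost everywhere convergence, which convergence in `L²` provides
  -- only along a subsequence.
  refine tendsto_of_subseq_tendsto fun ns hns => ?_
  have h1 : TendstoInMeasure P (fun n => (u (ns n) : Ω → ℝ)) atTop f :=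
    tendstoInMeasure_of_tendsto_Lp (hu.comp hns)
  obtain ⟨ms, -, hms⟩ := h1.exists_seq_tendsto_ae
  refine ⟨ms, tendsto_integral_of_dominated_convergence (fun _ => 1) (fun n => ?_)
    (integrable_const _) (fun n => ae_of_all _ fun ω => ?_) ?_⟩
  · have := (Lp.stronglyMeasurable (u (ns (ms n)))).measurable
    exact Measurable.aestronglyMeasurable (by fun_prop)
  · have : (t : ℂ) * (u (ns (ms n)) ω : ℂ) * Complex.I = ((t * u (ns (ms n)) ω : ℝ) : ℂ) * Complex.I := by
      push_cast; rfl
    rw [this, Complex.norm_exp_ofReal_mul_I]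
  · filter_upwards [hms] with ω hω
    have hc : Continuous fun x : ℝ => Complex.exp (t * x * Complex.I) := by fun_prop
    exact (hc.tendsto _).comp hω

lemma charFun_map_Lp [IsProbabilityMeasure P] (f : Lp ℝ 2 P) (t : ℝ) :
    charFun (P.map f) t = ∫ ω, Complex.exp (t * f ω * Complex.I) ∂P := by
  rw [charFun_apply_real, integral_map]
  · exact (Lp.stronglyMeasurable f).measurable.aemeasurable
  · exact Continuous.aestronglyMeasurable (by fun_prop)

/-- On some probability space there is an isonormal Gaussian process over the real Hilbert
space `H`. -/
theorem exists_isonormal (H : Type) [NormedAddCommGroup H] [InnerProductSpace ℝ H]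
    [CompleteSpace H] :
    ∃ (Ω : Type) (_ : MeasurableSpace Ω) (P : Measure Ω) (_ : IsProbabilityMeasure P)
      (G : H →ₗᵢ[ℝ] Lp ℝ 2 P), ∀ f, P.map (G f) = gaussianReal 0 (‖f‖₊ ^ 2) := by
  classical
  obtain ⟨ι, b, -⟩ := exists_hilbertBasis ℝ H
  let μ : ι → Measure ℝ := fun _ => gaussianReal 0 1
  let P := Measure.infinitePi μ
  have hmp : ∀ i : ι, MeasurePreserving (Function.eval i) P (μ i) :=
    measurePreserving_eval_infinitePi μ
  have hL : ∀ i : ι, MemLp (fun ω : ι → ℝ => ω i) 2 P := fun i =>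
    (memLp_id_gaussianReal' 2 (by simp)).comp_measurePreserving (hmp i)
  let ξ : ι → Lp ℝ 2 P := fun i => (hL i).toLp
  have hξ : ∀ i, ξ i =ᵐ[P] fun ω => ω i := fun i => (hL i).coeFn_toLp
  have hind : iIndepFun (fun (i : ι) (ω : ι → ℝ) => ω i) P :=
    iIndepFun_infinitePi (P := μ) (X := fun _ x => x) (fun _ => measurable_id)
  have hint : ∀ i, ∫ ω, ω i ∂P = 0 := fun i => by
    have h2 : ∫ ω, ω i ∂P = ∫ x, x ∂(P.map (Function.eval i)) := by
      rw [integral_map (hmp i).measurable.aemeasurable]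
      exact measurable_id.aestronglyMeasurable
    rw [h2, (hmp i).map_eq]
    exact integral_id_gaussianReal
  have hsq : ∀ i, ∫ ω, ω i * ω i ∂P = 1 := fun i => by
    have h2 : ∫ ω, ω i * ω i ∂P = ∫ x, x * x ∂(P.map (Function.eval i)) := by
      rw [integral_map (hmp i).measurable.aemeasurable]
      exact Measurable.aestronglyMeasurable (by fun_prop)
    rw [h2, (hmp i).map_eq]
    have := variance_fun_id_gaussianReal (μ := 0) (v := 1)
    rw [variance_eq_integral measurable_id'.aemeasurable] at this
    simpa [integral_id_gaussianReal, pow_two, μ] using this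
  have hon : Orthonormal ℝ ξ := by
    rw [orthonormal_iff_ite]
    intro i j
    rw [L2.inner_def]
    have : ∫ ω, inner ℝ (ξ i ω) (ξ j ω) ∂P = ∫ ω, ω j * ω i ∂P := by
      refine integral_congr_ae ?_
      filter_upwards [hξ i, hξ j] with ω h1 h2
      simp [h1, h2]
    rw [this]
    split_ifs with h
    · subst h; exact hsq i
    · rw [(hind.indepFun (Ne.symm h)).integral_fun_mul_eq_mul_integral
        (measurable_pi_apply _).aestronglyMeasurable (measurable_pi_apply _).aestronglyMeasurable,
        hint, zero_mul]
  let G : H →ₗᵢ[ℝ] Lp ℝ 2 P := hon.orthogonalFamily.linearIsometry.comp b.repr.toLinearIsometry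
  have hG : ∀ i, G (b i) = ξ i := fun i => by
    simp only [G, LinearIsometry.coe_comp, Function.comp_apply, LinearIsometryEquiv.coe_toLinearIsometry,
      HilbertBasis.repr_self]
    rw [OrthogonalFamily.linearIsometry_apply_single]
    simp
  refine ⟨ι → ℝ, inferInstance, P, inferInstance, G, fun f => ?_⟩
  -- Finite partial sums are Gaussian by independence of the coordinates. Both sides of the identity
  -- of characteristic functions are continuous in the vector, so it passes to the limit.
  refine Measure.ext_of_charFun (funext fun t => ?_)
  rw [charFun_map_Lp, charFun_gaussianReal]
  have hs := b.hasSum_repr f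
  have h1 := ((continuous_integral_cexp_mul_I_Lp (P := P) t).tendsto (G f)).comp
    ((G.continuous.tendsto f).comp hs)
  refine tendsto_nhds_unique h1 ?_
  have h2 : ∀ F : Finset ι, ∫ ω, Complex.exp (t * (G (∑ i ∈ F, b.repr f i • b i) : Lp ℝ 2 P) ω *
      Complex.I) ∂P = Complex.exp (t * (0 : ℝ) * Complex.I -
        ((‖∑ i ∈ F, b.repr f i • b i‖₊ ^ 2 : ℝ≥0) : ℝ) * t ^ 2 / 2) := by
    intro F
    rw [← charFun_map_Lp]
    have h3 : G (∑ i ∈ F, b.repr f i • b i) =ᵐ[P] fun ω => ∑ i ∈ F, b.repr f i * ω i := by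
      rw [map_sum]
      refine (Lp.coeFn_finsetSum _ _).trans ?_
      have : ∀ᵐ ω ∂P, ∀ i ∈ F, G (b.repr f i • b i) ω = b.repr f i * ω i := by
        rw [Finset.eventually_all]
        intro i _
        rw [map_smul, hG]
        filter_upwards [hξ i, Lp.coeFn_smul (b.repr f i) (ξ i)] with ω h4 h5
        rw [h5, Pi.smul_apply, h4, smul_eq_mul]
      filter_upwards [this] with ω hω
      rw [Finset.sum_apply]
      exact Finset.sum_congr rfl hω
    rw [Measure.map_congr h3, iIndepFun.charFun_map_fun_finsetSum_eq_prod
      (X := fun (i : ι) (ω : ι → ℝ) => b.repr f i * ω i)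
      (fun i _ => Measurable.aemeasurable (by fun_prop))
      ((hind.comp (fun i x => b.repr f i * x) fun i => by fun_prop).restrict _)]
    have h5 : ∀ i, charFun (P.map fun ω => b.repr f i * ω i) t =
        Complex.exp (- ((b.repr f i) ^ 2 * t ^ 2 / 2 : ℝ)) := fun i => by
      have : P.map (fun ω => b.repr f i * ω i) = (P.map (Function.eval i)).map (b.repr f i * ·) := by
        rw [Measure.map_map (by fun_prop) (by fun_prop)]; rfl
      rw [this, (hmp i).map_eq, gaussianReal_map_const_mul, charFun_gaussianReal]
      simp
    rw [Finset.prod_apply]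
    simp_rw [h5]
    rw [← Complex.exp_sum]
    congr 1
    have h6 : ‖∑ i ∈ F, b.repr f i • b i‖ ^ 2 = ∑ i ∈ F, b.repr f i ^ 2 := by
      rw [← real_inner_self_eq_norm_sq, b.orthonormal.inner_sum]
      simp [pow_two]
    have h7 : ((‖∑ i ∈ F, b.repr f i • b i‖₊ ^ 2 : ℝ≥0) : ℝ) = ∑ i ∈ F, b.repr f i ^ 2 := by
      rw [← h6]; simp
    rw [h7, Finset.sum_neg_distrib]
    push_cast
    rw [Finset.sum_mul, Finset.sum_div]
    simp
  have hc : Continuous fun g : H => Complex.exp (t * (0 : ℝ) * Complex.I -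
        ((‖g‖₊ ^ 2 : ℝ≥0) : ℝ) * t ^ 2 / 2) := by fun_prop
  exact ((hc.tendsto f).comp hs).congr fun F => (h2 F).symm

end Isonormal

/-! ## Products of one-variable functions on the cube -/

section ProdFun

variable {d : ℕ} {L : ℝ}

/-- The product `x ↦ ∏ⱼ fⱼ(xⱼ)`. -/
def prodFun (f : Fin d → ℝ → ℝ) (x : EuclideanSpace ℝ (Fin d)) : ℝ := ∏ j, f j (x j)

lemma prodFun_update (f : Fin d → ℝ → ℝ) (i : Fin d) (g : ℝ → ℝ)
    (x : EuclideanSpace ℝ (Fin d)) :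
    prodFun (Function.update f i g) x = g (x i) * ∏ j ∈ Finset.univ.erase i, f j (x j) := by
  rw [prodFun, ← Finset.mul_prod_erase _ _ (Finset.mem_univ i), Function.update_self]
  congr 1
  exact Finset.prod_congr rfl fun j hj => by
    rw [Function.update_of_ne (Finset.ne_of_mem_erase hj)]

lemma prodFun_update_const_mul (f : Fin d → ℝ → ℝ) (i : Fin d) (c : ℝ)
    (x : EuclideanSpace ℝ (Fin d)) :
    prodFun (Function.update f i fun y => c * f i y) x = c * prodFun f x := by
  rw [prodFun_update, mul_assoc, prodFun, ← Finset.mul_prod_erase _ _ (Finset.mem_univ i)]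

lemma contDiff_prodFun {f : Fin d → ℝ → ℝ} {n : WithTop ℕ∞} (hf : ∀ j, ContDiff ℝ n (f j)) :
    ContDiff ℝ n (prodFun f) := by
  refine contDiff_prod fun j _ => (hf j).comp ?_
  exact (contDiff_piLp_apply 2)

lemma continuous_prodFun {f : Fin d → ℝ → ℝ} (hf : ∀ j, Continuous (f j)) :
    Continuous (prodFun f) := by
  unfold prodFun; fun_prop

lemma fderiv_prodFun_single {f : Fin d → ℝ → ℝ} (hf : ∀ j, Differentiable ℝ (f j)) (i : Fin d)
    (x : EuclideanSpace ℝ (Fin d)) :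
    fderiv ℝ (prodFun f) x (EuclideanSpace.single i 1) =
      prodFun (Function.update f i (deriv (f i))) x := by
  have h1 : ∀ j ∈ (Finset.univ : Finset (Fin d)), HasFDerivAt
      (fun y : EuclideanSpace ℝ (Fin d) => f j (y j))
      (deriv (f j) (x j) • (EuclideanSpace.proj j : EuclideanSpace ℝ (Fin d) →L[ℝ] ℝ)) x :=
    fun j _ => ((hf j (x j)).hasDerivAt.comp_hasFDerivAt x
      (EuclideanSpace.proj j : EuclideanSpace ℝ (Fin d) →L[ℝ] ℝ).hasFDerivAt)
  have h2 := HasFDerivAt.finsetProd h1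
  have h3 : HasFDerivAt (prodFun f) _ x := h2
  rw [h3.fderiv, prodFun_update]
  simp [mul_comm]

lemma cube_eq_preimage (d : ℕ) (L : ℝ) :
    cube d L = (WithLp.ofLp : EuclideanSpace ℝ (Fin d) → Fin d → ℝ) ⁻¹'
      (Set.univ.pi fun _ => Set.Icc (-(L / 2)) (L / 2)) := by
  ext x; simp only [cube, Set.mem_ofPred_eq, Set.mem_preimage, Set.mem_univ_pi]

lemma measurableSet_cube (d : ℕ) (L : ℝ) : MeasurableSet (cube d L) := by
  rw [cube_eq_preimage]
  exact (PiLp.volume_preserving_ofLp (Fin d)).measurable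
    (MeasurableSet.univ_pi fun _ => measurableSet_Icc)

lemma measurePreserving_ofLp_cube (d : ℕ) (L : ℝ) :
    MeasurePreserving (WithLp.ofLp : EuclideanSpace ℝ (Fin d) → Fin d → ℝ)
      (volume.restrict (cube d L))
      (Measure.pi fun _ => volume.restrict (Set.Icc (-(L / 2)) (L / 2))) := by
  rw [cube_eq_preimage, ← Measure.restrict_pi_pi]
  exact (PiLp.volume_preserving_ofLp (Fin d)).restrict_preimage
    (MeasurableSet.univ_pi fun _ => measurableSet_Icc)

instance isFiniteMeasure_restrict_cube (d : ℕ) (L : ℝ) :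
    IsFiniteMeasure (volume.restrict (cube d L)) := by
  have h := (measurePreserving_ofLp_cube d L)
  refine ⟨?_⟩
  rw [← Set.preimage_univ (f := (WithLp.ofLp : EuclideanSpace ℝ (Fin d) → Fin d → ℝ)),
    h.measure_preimage MeasurableSet.univ.nullMeasurableSet]
  exact measure_lt_top _ _

lemma integral_cube_prodFun (f : Fin d → ℝ → ℝ) :
    ∫ x in cube d L, prodFun f x = ∏ j, ∫ x in Set.Icc (-(L / 2)) (L / 2), f j x := by
  rw [← integral_fintype_prod_eq_prod, ← (measurePreserving_ofLp_cube d L).integral_comp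
    (MeasurableEquiv.toLp 2 (Fin d → ℝ)).symm.measurableEmbedding]
  rfl

lemma isCompact_setOf_forall_mem_Icc (a b : ℝ) :
    IsCompact {x : EuclideanSpace ℝ (Fin d) | ∀ i, x i ∈ Set.Icc a b} := by
  have h : IsCompact (Set.univ.pi fun _ : Fin d => Set.Icc a b) :=
    isCompact_univ_pi fun _ => isCompact_Icc
  convert! h.image (PiLp.continuous_toLp 2 (fun _ : Fin d => ℝ)) using 1
  ext x
  simp only [Set.mem_ofPred_eq, Set.mem_image, Set.mem_univ_pi]
  exact ⟨fun h => ⟨x.ofLp, h, rfl⟩, by rintro ⟨y, hy, rfl⟩; exact hy⟩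

lemma isCompact_cube (d : ℕ) (L : ℝ) : IsCompact (cube d L) := isCompact_setOf_forall_mem_Icc _ _

lemma isOpen_setOf_forall_mem_Ioo (a b : ℝ) :
    IsOpen {x : EuclideanSpace ℝ (Fin d) | ∀ i, x i ∈ Set.Ioo a b} := by
  have : {x : EuclideanSpace ℝ (Fin d) | ∀ i, x i ∈ Set.Ioo a b} =
      ⋂ i, {x : EuclideanSpace ℝ (Fin d) | x i ∈ Set.Ioo a b} := by ext; simp
  rw [this]
  exact isOpen_iInter_of_finite fun i => isOpen_Ioo.preimage (by fun_prop)

lemma setOf_forall_mem_Ioo_subset_interior_cube :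
    {x : EuclideanSpace ℝ (Fin d) | ∀ i, x i ∈ Set.Ioo (-(L / 2)) (L / 2)} ⊆
      interior (cube d L) :=
  interior_maximal (fun _ hx i => Set.Ioo_subset_Icc_self (hx i)) (isOpen_setOf_forall_mem_Ioo _ _)

/-- The faces are null. This matters because the cutoffs used below converge to `1` only on the open
cube. -/
lemma ae_cube_mem_Ioo (d : ℕ) (L : ℝ) :
    ∀ᵐ x ∂(volume.restrict (cube d L)), ∀ i, x i ∈ Set.Ioo (-(L / 2)) (L / 2) := by
  have h : ∀ᵐ y ∂(Measure.pi fun _ : Fin d => volume.restrict (Set.Icc (-(L / 2)) (L / 2))),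
      ∀ i, y i ∈ Set.Ioo (-(L / 2)) (L / 2) := by
    rw [ae_all_iff]
    intro i
    have h1 : ∀ᵐ t ∂(volume.restrict (Set.Icc (-(L / 2)) (L / 2))),
        t ∈ Set.Ioo (-(L / 2)) (L / 2) := by
      rw [← restrict_Ioo_eq_restrict_Icc]
      exact ae_restrict_mem measurableSet_Ioo
    exact (Measure.tendsto_eval_ae_ae (i := i)).eventually h1
  exact (measurePreserving_ofLp_cube d L).quasiMeasurePreserving.ae h

lemma Continuous.memLp_restrict_cube {f : EuclideanSpace ℝ (Fin d) → ℝ} (hf : Continuous f)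
    (p : ENNReal) : MemLp f p (volume.restrict (cube d L)) := by
  obtain ⟨C, hC⟩ := (isCompact_cube d L).exists_bound_of_continuousOn hf.continuousOn
  exact MemLp.of_bound hf.aestronglyMeasurable C
    ((ae_restrict_iff' (measurableSet_cube d L)).2 (ae_of_all _ hC))

/-! ### Weak gradients and Green's formula -/

lemma IsWeakGradient.congr {D : Set (EuclideanSpace ℝ (Fin d))}
    {f f' : EuclideanSpace ℝ (Fin d) → ℝ} {G : Fin d → EuclideanSpace ℝ (Fin d) → ℝ}
    (h : IsWeakGradient D f G) (hf : f =ᵐ[volume.restrict D] f') : IsWeakGradient D f' G where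
  memLp := h.memLp.ae_eq hf
  memLp_grad := h.memLp_grad
  weak_deriv i φ h1 h2 h3 := by
    rw [← h.weak_deriv i φ h1 h2 h3]
    refine integral_congr_ae ?_
    filter_upwards [hf] with x hx
    rw [hx]

/-- The field equation is tested on classes in `Lp`, whereas the cosines are genuine functions; this
passes between the two. -/
lemma IsNeumannEigenfunction.congr {D : Set (EuclideanSpace ℝ (Fin d))}
    {f f' : EuclideanSpace ℝ (Fin d) → ℝ} {lam : ℝ}
    (h : IsNeumannEigenfunction D f lam) (hf : f =ᵐ[volume.restrict D] f') :
    IsNeumannEigenfunction D f' lam := by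
  obtain ⟨G, H, h1, h2, h3, h4⟩ := h
  refine ⟨G, H, h1.congr hf, h2, ?_, fun φ Φ hφ => ?_⟩
  · filter_upwards [h3, hf] with x hx hx'
    rw [← hx, hx']
  · rw [h4 φ Φ hφ]
    congr 1
    refine integral_congr_ae ?_
    filter_upwards [hf] with x hx
    rw [hx]

/-- A smooth function has its classical gradient as a weak gradient. -/
lemma isWeakGradient_prodFun {f : Fin d → ℝ → ℝ} (hf : ∀ j, ContDiff ℝ (⊤ : ℕ∞) (f j)) :
    IsWeakGradient (cube d L) (prodFun f)
      (fun i => prodFun (Function.update f i (deriv (f i)))) := by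
  have hc : Continuous (prodFun f) := continuous_prodFun fun j => (hf j).continuous
  have hfd : ∀ j, Differentiable ℝ (f j) := fun j => (hf j).differentiable (by simp)
  have hc' : ∀ i, Continuous (prodFun (Function.update f i (deriv (f i)))) := fun i =>
    continuous_prodFun fun j => by
      rcases eq_or_ne j i with rfl | h
      · rw [Function.update_self]; exact (hf j).continuous_deriv (by simp)
      · rw [Function.update_of_ne h]; exact (hf j).continuous
  refine ⟨hc.memLp_restrict_cube 2, fun i => (hc' i).memLp_restrict_cube 2, fun i φ h1 h2 h3 => ?_⟩
  have hsub : tsupport φ ⊆ cube d L := h3.trans interior_subset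
  have hφ' : Continuous fun x => fderiv ℝ φ x (EuclideanSpace.single i 1) :=
    (h1.continuous_fderiv (by simp)).clm_apply continuous_const
  have hs' : HasCompactSupport fun x => fderiv ℝ φ x (EuclideanSpace.single i 1) :=
    h2.fderiv_apply (𝕜 := ℝ) _
  -- The test function is supported in the cube, so both integrals extend to the whole space, where
  -- integration by parts has no boundary term.
  have e1 : ∫ x in cube d L, prodFun f x * fderiv ℝ φ x (EuclideanSpace.single i 1) =
      ∫ x, prodFun f x * fderiv ℝ φ x (EuclideanSpace.single i 1) := by
    refine setIntegral_eq_integral_of_forall_compl_eq_zero fun x hx => ?_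
    have : x ∉ tsupport (fderiv ℝ φ) := fun h => hx (hsub (tsupport_fderiv_subset ℝ h))
    rw [image_eq_zero_of_notMem_tsupport this]; simp
  have e2 : ∫ x in cube d L, prodFun (Function.update f i (deriv (f i))) x * φ x =
      ∫ x, prodFun (Function.update f i (deriv (f i))) x * φ x := by
    refine setIntegral_eq_integral_of_forall_compl_eq_zero fun x hx => ?_
    rw [image_eq_zero_of_notMem_tsupport fun h => hx (hsub h), mul_zero]
  rw [e1, e2]
  simp_rw [← fderiv_prodFun_single hfd i]
  refine integral_mul_fderiv_eq_neg_fderiv_mul_of_integrable ?_ ?_ ?_ ?_ ?_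
  · refine Continuous.integrable_of_hasCompactSupport ?_ h2.mul_left
    simp_rw [fderiv_prodFun_single hfd i]
    exact (hc' i).mul h1.continuous
  · exact Continuous.integrable_of_hasCompactSupport (hc.mul hφ') hs'.mul_left
  · exact Continuous.integrable_of_hasCompactSupport (hc.mul h1.continuous) h2.mul_left
  · exact fun x _ => ((contDiff_prodFun hf).differentiable (by simp)) x
  · exact fun x _ => (h1.differentiable (by simp)) x

end ProdFun

/-! ### Integration by parts against `H¹` functions, by cutting off near the faces -/

section Green

variable {d : ℕ} {L : ℝ}

/-- A smooth function on `ℝ` supported in `[-(L/2) + 1/m, L/2 - 1/m]`, equal to `1` at distance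
more than `2/m` from the end points. -/
noncomputable def cutoff (L : ℝ) (m : ℕ) (x : ℝ) : ℝ :=
  Real.smoothTransition (m * (x + L / 2) - 1) * Real.smoothTransition (m * (L / 2 - x) - 1)

lemma contDiff_cutoff (L : ℝ) (m : ℕ) : ContDiff ℝ (⊤ : ℕ∞) (cutoff L m) := by
  refine ContDiff.mul ?_ ?_ <;>
  exact Real.smoothTransition.contDiff.comp (by fun_prop)

lemma abs_cutoff_le (L : ℝ) (m : ℕ) (x : ℝ) : |cutoff L m x| ≤ 1 := by
  rw [cutoff, abs_mul, abs_of_nonneg (Real.smoothTransition.nonneg _),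
    abs_of_nonneg (Real.smoothTransition.nonneg _)]
  exact mul_le_one₀ (Real.smoothTransition.le_one _) (Real.smoothTransition.nonneg _)
    (Real.smoothTransition.le_one _)

lemma mem_Icc_of_cutoff_ne_zero {m : ℕ} (hm : 0 < m) {x : ℝ} (h : cutoff L m x ≠ 0) :
    x ∈ Set.Icc (-(L / 2) + 1 / m) (L / 2 - 1 / m) := by
  have hm' : (0 : ℝ) < m := by exact_mod_cast hm
  rw [cutoff, mul_ne_zero_iff, Ne, Ne, Real.smoothTransition.zero_iff_nonpos,
    Real.smoothTransition.zero_iff_nonpos, not_le, not_le] at h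
  have h1 : 1 / (m : ℝ) < x + L / 2 := by rw [div_lt_iff₀' hm']; linarith [h.1]
  have h2 : 1 / (m : ℝ) < L / 2 - x := by rw [div_lt_iff₀' hm']; linarith [h.2]
  constructor <;> linarith

lemma deriv_smoothTransition_eq_zero {y : ℝ} (hy : y < 0 ∨ 1 < y) :
    deriv Real.smoothTransition y = 0 := by
  rcases hy with hy | hy
  · have : Real.smoothTransition =ᶠ[𝓝 y] fun _ => 0 := by
      filter_upwards [Iio_mem_nhds hy] with z hz
      exact Real.smoothTransition.zero_of_nonpos (le_of_lt hz)
    rw [this.deriv_eq, deriv_const]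
  · have : Real.smoothTransition =ᶠ[𝓝 y] fun _ => 1 := by
      filter_upwards [Ioi_mem_nhds hy] with z hz
      exact Real.smoothTransition.one_of_one_le (le_of_lt hz)
    rw [this.deriv_eq, deriv_const]

/-- At distance `a` from a face the cutoff has a derivative of size `m S'(m a - 1)`. With `y = m a -
1`, multiplying it by `a` gives `(y + 1) S'(y)`, so this bound is uniform in `m`. -/
lemma exists_bound_deriv_smoothTransition :
    ∃ C, ∀ y : ℝ, |(y + 1) * deriv Real.smoothTransition y| ≤ C := by
  have hc : Continuous fun y : ℝ => (y + 1) * deriv Real.smoothTransition y :=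
    (by fun_prop : Continuous fun y : ℝ => y + 1).mul
      ((Real.smoothTransition.contDiff (n := 1)).continuous_deriv le_rfl)
  refine hc.bounded_above_of_compact_support
    (HasCompactSupport.intro (isCompact_Icc (a := (0 : ℝ)) (b := 1)) fun y hy => ?_)
  rw [Set.mem_Icc, not_and_or, not_le, not_le] at hy
  rw [deriv_smoothTransition_eq_zero hy, mul_zero]

lemma hasDerivAt_cutoff (L : ℝ) (m : ℕ) (x : ℝ) :
    HasDerivAt (cutoff L m)
      (m * deriv Real.smoothTransition (m * (x + L / 2) - 1) *
          Real.smoothTransition (m * (L / 2 - x) - 1) -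
        m * deriv Real.smoothTransition (m * (L / 2 - x) - 1) *
          Real.smoothTransition (m * (x + L / 2) - 1)) x := by
  have hS : ∀ y, HasDerivAt Real.smoothTransition (deriv Real.smoothTransition y) y := fun y =>
    ((Real.smoothTransition.contDiff (n := 1)).differentiable one_ne_zero y).hasDerivAt
  have h1 : HasDerivAt (fun x : ℝ => m * (x + L / 2) - 1) (m : ℝ) x := by
    simpa using (((hasDerivAt_id x).add_const (L / 2)).const_mul (m : ℝ)).sub_const 1
  have h2 : HasDerivAt (fun x : ℝ => m * (L / 2 - x) - 1) (-m : ℝ) x := by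
    simpa using (((hasDerivAt_id x).const_sub (L / 2)).const_mul (m : ℝ)).sub_const 1
  have := ((hS _).comp x h1).mul ((hS _).comp x h2)
  refine this.congr_deriv ?_
  simp only [Function.comp_apply]
  ring

lemma eventually_lt_natCast_mul {a : ℝ} (ha : 0 < a) : ∀ᶠ m : ℕ in atTop, 1 < (m : ℝ) * a - 1 := by
  have h : Tendsto (fun m : ℕ => (m : ℝ) * a) atTop atTop :=
    tendsto_natCast_atTop_atTop.atTop_mul_const ha
  filter_upwards [h.eventually_gt_atTop 2] with m hm
  linarith

lemma tendsto_cutoff {x : ℝ} (hx : x ∈ Set.Ioo (-(L / 2)) (L / 2)) :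
    Tendsto (fun m => cutoff L m x) atTop (𝓝 1) := by
  refine tendsto_const_nhds.congr' ?_
  filter_upwards [eventually_lt_natCast_mul (a := x + L / 2) (by linarith [hx.1]),
    eventually_lt_natCast_mul (a := L / 2 - x) (by linarith [hx.2])] with m h1 h2
  rw [cutoff, Real.smoothTransition.one_of_one_le h1.le, Real.smoothTransition.one_of_one_le h2.le,
    one_mul]

lemma tendsto_deriv_cutoff {x : ℝ} (hx : x ∈ Set.Ioo (-(L / 2)) (L / 2)) :
    Tendsto (fun m => deriv (cutoff L m) x) atTop (𝓝 0) := by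
  refine tendsto_const_nhds.congr' ?_
  filter_upwards [eventually_lt_natCast_mul (a := x + L / 2) (by linarith [hx.1]),
    eventually_lt_natCast_mul (a := L / 2 - x) (by linarith [hx.2])] with m h1 h2
  rw [(hasDerivAt_cutoff L m x).deriv, deriv_smoothTransition_eq_zero (.inr h1),
    deriv_smoothTransition_eq_zero (.inr h2)]
  simp

/-- If `f` vanishes at the end points, then `f` times the derivative of the cutoff is bounded. -/
lemma exists_bound_mul_deriv_cutoff {f : ℝ → ℝ} (hf : ContDiff ℝ 1 f) (h0 : f (-(L / 2)) = 0)
    (h1 : f (L / 2) = 0) :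
    ∃ C, ∀ (m : ℕ), ∀ x ∈ Set.Icc (-(L / 2)) (L / 2), |f x * deriv (cutoff L m) x| ≤ C := by
  obtain ⟨C, hC⟩ := exists_bound_deriv_smoothTransition
  obtain ⟨K, hK⟩ := (isCompact_Icc (a := -(L / 2)) (b := L / 2)).exists_bound_of_continuousOn
    (hf.continuous_deriv le_rfl).continuousOn
  refine ⟨K * C + K * C, fun m x hx => ?_⟩
  have hL : -(L / 2) ≤ L / 2 := hx.1.trans hx.2
  have hb : ∀ y ∈ Set.Icc (-(L / 2)) (L / 2), |f x - f y| ≤ K * |x - y| := fun y hy =>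
    Convex.norm_image_sub_le_of_norm_deriv_le (fun z _ => hf.differentiable one_ne_zero z) hK
      (convex_Icc _ _) hy hx
  have hl := hb _ (Set.left_mem_Icc.2 hL)
  have hr := hb _ (Set.right_mem_Icc.2 hL)
  rw [h0, sub_zero, sub_neg_eq_add, abs_of_nonneg (by linarith [hx.1] : 0 ≤ x + L / 2)] at hl
  rw [h1, sub_zero, abs_sub_comm, abs_of_nonneg (by linarith [hx.2] : 0 ≤ L / 2 - x)] at hr
  have hK0 : 0 ≤ K := (norm_nonneg _).trans (hK x hx)
  -- Here `a` is the distance to one end point. Vanishing of `f` there gives `|f x| ≤ K a`, and the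
  -- factor `a` compensates the `m` from differentiating the cutoff.
  have key : ∀ a S : ℝ, |f x| ≤ K * a → 0 ≤ a → |S| ≤ 1 →
      |f x * (m * deriv Real.smoothTransition (m * a - 1) * S)| ≤ K * C := by
    intro a S h1 ha hS
    have h2 := hC (m * a - 1)
    rw [sub_add_cancel, abs_mul, abs_of_nonneg (by positivity)] at h2
    rw [abs_mul, abs_mul, abs_mul, Nat.abs_cast]
    calc |f x| * (m * |deriv Real.smoothTransition (m * a - 1)| * |S|)
        ≤ (K * a) * (m * |deriv Real.smoothTransition (m * a - 1)| * 1) := by gcongr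
      _ = K * (m * a * |deriv Real.smoothTransition (m * a - 1)|) := by ring
      _ ≤ K * C := by gcongr
  have hS : ∀ y, |Real.smoothTransition y| ≤ 1 := fun y => by
    rw [abs_of_nonneg (Real.smoothTransition.nonneg _)]; exact Real.smoothTransition.le_one _
  rw [(hasDerivAt_cutoff L m x).deriv, mul_sub]
  refine (abs_sub _ _).trans (add_le_add ?_ ?_)
  · exact key _ _ hl (by linarith [hx.1]) (hS _)
  · exact key _ _ hr (by linarith [hx.2]) (hS _)

lemma abs_prodFun_le {f : Fin d → ℝ → ℝ} {K : ℝ} (hf : ∀ j, ∀ y ∈ Set.Icc (-(L / 2)) (L / 2),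
    |f j y| ≤ K) {x : EuclideanSpace ℝ (Fin d)} (hx : x ∈ cube d L) :
    |prodFun f x| ≤ K ^ d := by
  rw [prodFun, Finset.abs_prod]
  calc ∏ j, |f j (x j)| ≤ ∏ _j : Fin d, K :=
        Finset.prod_le_prod (fun _ _ => abs_nonneg _) fun j _ => hf j _ (hx j)
    _ = K ^ d := by simp

/-- The integration by parts formula defining the weak gradient of `φ ∈ H¹` also holds for test
functions which only vanish on the two faces of the cube orthogonal to the `i`-th axis. -/
lemma IsWeakGradient.integral_mul_prodFun_update_deriv
    {φ : EuclideanSpace ℝ (Fin d) → ℝ} {Φ : Fin d → EuclideanSpace ℝ (Fin d) → ℝ}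
    (h : IsWeakGradient (cube d L) φ Φ) {f : Fin d → ℝ → ℝ}
    (hf : ∀ j, ContDiff ℝ (⊤ : ℕ∞) (f j)) (i : Fin d) (h0 : f i (-(L / 2)) = 0)
    (h1 : f i (L / 2) = 0) :
    ∫ x in cube d L, φ x * prodFun (Function.update f i (deriv (f i))) x =
      -∫ x in cube d L, Φ i x * prodFun f x := by
  -- All factors are cut off, so that the product is an admissible test function. The derivative
  -- falls on the `i`-th factor only, and it is there that vanishing at the end points controls the
  -- derivative of the cutoff as `m → ∞`.
  let g : ℕ → Fin d → ℝ → ℝ := fun m j y => f j y * cutoff L m y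
  have hg : ∀ m j, ContDiff ℝ (⊤ : ℕ∞) (g m j) := fun m j => (hf j).mul (contDiff_cutoff L m)
  have hg' : ∀ m j y, deriv (g m j) y = deriv (f j) y * cutoff L m y + f j y * deriv (cutoff L m) y :=
    fun m j y => deriv_fun_mul ((hf j).differentiable (by simp) y)
      ((contDiff_cutoff L m).differentiable (by simp) y)
  have hsupp : ∀ m, 0 < m → tsupport (prodFun (g m)) ⊆
      {x : EuclideanSpace ℝ (Fin d) | ∀ i, x i ∈ Set.Icc (-(L / 2) + 1 / m) (L / 2 - 1 / m)} := by
    intro m hm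
    refine closure_minimal (fun x hx j => ?_) (isCompact_setOf_forall_mem_Icc _ _).isClosed
    refine mem_Icc_of_cutoff_ne_zero hm fun hc => hx ?_
    exact Finset.prod_eq_zero (Finset.mem_univ j) (by simp [g, hc])
  have key : ∀ᶠ m : ℕ in atTop,
      ∫ x in cube d L, φ x * prodFun (Function.update (g m) i (deriv (g m i))) x =
      -∫ x in cube d L, Φ i x * prodFun (g m) x := by
    filter_upwards [eventually_gt_atTop 0] with m hm
    have hm' : (0 : ℝ) < 1 / m := by positivity
    have hsub : {x : EuclideanSpace ℝ (Fin d) |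
          ∀ i, x i ∈ Set.Icc (-(L / 2) + 1 / m) (L / 2 - 1 / m)} ⊆
        {x | ∀ i, x i ∈ Set.Ioo (-(L / 2)) (L / 2)} := by
      intro x hx j
      exact ⟨by linarith [(hx j).1], by linarith [(hx j).2]⟩
    have := h.weak_deriv i (prodFun (g m)) (contDiff_prodFun (hg m))
      (HasCompactSupport.of_support_subset_isCompact (isCompact_setOf_forall_mem_Icc _ _)
        ((subset_tsupport _).trans (hsupp m hm)))
      (((hsupp m hm).trans hsub).trans setOf_forall_mem_Ioo_subset_interior_cube)
    simpa only [fderiv_prodFun_single fun j => (hg m j).differentiable (by simp)] using this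
  obtain ⟨C, hC⟩ := exists_bound_mul_deriv_cutoff ((hf i).of_le (by simp)) h0 h1
  have hb : ∀ u : ℝ → ℝ, Continuous u → ∃ K, ∀ y ∈ Set.Icc (-(L / 2)) (L / 2), |u y| ≤ K :=
    fun u hu => (isCompact_Icc).exists_bound_of_continuousOn hu.continuousOn
  choose K hK using fun j => hb (f j) (hf j).continuous
  obtain ⟨K', hK'⟩ := hb _ ((hf i).continuous_deriv (by simp))
  -- One constant bounding every factor, differentiated or not, so that each product is at most `M ^
  -- d`.
  let M : ℝ := ∑ j, |K j| + (|K'| + |C|)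
  have hKM : ∀ j, K j ≤ M := fun j => by
    have := Finset.single_le_sum (f := fun j => |K j|) (fun j _ => abs_nonneg _) (Finset.mem_univ j)
    have h2 := le_abs_self (K j)
    have h3 := abs_nonneg K'
    have h4 := abs_nonneg C
    simp only [M]; linarith
  have hKM' : K' + C ≤ M := by
    have : 0 ≤ ∑ j, |K j| := Finset.sum_nonneg fun j _ => abs_nonneg _
    simp only [M]; linarith [le_abs_self K', le_abs_self C]
  have hgM : ∀ m j, ∀ y ∈ Set.Icc (-(L / 2)) (L / 2), |g m j y| ≤ M := fun m j y hy => by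
    rw [abs_mul]
    refine (mul_le_of_le_one_right (abs_nonneg _) (abs_cutoff_le _ _ _)).trans
      ((hK j y hy).trans (hKM j))
  have hgM' : ∀ m j, ∀ y ∈ Set.Icc (-(L / 2)) (L / 2),
      |Function.update (g m) i (deriv (g m i)) j y| ≤ M := fun m j y hy => by
    rcases eq_or_ne j i with rfl | hj
    · rw [Function.update_self, hg']
      refine (abs_add_le _ _).trans (le_trans (add_le_add ?_ (hC m y hy)) hKM')
      rw [abs_mul]
      exact (mul_le_of_le_one_right (abs_nonneg _) (abs_cutoff_le _ _ _)).trans (hK' y hy)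
    · rw [Function.update_of_ne hj]; exact hgM m j y hy
  have hcont : ∀ m j, Continuous (Function.update (g m) i (deriv (g m i)) j) := fun m j => by
    rcases eq_or_ne j i with rfl | hj
    · rw [Function.update_self]; exact (hg m j).continuous_deriv (by simp)
    · rw [Function.update_of_ne hj]; exact (hg m j).continuous
  have hdom : ∀ (ψ : EuclideanSpace ℝ (Fin d) → ℝ) (u : ℕ → Fin d → ℝ → ℝ) (v : Fin d → ℝ → ℝ),
      MemLp ψ 2 (volume.restrict (cube d L)) → (∀ m j, Continuous (u m j)) →
      (∀ m j, ∀ y ∈ Set.Icc (-(L / 2)) (L / 2), |u m j y| ≤ M) →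
      (∀ j, ∀ y ∈ Set.Ioo (-(L / 2)) (L / 2), Tendsto (fun m => u m j y) atTop (𝓝 (v j y))) →
      Tendsto (fun m => ∫ x in cube d L, ψ x * prodFun (u m) x) atTop
        (𝓝 (∫ x in cube d L, ψ x * prodFun v x)) := by
    intro ψ u v hψ hu hM ht
    refine tendsto_integral_of_dominated_convergence (fun x => |ψ x| * M ^ d)
      (fun m => hψ.1.mul (continuous_prodFun (hu m)).aestronglyMeasurable)
      ((hψ.integrable (by norm_num)).abs.mul_const _) (fun m => ?_) ?_
    · filter_upwards [ae_restrict_mem (measurableSet_cube d L)] with x hx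
      rw [Real.norm_eq_abs, abs_mul]
      exact mul_le_mul_of_nonneg_left (abs_prodFun_le (hM m) hx) (abs_nonneg _)
    · filter_upwards [ae_cube_mem_Ioo d L] with x hx
      exact (tendsto_finsetProd _ fun j _ => ht j _ (hx j)).const_mul _
  have t1 := hdom φ _ (Function.update f i (deriv (f i))) h.memLp hcont hgM' (fun j y hy => by
    rcases eq_or_ne j i with rfl | hj
    · simp only [Function.update_self, hg']
      simpa using ((tendsto_cutoff hy).const_mul (deriv (f j) y)).add
        ((tendsto_deriv_cutoff hy).const_mul (f j y))
    · simp only [Function.update_of_ne hj]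
      simpa [g] using (tendsto_cutoff hy).const_mul (f j y))
  have t2 := hdom (Φ i) g f (h.memLp_grad i) (fun m j => (hg m j).continuous) hgM (fun j y hy => by
    simpa [g] using (tendsto_cutoff hy).const_mul (f j y))
  exact tendsto_nhds_unique t1 (t2.neg.congr' (key.mono fun m hm => hm.symm))

end Green

/-! ## The cosine eigenfunctions of the Neumann Laplacian on the cube -/

section Eigenfunctions

variable {d : ℕ} {L : ℝ}

/-- Green's formula must hold against every `φ ∈ H¹`. In direction `i` it is integration by parts
with the product carrying `deriv (f i)`, a factor that vanishes on the two faces orthogonal to that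
axis by the Neumann condition. Neither traces nor density of smooth functions are needed. -/
lemma isNeumannEigenfunction_prodFun {f : Fin d → ℝ → ℝ} {c : Fin d → ℝ}
    (hf : ∀ j, ContDiff ℝ (⊤ : ℕ∞) (f j)) (hc : ∀ j, deriv (deriv (f j)) = fun y => -c j * f j y)
    (h0 : ∀ j, deriv (f j) (-(L / 2)) = 0) (h1 : ∀ j, deriv (f j) (L / 2) = 0) :
    IsNeumannEigenfunction (cube d L) (prodFun f) (∑ j, c j) := by
  let f' : Fin d → Fin d → ℝ → ℝ := fun i => Function.update f i (deriv (f i))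
  have hf' : ∀ i j, ContDiff ℝ (⊤ : ℕ∞) (f' i j) := fun i j => by
    rcases eq_or_ne j i with rfl | h
    · simp only [f', Function.update_self]
      exact ((contDiff_infty_iff_deriv (𝕜 := ℝ)).1 (hf j)).2
    · simp only [f', Function.update_of_ne h]; exact hf j
  have hH : ∀ i x, prodFun (Function.update (f' i) i (deriv (f' i i))) x = -c i * prodFun f x := by
    intro i x
    simp only [f', Function.update_idem, Function.update_self, hc, prodFun_update_const_mul]
  refine ⟨fun i => prodFun (f' i), fun i j => prodFun (Function.update (f' i) j (deriv (f' i j))),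
    isWeakGradient_prodFun hf, fun i => isWeakGradient_prodFun (hf' i), ae_of_all _ fun x => ?_,
    fun φ Φ hφ => ?_⟩
  · simp only [hH, ← Finset.sum_mul, Finset.sum_neg_distrib]
    ring
  · have hi : ∀ i, ∫ x in cube d L, prodFun (f' i) x * Φ i x =
        ∫ x in cube d L, c i * prodFun f x * φ x := fun i => by
      have := hφ.integral_mul_prodFun_update_deriv (hf' i) i (by simp [f', h0]) (by simp [f', h1])
      simp only [hH] at this
      rw [← neg_eq_iff_eq_neg, ← integral_neg] at this
      simp_rw [mul_comm _ (Φ i _)]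
      rw [← this]
      exact integral_congr_ae (ae_of_all _ fun x => by simp only; ring)
    have hφf : Integrable (fun x => prodFun f x * φ x) (volume.restrict (cube d L)) :=
      ((continuous_prodFun fun j => (hf j).continuous).memLp_restrict_cube 2).integrable_mul hφ.memLp
    rw [integral_finsetSum]
    · simp_rw [hi, mul_assoc, integral_const_mul]
      rw [← Finset.sum_mul, ← integral_neg]
      simp_rw [neg_mul, neg_neg, mul_assoc]
      rw [integral_const_mul]
    · exact fun i _ => ((continuous_prodFun fun j => (hf' i j).continuous).memLp_restrict_cube
        2).integrable_mul (hφ.memLp_grad i)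

/-- Both sides equal `∫ ∇f · ∇g`, by Green's formula applied in either order. Hence eigenfunctions
with different eigenvalues are orthogonal. -/
lemma IsNeumannEigenfunction.mul_integral_eq {D : Set (EuclideanSpace ℝ (Fin d))}
    {f g : EuclideanSpace ℝ (Fin d) → ℝ} {lam mu : ℝ} (hf : IsNeumannEigenfunction D f lam)
    (hg : IsNeumannEigenfunction D g mu) :
    lam * ∫ x in D, f x * g x = mu * ∫ x in D, f x * g x := by
  obtain ⟨F, _, hF, -, -, hF'⟩ := hf
  obtain ⟨G, _, hG, -, -, hG'⟩ := hg
  have h1 := hF' g G hG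
  have h2 := hG' f F hF
  simp_rw [mul_comm (G _ _) (F _ _)] at h2
  rw [h1] at h2
  simp_rw [neg_mul, integral_neg, neg_neg, mul_assoc, integral_const_mul] at h2
  rw [h2]
  simp_rw [mul_comm (g _) (f _)]

/-- The normalized one-dimensional Neumann eigenfunctions on `[-L/2, L/2]`. -/
noncomputable def cosFactor (L : ℝ) (n : ℕ) (x : ℝ) : ℝ :=
  √((if n = 0 then 1 else 2) / L) * Real.cos (n * Real.pi * (x / L + 1 / 2))

/-- The normalized Neumann eigenfunctions on the cube. -/
noncomputable def neumannCos (L : ℝ) (n : Fin d → ℕ) : EuclideanSpace ℝ (Fin d) → ℝ :=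
  prodFun fun j => cosFactor L (n j)

/-- The eigenvalue of `-Δ` for the eigenfunction `neumannCos L n`. -/
noncomputable def neumannEig (L : ℝ) (n : Fin d → ℕ) : ℝ := ∑ j, (n j * Real.pi / L) ^ 2

lemma contDiff_cosFactor (L : ℝ) (n : ℕ) : ContDiff ℝ (⊤ : ℕ∞) (cosFactor L n) := by
  refine contDiff_const.mul (Real.contDiff_cos.comp ?_)
  fun_prop

lemma continuous_neumannCos (L : ℝ) (n : Fin d → ℕ) : Continuous (neumannCos L n) :=
  continuous_prodFun fun j => (contDiff_cosFactor L (n j)).continuous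

lemma deriv_cosFactor (L : ℝ) (n : ℕ) : deriv (cosFactor L n) = fun x =>
    -(√((if n = 0 then 1 else 2) / L) * (n * Real.pi / L) *
      Real.sin (n * Real.pi * (x / L + 1 / 2))) := by
  funext x
  have h1 : HasDerivAt (fun x : ℝ => n * Real.pi * (x / L + 1 / 2)) (n * Real.pi * (1 / L)) x :=
    (((hasDerivAt_id x).div_const L).add_const (1 / 2)).const_mul _
  rw [show cosFactor L n = fun x => √((if n = 0 then 1 else 2) / L) *
    Real.cos (n * Real.pi * (x / L + 1 / 2)) from rfl, (h1.cos.const_mul _).deriv]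
  ring

lemma deriv_deriv_cosFactor (L : ℝ) (n : ℕ) : deriv (deriv (cosFactor L n)) = fun x =>
    -(n * Real.pi / L) ^ 2 * cosFactor L n x := by
  funext x
  have h1 : HasDerivAt (fun x : ℝ => n * Real.pi * (x / L + 1 / 2)) (n * Real.pi * (1 / L)) x :=
    (((hasDerivAt_id x).div_const L).add_const (1 / 2)).const_mul _
  rw [deriv_cosFactor, (h1.sin.const_mul _).fun_neg.deriv, cosFactor]
  ring

lemma isNeumannEigenfunction_neumannCos (hL : 0 < L) (n : Fin d → ℕ) :
    IsNeumannEigenfunction (cube d L) (neumannCos L n) (neumannEig L n) := by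
  refine isNeumannEigenfunction_prodFun (fun j => contDiff_cosFactor L _) (fun j => ?_)
    (fun j => ?_) fun j => ?_
  · rw [deriv_deriv_cosFactor]
  · rw [deriv_cosFactor]
    simp only
    rw [show -(L / 2) / L + 1 / 2 = 0 by field_simp; ring]
    simp
  · rw [deriv_cosFactor]
    simp only
    rw [show L / 2 / L + 1 / 2 = 1 by field_simp; norm_num]
    simp

lemma neumannEig_nonneg (L : ℝ) (n : Fin d → ℕ) : 0 ≤ neumannEig L n :=
  Finset.sum_nonneg fun _ _ => sq_nonneg _

lemma neumannEig_pos (hL : 0 < L) {n : Fin d → ℕ} (hn : n ≠ 0) : 0 < neumannEig L n := by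
  obtain ⟨j, hj⟩ := Function.ne_iff.1 hn
  have hj' : (0 : ℝ) < n j := by exact_mod_cast Nat.pos_of_ne_zero hj
  refine Finset.sum_pos' (fun _ _ => sq_nonneg _) ⟨j, Finset.mem_univ j, ?_⟩
  have := Real.pi_pos
  positivity

lemma neumannEig_zero (L : ℝ) : neumannEig L (0 : Fin d → ℕ) = 0 := by simp [neumannEig]

lemma abs_neumannCos_le (n : Fin d → ℕ) (x : EuclideanSpace ℝ (Fin d)) :
    |neumannCos L n x| ≤ √(2 / L) ^ d := by
  rw [neumannCos, prodFun, Finset.abs_prod]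
  calc ∏ j, |cosFactor L (n j) (x j)| ≤ ∏ _j : Fin d, √(2 / L) := by
        refine Finset.prod_le_prod (fun _ _ => abs_nonneg _) fun j _ => ?_
        rw [cosFactor, abs_mul, abs_of_nonneg (Real.sqrt_nonneg _)]
        refine (mul_le_of_le_one_right (Real.sqrt_nonneg _) (Real.abs_cos_le_one _)).trans ?_
        rcases le_or_gt L 0 with hL | hL
        -- For `L ≤ 0` the normalising constant is the square root of a nonpositive number, hence
        -- `0` by convention.
        · rw [Real.sqrt_eq_zero_of_nonpos]
          · exact Real.sqrt_nonneg _
          · exact div_nonpos_of_nonneg_of_nonpos (by split_ifs <;> norm_num) hL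
        · gcongr
          split_ifs <;> norm_num
    _ = _ := by rw [Finset.prod_const, Finset.card_univ, Fintype.card_fin]

lemma integral_cos_int_mul_pi (k : ℤ) :
    ∫ y in (0 : ℝ)..1, Real.cos (k * Real.pi * y) = if k = 0 then 1 else 0 := by
  split_ifs with h
  · simp [h]
  · have hk : (k : ℝ) * Real.pi ≠ 0 := mul_ne_zero (by exact_mod_cast h) Real.pi_ne_zero
    rw [intervalIntegral.integral_comp_mul_left (fun y => Real.cos y) hk, integral_cos]
    simp [Real.sin_int_mul_pi]

lemma integral_cosFactor_mul (hL : 0 < L) (n m : ℕ) :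
    ∫ x in Set.Icc (-(L / 2)) (L / 2), cosFactor L n x * cosFactor L m x =
      if n = m then 1 else 0 := by
  rw [integral_Icc_eq_integral_Ioc, ← intervalIntegral.integral_of_le (by linarith)]
  have h1 : ∫ x in (-(L / 2))..(L / 2), cosFactor L n x * cosFactor L m x =
      √((if n = 0 then 1 else 2) / L) * √((if m = 0 then 1 else 2) / L) * (L *
      ∫ y in (0 : ℝ)..1, Real.cos (n * Real.pi * y) * Real.cos (m * Real.pi * y)) := by
    have := intervalIntegral.integral_comp_div_add
      (fun y => Real.cos (n * Real.pi * y) * Real.cos (m * Real.pi * y)) hL.ne' (1 / 2)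
      (a := -(L / 2)) (b := L / 2)
    rw [show -(L / 2) / L + 1 / 2 = 0 by field_simp; ring,
      show L / 2 / L + 1 / 2 = 1 by field_simp; norm_num, smul_eq_mul] at this
    rw [← this, ← intervalIntegral.integral_const_mul]
    refine intervalIntegral.integral_congr fun x _ => ?_
    simp only [cosFactor]
    ring
  -- Product-to-sum formula. The second indicator is nonzero only for `n = m = 0`, which is why the
  -- constant mode is normalised by `1` and the others by `2`.
  have h2 : ∫ y in (0 : ℝ)..1, Real.cos (n * Real.pi * y) * Real.cos (m * Real.pi * y) =
      ((if (n - m : ℤ) = 0 then 1 else 0) + (if (n + m : ℤ) = 0 then 1 else 0)) / 2 := by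
    rw [← integral_cos_int_mul_pi, ← integral_cos_int_mul_pi, ← intervalIntegral.integral_add
      (Continuous.intervalIntegrable (by fun_prop) _ _)
      (Continuous.intervalIntegrable (by fun_prop) _ _), ← intervalIntegral.integral_div]
    refine intervalIntegral.integral_congr fun y _ => ?_
    push_cast
    rw [show ((n : ℝ) - m) * Real.pi * y = n * Real.pi * y - m * Real.pi * y by ring,
      show ((n : ℝ) + m) * Real.pi * y = n * Real.pi * y + m * Real.pi * y by ring,
      Real.cos_add, Real.cos_sub]
    ring
  rw [h1, h2]
  rcases eq_or_ne n m with rfl | hnm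
  · rcases eq_or_ne n 0 with rfl | hn
    · rw [Real.mul_self_sqrt (by positivity)]
      simp [hL.ne']
    · rw [Real.mul_self_sqrt (by rw [if_neg hn]; positivity)]
      have : (n + n : ℤ) ≠ 0 := by omega
      simp only [hn, this, if_false, sub_self, if_true]
      field_simp
      norm_num
  · have h3 : (n - m : ℤ) ≠ 0 := by omega
    have h4 : (n + m : ℤ) ≠ 0 := by omega
    simp [hnm, h3, h4]

lemma integral_neumannCos_mul (hL : 0 < L) (n m : Fin d → ℕ) :
    ∫ x in cube d L, neumannCos L n x * neumannCos L m x = if n = m then 1 else 0 := by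
  have : ∀ x, neumannCos L n x * neumannCos L m x =
      prodFun (fun j y => cosFactor L (n j) y * cosFactor L (m j) y) x := fun x => by
    simp only [neumannCos, prodFun, Finset.prod_mul_distrib]
  simp_rw [this, integral_cube_prodFun, integral_cosFactor_mul hL]
  split_ifs with h
  · simp [h]
  · obtain ⟨j, hj⟩ := Function.ne_iff.1 h
    exact Finset.prod_eq_zero (Finset.mem_univ j) (by simp [hj])

/-! ### Polynomials in the cosines -/

/-- The point of `[-1, 1]^d` with coordinates `cos (π (xⱼ / L + 1 / 2))`. -/
noncomputable def cosCoord (L : ℝ) (x : EuclideanSpace ℝ (Fin d)) (j : Fin d) : ℝ :=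
  Real.cos (Real.pi * (x j / L + 1 / 2))

/-- This is `2 cos(nθ) cos θ = cos((n+1)θ) + cos((n-1)θ)` up to normalisation, with `n = 0` apart
because `n - 1` is then not an index. It makes the span of the cosines stable under multiplication
by `cosCoord`. -/
lemma cosFactor_mul_cos_mem (L : ℝ) (n : ℕ) : ∃ a b : ℝ, ∃ k l : ℕ, ∀ x,
    cosFactor L n x * Real.cos (Real.pi * (x / L + 1 / 2)) =
      a * cosFactor L k x + b * cosFactor L l x := by
  have key : ∀ n k : ℕ, ∃ a : ℝ, ∀ x, √((if n = 0 then 1 else 2) / L) *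
      Real.cos (k * Real.pi * (x / L + 1 / 2)) = a * cosFactor L k x := by
    intro n k
    rcases le_or_gt L 0 with hL | hL
    · refine ⟨0, fun x => ?_⟩
      rw [Real.sqrt_eq_zero_of_nonpos]
      · simp
      · exact div_nonpos_of_nonneg_of_nonpos (by split_ifs <;> norm_num) hL
    · have hk : 0 < √((if k = 0 then 1 else 2) / L) :=
        Real.sqrt_pos.2 (div_pos (by split_ifs <;> norm_num) hL)
      refine ⟨√((if n = 0 then 1 else 2) / L) / √((if k = 0 then 1 else 2) / L), fun x => ?_⟩
      rw [cosFactor, ← mul_assoc, div_mul_cancel₀ _ hk.ne']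
  rcases n with _ | n
  · obtain ⟨a, ha⟩ := key 0 1
    refine ⟨a, 0, 1, 0, fun x => ?_⟩
    rw [← ha, cosFactor]
    simp
  · obtain ⟨a, ha⟩ := key (n + 1) (n + 2)
    obtain ⟨b, hb⟩ := key (n + 1) n
    refine ⟨a / 2, b / 2, n + 2, n, fun x => ?_⟩
    rw [div_mul_eq_mul_div, div_mul_eq_mul_div, ← ha, ← hb, cosFactor]
    push_cast
    rw [show ((n : ℝ) + 2) * Real.pi * (x / L + 1 / 2) = (n + 1) * Real.pi * (x / L + 1 / 2) +
      Real.pi * (x / L + 1 / 2) by ring, show (n : ℝ) * Real.pi * (x / L + 1 / 2) =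
      (n + 1) * Real.pi * (x / L + 1 / 2) - Real.pi * (x / L + 1 / 2) by ring, Real.cos_add,
      Real.cos_sub]
    ring

/-- Induction on the polynomial, each variable raising or lowering one index. Polynomials give
access both to Stone–Weierstrass and to the independence of multiplicative functionals. -/
lemma eval_cosCoord_mem_span (hL : 0 < L) (p : MvPolynomial (Fin d) ℝ) :
    (fun x => MvPolynomial.eval (cosCoord L x) p) ∈
      Submodule.span ℝ (Set.range (neumannCos (d := d) L)) := by
  induction p using MvPolynomial.induction_on with
  | C a =>
    have h1 : (fun x => MvPolynomial.eval (cosCoord L x) (MvPolynomial.C a)) =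
        (a / √(1 / L) ^ d) • neumannCos (d := d) L 0 := by
      funext x
      have : √(1 / L) ^ d ≠ 0 := pow_ne_zero _ (Real.sqrt_pos.2 (by positivity)).ne'
      have h2 : neumannCos (d := d) L 0 x = √(1 / L) ^ d := by
        simp [neumannCos, prodFun, cosFactor]
      rw [Pi.smul_apply, h2, smul_eq_mul, div_mul_cancel₀ _ this, MvPolynomial.eval_C]
    rw [h1]
    exact Submodule.smul_mem _ _ (Submodule.subset_span ⟨0, rfl⟩)
  | add p q hp hq =>
    simp only [map_add]
    exact Submodule.add_mem _ hp hq
  | mul_X p j hp =>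
    simp only [map_mul, MvPolynomial.eval_X]
    change (fun x => MvPolynomial.eval (cosCoord L x) p) * (fun x => cosCoord L x j) ∈ _
    generalize (fun x => MvPolynomial.eval (cosCoord L x) p) = g at hp
    induction hp using Submodule.span_induction with
    | mem g hg =>
      obtain ⟨n, rfl⟩ := hg
      obtain ⟨a, b, k, l, h⟩ := cosFactor_mul_cos_mem L (n j)
      have hu : ∀ k x, neumannCos L (Function.update n j k) x =
          cosFactor L k (x j) * ∏ i ∈ Finset.univ.erase j, cosFactor L (n i) (x i) := by
        intro k x
        rw [← prodFun_update (fun i => cosFactor L (n i)), neumannCos]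
        congr 1
        funext i
        rcases eq_or_ne i j with rfl | hij
        · simp
        · simp [Function.update_of_ne hij]
      have : neumannCos L n * (fun x => cosCoord L x j) =
          a • neumannCos L (Function.update n j k) + b • neumannCos L (Function.update n j l) := by
        funext x
        have h0 := hu (n j) x
        rw [Function.update_eq_self] at h0
        simp only [Pi.mul_apply, Pi.add_apply, Pi.smul_apply, smul_eq_mul, hu, h0, cosCoord]
        linear_combination (∏ i ∈ Finset.univ.erase j, cosFactor L (n i) (x i)) * h (x j)
      rw [this]
      exact Submodule.add_mem _ (Submodule.smul_mem _ _ (Submodule.subset_span ⟨_, rfl⟩))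
        (Submodule.smul_mem _ _ (Submodule.subset_span ⟨_, rfl⟩))
    | zero => rw [zero_mul]; exact Submodule.zero_mem _
    | add f g _ _ hf hg => rw [add_mul]; exact Submodule.add_mem _ hf hg
    | smul c f _ hf => rw [smul_mul_assoc]; exact Submodule.smul_mem _ _ hf

lemma angle_mem_Icc (hL : 0 < L) {t : ℝ} (ht : t ∈ Set.Icc (-(L / 2)) (L / 2)) :
    Real.pi * (t / L + 1 / 2) ∈ Set.Icc 0 Real.pi := by
  have h1 : 0 ≤ t / L + 1 / 2 := by
    rw [show t / L + 1 / 2 = (t + L / 2) / L by field_simp]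
    exact div_nonneg (by linarith [ht.1]) hL.le
  have h2 : t / L + 1 / 2 ≤ 1 := by
    rw [show t / L + 1 / 2 = (t + L / 2) / L by field_simp, div_le_one hL]
    linarith [ht.2]
  exact ⟨mul_nonneg Real.pi_pos.le h1, mul_le_of_le_one_right Real.pi_pos.le h2⟩

lemma arccos_cosCoord (hL : 0 < L) {x : EuclideanSpace ℝ (Fin d)} (hx : x ∈ cube d L) (j : Fin d) :
    L * (Real.arccos (cosCoord L x j) / Real.pi - 1 / 2) = x j := by
  have h := angle_mem_Icc hL (hx j)
  rw [cosCoord, Real.arccos_cos h.1 h.2]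
  field_simp
  ring

/-- The functions `neumannCos L n` separate signed point measures on the cube. -/
lemma eq_zero_of_forall_sum_mul_neumannCos (hL : 0 < L) {k : ℕ}
    {s : Fin k → EuclideanSpace ℝ (Fin d)} (hs : ∀ i, s i ∈ cube d L)
    (hinj : Function.Injective s) {c : Fin k → ℝ}
    (h : ∀ n, ∑ i, c i * neumannCos L n (s i) = 0) : c = 0 := by
  have hspan : ∀ g ∈ Submodule.span ℝ (Set.range (neumannCos (d := d) L)),
      ∑ i, c i * g (s i) = 0 := by
    intro g hg
    induction hg using Submodule.span_induction with
    | mem g hg => obtain ⟨n, rfl⟩ := hg; exact h n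
    | zero => simp
    | add f g _ _ hf hg => simp only [Pi.add_apply, mul_add, Finset.sum_add_distrib, hf, hg, add_zero]
    | smul a f _ hf =>
      simp only [Pi.smul_apply, smul_eq_mul, mul_left_comm _ a, ← Finset.mul_sum, hf, mul_zero]
  -- Evaluations at distinct points are distinct monoid homomorphisms, hence linearly independent by
  -- Dedekind's lemma.
  let ev : Fin k → MvPolynomial (Fin d) ℝ →* ℝ := fun i =>
    (MvPolynomial.eval (cosCoord L (s i)) : MvPolynomial (Fin d) ℝ →+* ℝ)
  have hev : Function.Injective ev := by
    intro a b hab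
    refine hinj (PiLp.ext fun j => ?_)
    have := DFunLike.congr_fun hab (MvPolynomial.X j)
    replace this : cosCoord L (s a) j = cosCoord L (s b) j := by simpa [ev] using this
    rw [← arccos_cosCoord hL (hs a) j, ← arccos_cosCoord hL (hs b) j, this]
  have hli := (linearIndependent_monoidHom (MvPolynomial (Fin d) ℝ) ℝ).comp ev hev
  rw [Fintype.linearIndependent_iff] at hli
  funext i
  refine hli c (funext fun p => ?_) i
  have := hspan _ (eval_cosCoord_mem_span hL p)
  simpa [ev, Finset.sum_apply] using this

/-- The map `cosCoord L` identifies the cube with `[-1, 1]^d`, with continuous inverse given by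
`arccos`. The claim becomes Stone–Weierstrass for polynomials on that box. -/
lemma exists_eval_cosCoord_near (hL : 0 < L) {g : EuclideanSpace ℝ (Fin d) → ℝ}
    (hg : Continuous g) {ε : ℝ} (hε : 0 < ε) :
    ∃ p : MvPolynomial (Fin d) ℝ, ∀ x ∈ cube d L, |MvPolynomial.eval (cosCoord L x) p - g x| < ε := by
  let X : Fin d → C(Fin d → ℝ, ℝ) := fun j => ⟨fun y => y j, continuous_apply j⟩
  let A : Subalgebra ℝ C(Fin d → ℝ, ℝ) := (MvPolynomial.aeval X).range
  have hA : A.SeparatesPoints := by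
    intro y z hyz
    obtain ⟨j, hj⟩ := Function.ne_iff.1 hyz
    exact ⟨X j, ⟨X j, ⟨MvPolynomial.X j, by simp⟩, rfl⟩, hj⟩
  let G : C(Fin d → ℝ, ℝ) := ⟨fun y => g (WithLp.toLp 2 fun j =>
    L * (Real.arccos (y j) / Real.pi - 1 / 2)), hg.comp ((PiLp.continuous_toLp 2 _).comp
      (continuous_pi fun j => by have := Real.continuous_arccos; fun_prop))⟩
  obtain ⟨q, ⟨p, rfl⟩, hq⟩ :=
    ContinuousMap.exists_mem_subalgebra_near_continuous_of_isCompact_of_separatesPoints hA G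
      (isCompact_univ_pi fun _ : Fin d => isCompact_Icc (a := (-1 : ℝ)) (b := 1)) hε
  refine ⟨p, fun x hx => ?_⟩
  have h1 := hq (cosCoord L x) (Set.mem_univ_pi.2 fun j => Real.cos_mem_Icc _)
  have h2 : (MvPolynomial.aeval X p : C(Fin d → ℝ, ℝ)) (cosCoord L x) =
      MvPolynomial.eval (cosCoord L x) p := by
    clear hq h1
    induction p using MvPolynomial.induction_on with
    | C a => simp
    | add p q hp hq => rw [map_add, ContinuousMap.add_apply, hp, hq, map_add]
    | mul_X p j hp => rw [map_mul, ContinuousMap.mul_apply, hp]; simp [X]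
  have h3 : G (cosCoord L x) = g x := by
    change g _ = g x
    congr 1
    refine PiLp.ext fun j => ?_
    simpa using arccos_cosCoord hL hx j
  rw [← h2, ← h3]
  exact h1

/-- The cosine system is complete in `L²` of the cube. -/
lemma ae_eq_zero_of_forall_integral_mul_neumannCos (hL : 0 < L)
    {f : EuclideanSpace ℝ (Fin d) → ℝ} (hf : MemLp f 2 (volume.restrict (cube d L)))
    (h : ∀ n, ∫ x in cube d L, f x * neumannCos L n x = 0) :
    f =ᵐ[volume.restrict (cube d L)] 0 := by
  have hfi : Integrable f (volume.restrict (cube d L)) := hf.integrable (by norm_num)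
  have hint : ∀ g : EuclideanSpace ℝ (Fin d) → ℝ, Continuous g →
      Integrable (fun x => f x * g x) (volume.restrict (cube d L)) := fun g hg =>
    hf.integrable_mul (hg.memLp_restrict_cube 2)
  have hspan : ∀ g ∈ Submodule.span ℝ (Set.range (neumannCos (d := d) L)),
      Continuous g ∧ ∫ x in cube d L, f x * g x = 0 := by
    intro g hg
    induction hg using Submodule.span_induction with
    | mem g hg => obtain ⟨n, rfl⟩ := hg; exact ⟨continuous_neumannCos L n, h n⟩
    | zero => exact ⟨continuous_const, by simp⟩
    | add g g' _ _ hg hg' =>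
      refine ⟨hg.1.add hg'.1, ?_⟩
      simp only [Pi.add_apply, mul_add]
      rw [integral_add (hint g hg.1) (hint g' hg'.1), hg.2, hg'.2, add_zero]
    | smul a g _ hg =>
      refine ⟨hg.1.const_smul a, ?_⟩
      simp only [Pi.smul_apply, smul_eq_mul, mul_left_comm _ a, integral_const_mul, hg.2, mul_zero]
  have hcont : ∀ g : EuclideanSpace ℝ (Fin d) → ℝ, Continuous g →
      ∫ x in cube d L, f x * g x = 0 := by
    intro g hg
    rw [← abs_nonpos_iff]
    refine le_of_forall_pos_le_add fun ε hε => ?_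
    set M := ∫ x in cube d L, |f x|
    have hM : 0 ≤ M := integral_nonneg fun _ => abs_nonneg _
    obtain ⟨p, hp⟩ := exists_eval_cosCoord_near hL hg (ε := ε / (M + 1)) (by positivity)
    obtain ⟨h1, h2⟩ := hspan _ (eval_cosCoord_mem_span hL p)
    have h3 : ∫ x in cube d L, f x * g x =
        ∫ x in cube d L, f x * (g x - MvPolynomial.eval (cosCoord L x) p) := by
      simp_rw [mul_sub]
      rw [integral_sub (hint g hg) (hint _ h1), h2, sub_zero]
    rw [h3, zero_add]
    refine (abs_integral_le_integral_abs).trans ?_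
    calc ∫ x in cube d L, |f x * (g x - MvPolynomial.eval (cosCoord L x) p)|
        ≤ ∫ x in cube d L, |f x| * (ε / (M + 1)) := by
          refine setIntegral_mono_on (hint _ (hg.sub h1)).abs (hfi.abs.mul_const _)
            (measurableSet_cube d L) fun x hx => ?_
          rw [abs_mul, abs_sub_comm (g x)]
          exact mul_le_mul_of_nonneg_left (hp x hx).le (abs_nonneg _)
      _ = M * (ε / (M + 1)) := by rw [integral_mul_const]
      _ ≤ ε := by
        rw [mul_div_assoc', div_le_iff₀ (by positivity)]
        nlinarith
  -- Extension by zero allows testing against smooth functions on all of `ℝ^d`.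
  have hind : ∀ᵐ x, (cube d L).indicator f x = 0 := by
    refine ae_eq_zero_of_integral_contDiff_smul_eq_zero
      ((integrable_indicator_iff (measurableSet_cube d L)).2 hfi).locallyIntegrable
      fun g hg _ => ?_
    rw [← hcont g hg.continuous, ← integral_indicator (measurableSet_cube d L)]
    refine integral_congr_ae (ae_of_all _ fun x => ?_)
    by_cases hx : x ∈ cube d L <;> simp [hx, mul_comm]
  refine (ae_restrict_iff' (measurableSet_cube d L)).2 ?_
  filter_upwards [hind] with x hx hxD
  simpa [hxD] using hx

end Eigenfunctions

/-! ## Measurable versions of orthogonal series -/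

section MeasurableVersion

lemma Orthonormal.norm_sum_smul_sq {E ι : Type*} [NormedAddCommGroup E] [InnerProductSpace ℝ E]
    {v : ι → E} (hv : Orthonormal ℝ v) (c : ι → ℝ) (F : Finset ι) :
    ‖∑ n ∈ F, c n • v n‖ ^ 2 = ∑ n ∈ F, c n ^ 2 := by
  rw [← real_inner_self_eq_norm_sq, hv.inner_sum]
  simp [pow_two]

/-- If the partial sums of an orthogonal series converge uniformly in the parameter `x`, the sum
has a jointly measurable version. -/
lemma exists_measurable_version {X Ω ι : Type*} [MeasurableSpace X] [MeasurableSpace Ω]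
    {P : Measure Ω} {ξ : ι → Lp ℝ 2 P} (hξ : Orthonormal ℝ ξ) {a : ι → ℝ}
    (ha : Summable fun n => a n ^ 2) {e : ι → X → ℝ} (he : ∀ n, Measurable (e n)) {M : ℝ}
    (hM : ∀ n x, |e n x| ≤ M) {U : X → Lp ℝ 2 P}
    (hU : ∀ x, HasSum (fun n => (a n * e n x) • ξ n) (U x)) :
    ∃ u : X → Ω → ℝ, Measurable (Function.uncurry u) ∧ ∀ x, u x =ᵐ[P] U x := by
  classical
  -- The coefficients outside `F k` have square sum at most `4^(-k)`. The partial sums are then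
  -- within `|M| 2^(-k)` of `U x` in `L²`, uniformly in `x`; summability in `k` gives almost sure
  -- convergence for every `x` along one and the same sequence.
  have hchoice : ∀ k : ℕ, ∃ F : Finset ι, ∀ t : Finset ι, Disjoint t F →
      ‖∑ n ∈ t, a n ^ 2‖ < ((1 / 2 : ℝ) ^ k) ^ 2 := fun k =>
    summable_iff_vanishing_norm.1 ha _ (by positivity)
  choose F hF using hchoice
  let S : ℕ → X → Ω → ℝ := fun k x ω => ∑ n ∈ F k, a n * e n x * ξ n ω
  have hS : ∀ k, Measurable (Function.uncurry (S k)) := fun k => by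
    refine Finset.measurable_sum _ fun n _ => ?_
    have h1 := (Lp.stronglyMeasurable (ξ n)).measurable
    exact ((measurable_const.mul ((he n).comp measurable_fst))).mul (h1.comp measurable_snd)
  let V : ℕ → X → Lp ℝ 2 P := fun k x => ∑ n ∈ F k, (a n * e n x) • ξ n
  have hV : ∀ k x, S k x =ᵐ[P] V k x := fun k x => by
    have h1 : ∀ᵐ ω ∂P, ∀ n ∈ F k, ((a n * e n x) • ξ n : Lp ℝ 2 P) ω = a n * e n x * ξ n ω := by
      rw [Finset.eventually_all]
      intro n _
      filter_upwards [Lp.coeFn_smul (a n * e n x) (ξ n)] with ω h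
      rw [h, Pi.smul_apply, smul_eq_mul]
    filter_upwards [h1, Lp.coeFn_finsetSum (F k) fun n => (a n * e n x) • ξ n] with ω h2 h3
    rw [h3, Finset.sum_apply]
    exact (Finset.sum_congr rfl h2).symm
  have hnorm : ∀ k x, ‖V k x - U x‖ ≤ |M| * (1 / 2) ^ k := by
    intro k x
    rw [norm_sub_rev]
    have ht : Tendsto (fun F' : Finset ι => ‖∑ n ∈ F', (a n * e n x) • ξ n - V k x‖) atTop
        (𝓝 ‖U x - V k x‖) := ((hU x).sub_const (V k x)).norm
    refine le_of_tendsto ht ?_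
    filter_upwards [eventually_ge_atTop (F k)] with F' hF'
    rw [← Finset.sum_sdiff hF', add_sub_cancel_right]
    refine abs_le_of_sq_le_sq' ?_ (by positivity) |>.2
    rw [hξ.norm_sum_smul_sq, mul_pow, sq_abs]
    calc ∑ n ∈ F' \ F k, (a n * e n x) ^ 2 ≤ ∑ n ∈ F' \ F k, M ^ 2 * a n ^ 2 := by
          refine Finset.sum_le_sum fun n _ => ?_
          rw [mul_pow, mul_comm]
          have := sq_le_sq' (abs_le.1 (hM n x)).1 (abs_le.1 (hM n x)).2
          gcongr
      _ = M ^ 2 * ∑ n ∈ F' \ F k, a n ^ 2 := by rw [Finset.mul_sum]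
      _ ≤ M ^ 2 * ((1 / 2) ^ k) ^ 2 := by
        gcongr
        exact (le_abs_self _).trans (hF k _ Finset.sdiff_disjoint).le
  -- The upper limit is jointly measurable without reference to the exceptional null sets, and
  -- equals the limit wherever there is one.
  refine ⟨fun x ω => limsup (fun k => S k x ω) atTop, Measurable.limsup hS, fun x => ?_⟩
  have hsum : Summable fun k => ‖V k x - U x‖ :=
    Summable.of_nonneg_of_le (fun _ => norm_nonneg _) (hnorm · x)
      (summable_geometric_two.mul_left _)
  have h1 : ∑' k, ‖V k x - U x‖ₑ ≠ ⊤ := by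
    simp_rw [← ofReal_norm]
    rw [← ENNReal.ofReal_tsum_of_nonneg (fun _ => norm_nonneg _) hsum]
    exact ENNReal.ofReal_ne_top
  have h2 := Lp.hasSum_coeFn_tsum h1
  have h3 : ∀ᵐ ω ∂P, ∀ k, (V k x - U x : Lp ℝ 2 P) ω = S k x ω - U x ω := by
    rw [ae_all_iff]
    intro k
    filter_upwards [Lp.coeFn_sub (V k x) (U x), hV k x] with ω h4 h5
    rw [h4, Pi.sub_apply, h5]
  filter_upwards [h2, h3] with ω h4 h5
  have h6 := h4.summable.tendsto_atTop_zero
  simp_rw [h5] at h6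
  refine Tendsto.limsup_eq ?_
  simpa using h6.add_const (U x ω)

end MeasurableVersion

/-! ## The series representation on the cube -/

section Coefficients

variable {d : ℕ} {L : ℝ}

/-- The symbol `λ^(β/2) (κ² + λ)^(α/2)` of the operator. -/
noncomputable def wmSymbol (κ α β lam : ℝ) : ℝ := lam ^ (β / 2) * (κ ^ 2 + lam) ^ (α / 2)

/-- The coefficients of the intrinsic Whittle–Matérn field along the normalized eigenfunctions. -/
noncomputable def wmCoeff (κ τ α β L : ℝ) (n : Fin d → ℕ) : ℝ :=
  if n = 0 then 0 else τ⁻¹ * (wmSymbol κ α β (neumannEig L n))⁻¹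

/-- The variogram of the intrinsic Whittle–Matérn field on the cube. -/
noncomputable def wmVariogram (κ τ α β L : ℝ) (s t : EuclideanSpace ℝ (Fin d)) : ℝ :=
  ∑' n : Fin d → ℕ, (wmCoeff κ τ α β L n * (neumannCos L n s - neumannCos L n t)) ^ 2

lemma wmSymbol_pos (κ α β : ℝ) {lam : ℝ} (h : 0 < lam) : 0 < wmSymbol κ α β lam := by
  have : 0 < κ ^ 2 + lam := by positivity
  unfold wmSymbol; positivity

lemma wmCoeff_ne_zero (κ α β : ℝ) {τ : ℝ} (hτ : 0 < τ) (hL : 0 < L) {n : Fin d → ℕ} (hn : n ≠ 0) :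
    wmCoeff κ τ α β L n ≠ 0 := by
  rw [wmCoeff, if_neg hn]
  have := wmSymbol_pos κ α β (neumannEig_pos hL hn)
  positivity

lemma wmSymbol_sq (κ α β : ℝ) {lam : ℝ} (h : 0 ≤ lam) :
    wmSymbol κ α β lam ^ 2 = lam ^ β * (κ ^ 2 + lam) ^ α := by
  have : 0 ≤ κ ^ 2 + lam := by positivity
  rw [wmSymbol, mul_pow, ← Real.rpow_natCast, ← Real.rpow_natCast, ← Real.rpow_mul h,
    ← Real.rpow_mul this]
  norm_num

/-- A subsum of the convergent lattice sum over `ℤ^d`. -/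
lemma summable_norm_natCast_rpow (d : ℕ) {r : ℝ} (hr : r < -(d : ℝ)) :
    Summable fun n : Fin d → ℕ => ‖(fun j => (n j : ℝ))‖ ^ r := by
  let Λ := Submodule.span ℤ (Set.range (Pi.basisFun ℝ (Fin d)))
  have hrank : Module.finrank ℤ Λ = d := by
    rw [ZLattice.rank ℝ Λ]; simp
  have h1 := ZLattice.summable_norm_rpow Λ r (by rw [hrank]; exact hr)
  have hmem : ∀ n : Fin d → ℕ, (fun j => (n j : ℝ)) ∈ Λ := fun n => by
    have : (fun j => (n j : ℝ)) = ∑ j, (n j : ℤ) • Pi.basisFun ℝ (Fin d) j := by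
      funext i
      simp [Pi.single_apply]
    rw [this]
    exact Submodule.sum_mem _ fun j _ => Submodule.smul_mem _ _ (Submodule.subset_span ⟨j, rfl⟩)
  have hinj : Function.Injective fun n : Fin d → ℕ => (⟨fun j => (n j : ℝ), hmem n⟩ : Λ) := by
    intro n m h
    funext j
    have h2 : (n j : ℝ) = m j := congrFun (congrArg Subtype.val h) j
    exact_mod_cast h2
  refine (h1.comp_injective hinj).congr fun n => ?_
  rw [Function.comp_apply, Submodule.coe_norm]

/-- For `n ≠ 0` the eigenvalue is at least `(π/L)² |n|²`, so `a_n²` is at most a constant times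
`|n|^(-2(α+β))`, whose exponent exceeds `d`. The spectral gap at fixed `L` makes conditions at low
frequency unnecessary here. -/
lemma summable_wmCoeff_sq (κ τ α β : ℝ) (hαβ : (d : ℝ) / 2 < α + β) (hL : 0 < L) :
    Summable fun n : Fin d → ℕ => wmCoeff κ τ α β L n ^ 2 := by
  have hpi := Real.pi_pos
  set c : ℝ := (Real.pi / L) ^ 2 with hc
  have hc0 : 0 < c := by positivity
  -- As `lam ≥ c` for `n ≠ 0`, this `K` bounds `(κ² + lam) / lam`; the power `K ^ |α|` covers both
  -- signs of `α`.
  set K : ℝ := κ ^ 2 / c + 1 with hK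
  have hK1 : 1 ≤ K := by have : 0 ≤ κ ^ 2 / c := by positivity
                         linarith
  have hsum := (summable_norm_natCast_rpow d (r := -(2 * (α + β))) (by linarith)).mul_left
    (τ⁻¹ ^ 2 * (K ^ |α| * c ^ (-(α + β))))
  refine Summable.of_nonneg_of_le (fun _ => sq_nonneg _) (fun n => ?_) hsum
  by_cases hn : n = 0
  · rw [wmCoeff, if_pos hn, zero_pow two_ne_zero]
    have hK0 : 0 < K := by linarith
    positivity
  have hN : 1 ≤ ‖(fun j => (n j : ℝ))‖ := by
    obtain ⟨j, hj⟩ := Function.ne_iff.1 hn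
    have h1 : (1 : ℝ) ≤ n j := by exact_mod_cast Nat.pos_of_ne_zero hj
    have h2 := norm_le_pi_norm (fun j => (n j : ℝ)) j
    rw [Real.norm_of_nonneg (by positivity)] at h2
    exact h1.trans h2
  set N := ‖(fun j => (n j : ℝ))‖ with hNdef
  set lam := neumannEig L n with hlamdef
  have hlam : c * N ^ 2 ≤ lam := by
    have h3 : ∃ j, N ≤ n j := by
      by_contra! hcon
      have : N < N := by
        refine (pi_norm_lt_iff (by linarith)).2 fun j => ?_
        rw [Real.norm_of_nonneg (by positivity)]
        exact hcon j
      exact lt_irrefl _ this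
    obtain ⟨j, hj⟩ := h3
    have h4 : (n j * Real.pi / L) ^ 2 ≤ lam :=
      Finset.single_le_sum (f := fun j => (n j * Real.pi / L) ^ 2) (fun _ _ => sq_nonneg _)
        (Finset.mem_univ j)
    refine le_trans ?_ h4
    rw [hc, ← mul_pow, mul_div_assoc, mul_comm]
    gcongr
  have hlamc : c ≤ lam := le_trans (le_mul_of_one_le_right hc0.le (one_le_pow₀ hN)) hlam
  have hlam0 : 0 < lam := by linarith
  have hle : lam ≤ κ ^ 2 + lam := by nlinarith [sq_nonneg κ]
  have hle' : κ ^ 2 + lam ≤ K * lam := by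
    have : κ ^ 2 = κ ^ 2 / c * c := by field_simp
    have h5 : κ ^ 2 / c * c ≤ κ ^ 2 / c * lam := by gcongr
    rw [hK]; linarith
  have hα : (κ ^ 2 + lam) ^ (-α) ≤ K ^ |α| * lam ^ (-α) := by
    rcases le_total 0 α with h | h
    · calc (κ ^ 2 + lam) ^ (-α) ≤ lam ^ (-α) :=
            Real.rpow_le_rpow_of_nonpos hlam0 hle (by linarith)
        _ ≤ K ^ |α| * lam ^ (-α) :=
          le_mul_of_one_le_left (by positivity) (Real.one_le_rpow hK1 (abs_nonneg _))
    · rw [abs_of_nonpos h, ← Real.mul_rpow (by linarith) hlam0.le]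
      exact Real.rpow_le_rpow (by positivity) hle' (by linarith)
  rw [wmCoeff, if_neg hn, mul_pow, mul_assoc, inv_pow (wmSymbol _ _ _ _), wmSymbol_sq _ _ _ hlam0.le]
  refine mul_le_mul_of_nonneg_left ?_ (sq_nonneg _)
  have h6 : 0 < κ ^ 2 + lam := by linarith
  rw [mul_inv, ← Real.rpow_neg hlam0.le, ← Real.rpow_neg h6.le]
  calc lam ^ (-β) * (κ ^ 2 + lam) ^ (-α) ≤ lam ^ (-β) * (K ^ |α| * lam ^ (-α)) := by gcongr
    _ = K ^ |α| * lam ^ (-(α + β)) := by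
      rw [mul_left_comm, ← Real.rpow_add hlam0]; ring_nf
    _ ≤ K ^ |α| * (c * N ^ 2) ^ (-(α + β)) := by
      have : (0 : ℝ) ≤ d := Nat.cast_nonneg d
      have h7 : -(α + β) ≤ 0 := by linarith
      have := Real.rpow_le_rpow_of_nonpos (by positivity) hlam h7
      gcongr
    _ = K ^ |α| * c ^ (-(α + β)) * N ^ (-(2 * (α + β))) := by
      rw [Real.mul_rpow hc0.le (by positivity), ← Real.rpow_natCast N 2, ← Real.rpow_mul (by positivity)]
      push_cast
      ring_nf

/-- The cosine basis of `L²` of the cube. -/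
lemma exists_hilbertBasis_neumannCos (hL : 0 < L) :
    ∃ b : HilbertBasis (Fin d → ℕ) ℝ (Lp ℝ 2 (volume.restrict (cube d L))),
      ∀ n, b n =ᵐ[volume.restrict (cube d L)] neumannCos L n := by
  classical
  have hmem : ∀ n : Fin d → ℕ, MemLp (neumannCos L n) 2 (volume.restrict (cube d L)) := fun n =>
    (continuous_neumannCos L n).memLp_restrict_cube 2
  let v : (Fin d → ℕ) → Lp ℝ 2 (volume.restrict (cube d L)) := fun n => (hmem n).toLp
  have hv : ∀ n, v n =ᵐ[volume.restrict (cube d L)] neumannCos L n := fun n => (hmem n).coeFn_toLp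
  have hon : Orthonormal ℝ v := by
    rw [orthonormal_iff_ite]
    intro n m
    rw [L2.inner_def, ← integral_neumannCos_mul hL n m]
    refine integral_congr_ae ?_
    filter_upwards [hv n, hv m] with x h1 h2
    simp [h1, h2, mul_comm]
  have hbot : (Submodule.span ℝ (Set.range v))ᗮ = ⊥ := by
    rw [Submodule.eq_bot_iff]
    intro f hf
    rw [Submodule.mem_orthogonal] at hf
    rw [← Lp.eq_zero_iff_ae_eq_zero.2
      (ae_eq_zero_of_forall_integral_mul_neumannCos hL (Lp.memLp f) fun n => ?_)]
    rw [← hf (v n) (Submodule.subset_span ⟨n, rfl⟩), L2.inner_def]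
    refine integral_congr_ae ?_
    filter_upwards [hv n] with x h1
    simp [h1]
  refine ⟨HilbertBasis.mkOfOrthogonalEqBot hon hbot, fun n => ?_⟩
  rw [HilbertBasis.coe_mkOfOrthogonalEqBot]
  exact hv n

end Coefficients

/-! ## Existence of the field on the cube -/

section Existence

lemma HilbertBasis.hasSum_inner_sq {ι E : Type*} [NormedAddCommGroup E] [InnerProductSpace ℝ E]
    (b : HilbertBasis ι ℝ E) (z : E) : HasSum (fun n => inner ℝ (b n) z ^ 2) (‖z‖ ^ 2) := by
  have := b.hasSum_inner_mul_inner z z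
  rw [real_inner_self_eq_norm_sq] at this
  refine this.congr_fun fun n => ?_
  rw [real_inner_comm z, pow_two]

lemma HilbertBasis.exists_hasSum_smul {ι E : Type*} [NormedAddCommGroup E] [InnerProductSpace ℝ E]
    (b : HilbertBasis ι ℝ E) {c : ι → ℝ} (hc : Summable fun n => c n ^ 2) :
    ∃ z, HasSum (fun n => c n • b n) z ∧ ∀ n, inner ℝ (b n) z = c n := by
  have hmem : Memℓp c 2 := memℓp_gen (by simpa using hc)
  let g : lp (fun _ : ι => ℝ) 2 := ⟨c, hmem⟩
  refine ⟨b.repr.symm g, b.hasSum_repr_symm g, fun n => ?_⟩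
  rw [← b.repr_apply_apply, LinearIsometryEquiv.apply_symm_apply]

lemma Summable.abs_mul_of_sq {ι : Type*} {a y : ι → ℝ} (ha : Summable fun n => a n ^ 2)
    (hy : Summable fun n => y n ^ 2) : Summable fun n => |a n * y n| := by
  refine Summable.of_nonneg_of_le (fun _ => abs_nonneg _) (fun n => ?_) (ha.add hy)
  rw [abs_mul]
  nlinarith [sq_nonneg (|a n| - |y n|), sq_abs (a n), sq_abs (y n), sq_nonneg (a n),
    sq_nonneg (y n)]

variable {d : ℕ} {L : ℝ}

lemma summable_mul_neumannCos {c : (Fin d → ℕ) → ℝ} (hc : Summable fun n => |c n|)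
    (x : EuclideanSpace ℝ (Fin d)) : Summable fun n => c n * neumannCos L n x := by
  refine Summable.of_norm_bounded (hc.mul_right (√(2 / L) ^ d)) fun n => ?_
  rw [Real.norm_eq_abs, abs_mul]
  exact mul_le_mul_of_nonneg_left (abs_neumannCos_le n x) (abs_nonneg _)

lemma continuous_tsum_mul_neumannCos {c : (Fin d → ℕ) → ℝ} (hc : Summable fun n => |c n|) :
    Continuous fun x => ∑' n, c n * neumannCos (d := d) L n x := by
  refine continuous_tsum (fun n => (continuous_neumannCos L n).const_mul _)
    (hc.mul_right (√(2 / L) ^ d)) fun n x => ?_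
  rw [Real.norm_eq_abs, abs_mul]
  exact mul_le_mul_of_nonneg_left (abs_neumannCos_le n x) (abs_nonneg _)

lemma hasSum_integral_mul_tsum_neumannCos {c : (Fin d → ℕ) → ℝ} (hc : Summable fun n => |c n|)
    {f : EuclideanSpace ℝ (Fin d) → ℝ} (hf : MemLp f 2 (volume.restrict (cube d L))) :
    HasSum (fun n => c n * ∫ x in cube d L, f x * neumannCos L n x)
      (∫ x in cube d L, f x * ∑' n, c n * neumannCos L n x) := by
  have hfi := (hf.integrable (by norm_num : (1 : ENNReal) ≤ 2)).abs
  have hint : ∀ n, Integrable (fun x => f x * (c n * neumannCos L n x))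
      (volume.restrict (cube d L)) := fun n =>
    hf.integrable_mul (((continuous_neumannCos L n).const_mul _).memLp_restrict_cube 2)
  have := hasSum_integral_of_summable_integral_norm hint (by
    refine Summable.of_nonneg_of_le (fun n => integral_nonneg fun _ => norm_nonneg _) (fun n => ?_)
      (hc.mul_right (√(2 / L) ^ d * ∫ x in cube d L, |f x|))
    rw [← mul_assoc, ← integral_const_mul]
    refine integral_mono (hint n).norm (hfi.const_mul _) fun x => ?_
    rw [Real.norm_eq_abs, abs_mul, abs_mul, mul_comm |f x|]
    exact mul_le_mul_of_nonneg_right (mul_le_mul_of_nonneg_left (abs_neumannCos_le n x)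
      (abs_nonneg _)) (abs_nonneg _))
  simp_rw [tsum_mul_left] at this
  refine this.congr_fun fun n => ?_
  rw [← integral_const_mul]
  exact integral_congr_ae (ae_of_all _ fun x => by ring)

lemma summable_sq_wmCoeff_mul {κ τ α β : ℝ} (hαβ : (d : ℝ) / 2 < α + β) (hL : 0 < L)
    {g : (Fin d → ℕ) → ℝ} {M : ℝ} (hg : ∀ n, |g n| ≤ M) :
    Summable fun n => (wmCoeff κ τ α β L n * g n) ^ 2 := by
  refine Summable.of_nonneg_of_le (fun _ => sq_nonneg _) (fun n => ?_)
    ((summable_wmCoeff_sq κ τ α β hαβ hL).mul_right (M ^ 2))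
  rw [mul_pow]
  exact mul_le_mul_of_nonneg_left (sq_le_sq' (abs_le.1 (hg n)).1 (abs_le.1 (hg n)).2) (sq_nonneg _)

lemma abs_neumannCos_sub_le (n : Fin d → ℕ) (x y : EuclideanSpace ℝ (Fin d)) :
    |neumannCos L n x - neumannCos L n y| ≤ 2 * √(2 / L) ^ d := by
  refine (abs_sub _ _).trans ?_
  linarith [abs_neumannCos_le (L := L) n x, abs_neumannCos_le (L := L) n y]

lemma MeasureTheory.Lp.integral_sub_sq {Ω : Type*} [MeasurableSpace Ω] {P : Measure Ω}
    (X Y : Lp ℝ 2 P) : ∫ ω, (X ω - Y ω) ^ 2 ∂P = ‖X - Y‖ ^ 2 := by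
  rw [← real_inner_self_eq_norm_sq, L2.inner_def]
  refine integral_congr_ae ?_
  filter_upwards [Lp.coeFn_sub X Y] with ω h
  rw [h, Pi.sub_apply, pow_two]
  rfl

/-- The field is `u x = G (K x)`, with `G` an isonormal process on `L²` of the cube and `K x = ∑ a_n
e_n(x) b_n`. The same `G` serves as the white noise of the equation. Contrasts are nondegenerate
because the cosines separate signed point measures and `a_n ≠ 0` for `n ≠ 0`. -/
theorem exists_isIntrinsicWhittleMatern {κ τ α β : ℝ} (hτ : 0 < τ) (hαβ : (d : ℝ) / 2 < α + β)
    (hL : 0 < L) :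
    ∃ (Ω : Type) (_ : MeasurableSpace Ω) (P : Measure Ω) (_ : IsProbabilityMeasure P)
      (u : EuclideanSpace ℝ (Fin d) → Ω → ℝ), IsIntrinsicWhittleMatern (cube d L) κ τ α β P u := by
  classical
  obtain ⟨b, hb⟩ := exists_hilbertBasis_neumannCos (d := d) hL
  obtain ⟨Ω, mΩ, P, hP, G, hG⟩ := exists_isonormal (Lp ℝ 2 (volume.restrict (cube d L)))
  set a : (Fin d → ℕ) → ℝ := wmCoeff κ τ α β L with ha_def
  have ha : Summable fun n => a n ^ 2 := summable_wmCoeff_sq κ τ α β hαβ hL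
  choose K hK hKinner using fun x : EuclideanSpace ℝ (Fin d) => b.exists_hasSum_smul
    (summable_sq_wmCoeff_mul (κ := κ) (τ := τ) hαβ hL fun n => abs_neumannCos_le (L := L) n x)
  have hGon : Orthonormal ℝ fun n => G (b n) := b.orthonormal.comp_linearIsometry G
  have hGK : ∀ x, HasSum (fun n => (a n * neumannCos L n x) • G (b n)) (G (K x)) := fun x => by
    have := G.toContinuousLinearMap.hasSum (hK x)
    simpa using this
  obtain ⟨u, hum, hu⟩ := exists_measurable_version hGon ha
    (fun n => (continuous_neumannCos L n).measurable) (fun n x => abs_neumannCos_le n x) hGK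
  have hnorm : ∀ x y, HasSum (fun n => (a n * (neumannCos L n x - neumannCos L n y)) ^ 2)
      (‖K x - K y‖ ^ 2) := fun x y => by
    refine (b.hasSum_inner_sq (K x - K y)).congr_fun fun n => ?_
    rw [inner_sub_right, hKinner, hKinner, mul_sub]
  have hsq : ∀ x y, ∫ ω, (u x ω - u y ω) ^ 2 ∂P = ‖K x - K y‖ ^ 2 := fun x y => by
    rw [← G.norm_map, map_sub, ← Lp.integral_sub_sq]
    refine integral_congr_ae ?_
    filter_upwards [hu x, hu y] with ω h1 h2
    rw [h1, h2]
  have hmem : MemLp (fun p : EuclideanSpace ℝ (Fin d) × Ω => u p.1 p.2) 2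
      ((volume.restrict (cube d L)).prod P) := by
    have hm : AEStronglyMeasurable (fun p : EuclideanSpace ℝ (Fin d) × Ω => u p.1 p.2 ^ 2)
        ((volume.restrict (cube d L)).prod P) := (hum.pow_const 2).aestronglyMeasurable
    have hm' : AEStronglyMeasurable (fun p : EuclideanSpace ℝ (Fin d) × Ω => u p.1 p.2)
        ((volume.restrict (cube d L)).prod P) := hum.aestronglyMeasurable
    rw [memLp_two_iff_integrable_sq hm', integrable_prod_iff hm]
    refine ⟨ae_of_all _ fun x => ?_, ?_⟩
    · exact ((Lp.memLp (G (K x))).integrable_sq).congr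
        (by filter_upwards [hu x] with ω h; rw [h])
    · refine Integrable.of_bound (C := ∑' n, (a n ^ 2 * (√(2 / L) ^ d) ^ 2))
        hm.norm.integral_prod_right' (ae_of_all _ fun x => ?_)
      have h1 : ∫ ω, ‖u x ω ^ 2‖ ∂P = ‖K x‖ ^ 2 := by
        rw [← G.norm_map, ← real_inner_self_eq_norm_sq, L2.inner_def]
        refine integral_congr_ae ?_
        filter_upwards [hu x] with ω h
        simp [h, pow_two]
      simp only [h1]
      rw [Real.norm_of_nonneg (sq_nonneg _), ← (b.hasSum_inner_sq (K x)).tsum_eq]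
      refine Summable.tsum_le_tsum (fun n => ?_) (b.hasSum_inner_sq (K x)).summable
        (ha.mul_right _)
      rw [hKinner, mul_pow]
      have h2 := abs_le.1 (abs_neumannCos_le (L := L) n x)
      exact mul_le_mul_of_nonneg_left (sq_le_sq' h2.1 h2.2) (sq_nonneg _)
  refine ⟨Ω, mΩ, P, hP, u, ?_, hmem, fun s _ => ?_, G.toLinearMap, fun f => ?_,
    fun f lam hf hlam => ?_⟩
  · intro k s c hs hinj hc0 hc
    refine ⟨‖∑ i, c i • K (s i)‖₊ ^ 2, ?_, ?_⟩
    · rw [Ne, sq_eq_zero_iff, nnnorm_eq_zero]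
      intro h0
      refine hc (eq_zero_of_forall_sum_mul_neumannCos hL hs hinj fun n => ?_)
      -- The mode `n = 0` does not enter `K`; it is constant in space, so it is annihilated by `∑ c
      -- i = 0`.
      by_cases hn : n = 0
      · have : ∀ x, neumannCos (d := d) L 0 x = √(1 / L) ^ d := fun x => by
          simp [neumannCos, prodFun, cosFactor]
        simp only [hn, this, ← Finset.sum_mul, hc0, zero_mul]
      · have h1 : inner ℝ (b n) (∑ i, c i • K (s i)) = 0 := by rw [h0, inner_zero_right]
        simp only [inner_sum, inner_smul_right, hKinner, mul_left_comm (c _), ← Finset.mul_sum]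
          at h1
        exact (mul_eq_zero.1 h1).resolve_left (wmCoeff_ne_zero κ α β hτ hL hn)
    · rw [← hG]
      refine Measure.map_congr ?_
      have h1 : ∀ᵐ ω ∂P, ∀ i, G (c i • K (s i)) ω = c i * u (s i) ω := by
        rw [ae_all_iff]
        intro i
        rw [map_smul]
        filter_upwards [hu (s i), Lp.coeFn_smul (c i) (G (K (s i)))] with ω h2 h3
        rw [h2, h3, Pi.smul_apply, smul_eq_mul]
      rw [map_sum]
      filter_upwards [h1, Lp.coeFn_finsetSum Finset.univ fun i => G (c i • K (s i))] with ω h2 h3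
      rw [h3, Finset.sum_apply]
      exact (Finset.sum_congr rfl fun i _ => h2 i).symm
  · simp_rw [hsq, ← (hnorm _ _).tsum_eq]
    have : Tendsto (fun t => ∑' n, (a n * (neumannCos L n t - neumannCos L n s)) ^ 2)
        (𝓝[cube d L] s) (𝓝 (∑' _ : Fin d → ℕ, (0 : ℝ))) := by
      refine tendsto_tsum_of_dominated_convergence (bound := fun n => a n ^ 2 *
        (2 * √(2 / L) ^ d) ^ 2) (ha.mul_right _) (fun n => ?_) (Eventually.of_forall fun t n => ?_)
      · have hc : Continuous fun t => (a n * (neumannCos L n t - neumannCos L n s)) ^ 2 := by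
          have := continuous_neumannCos L n
          fun_prop
        have := hc.tendsto s
        simp only [sub_self, mul_zero, ne_eq, OfNat.ofNat_ne_zero, not_false_eq_true,
          zero_pow] at this
        exact this.mono_left nhdsWithin_le_nhds
      · have h2 := abs_le.1 (abs_neumannCos_sub_le (L := L) n t s)
        rw [Real.norm_of_nonneg (sq_nonneg _), mul_pow]
        exact mul_le_mul_of_nonneg_left (sq_le_sq' h2.1 h2.2) (sq_nonneg _)
    simpa using this
  · exact hG f
  · have hprod : Integrable (fun p : EuclideanSpace ℝ (Fin d) × Ω => (τ * u p.1 p.2) * f p.1)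
        ((volume.restrict (cube d L)).prod P) :=
      (hmem.const_mul τ).integrable_mul ((Lp.memLp f).comp_measurePreserving measurePreserving_fst)
    -- The two random variables are compared through their integrals over each event `A`, that is,
    -- through inner products with its indicator `Y`. After Fubini both sides are series in `⟪Y, G
    -- (b n)⟫`, compared term by term.
    refine Integrable.ae_eq_of_forall_setIntegral_eq _ _ (hprod.integral_prod_right.const_mul _)
      ((Lp.memLp (G f)).integrable (by norm_num)) fun A hA _ => ?_
    set Y : Lp ℝ 2 P := indicatorConstLp 2 hA (measure_ne_top P A) 1
    have hYinner : ∀ X : Lp ℝ 2 P, inner ℝ Y X = ∫ ω in A, X ω ∂P := fun X =>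
      L2.inner_indicatorConstLp_one hA (measure_ne_top P A) X
    set y : (Fin d → ℕ) → ℝ := fun n => inner ℝ Y (G (b n)) with hy_def
    have hy : Summable fun n => y n ^ 2 := by
      have := hGon.inner_products_summable Y
      refine this.congr fun n => ?_
      rw [Real.norm_eq_abs, sq_abs, real_inner_comm]
    have hay := ha.abs_mul_of_sq hy
    have hYK : ∀ x, inner ℝ Y (G (K x)) = ∑' n, a n * y n * neumannCos L n x := fun x => by
      have := (innerSL ℝ Y).hasSum (hGK x)
      simp only [innerSL_apply_apply, inner_smul_right] at this
      rw [← this.tsum_eq]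
      exact tsum_congr fun n => by simp only [hy_def]; ring
    have h1 : ∫ ω in A, wmSymbol κ α β lam * (∫ s in cube d L, (τ * u s ω) * f s) ∂P =
        wmSymbol κ α β lam * τ * ∫ s in cube d L, f s * ∑' n, a n * y n * neumannCos L n s := by
      rw [integral_const_mul, mul_assoc, ← integral_integral_swap]
      · congr 1
        rw [← integral_const_mul]
        refine integral_congr_ae (ae_of_all _ fun s => ?_)
        simp only
        rw [← hYK, hYinner, integral_mul_const, integral_const_mul]
        have : ∫ ω in A, u s ω ∂P = ∫ ω in A, G (K s) ω ∂P :=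
          integral_congr_ae (ae_restrict_of_ae (hu s))
        rw [this]; ring
      · have : (volume.restrict (cube d L)).prod (P.restrict A) =
            ((volume.restrict (cube d L)).prod P).restrict (Set.univ ×ˢ A) := by
          rw [← Measure.prod_restrict, Measure.restrict_univ]
        rw [this]
        exact hprod.restrict
    have h2 := (hasSum_integral_mul_tsum_neumannCos hay (Lp.memLp f)).mul_left
      (wmSymbol κ α β lam * τ)
    have h3 : HasSum (fun n => inner ℝ (b n) f * y n) (inner ℝ Y (G f)) := by
      have := (innerSL ℝ Y).hasSum (G.toContinuousLinearMap.hasSum (b.hasSum_repr f))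
      simp only [innerSL_apply_apply, LinearIsometry.coe_toContinuousLinearMap, map_smul,
        b.repr_apply_apply] at this
      exact this
    change ∫ ω in A, wmSymbol κ α β lam * (∫ s in cube d L, (τ * u s ω) * f s) ∂P =
      ∫ ω in A, G f ω ∂P
    rw [h1, ← hYinner]
    refine (h2.congr_fun fun n => ?_).unique h3
    have hbf : inner ℝ (b n) f = ∫ x in cube d L, f x * neumannCos L n x := by
      rw [L2.inner_def]
      refine integral_congr_ae ?_
      filter_upwards [hb n] with x hx
      simp [hx]
    rw [hbf]
    -- The eigenfunction `f` need not be a cosine. Orthogonality leaves only its components along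
    -- cosines with the same eigenvalue, on which the symbol cancels the coefficient.
    have h4 := hf.mul_integral_eq (isNeumannEigenfunction_neumannCos hL n)
    by_cases h0 : ∫ x in cube d L, f x * neumannCos L n x = 0
    · simp [h0]
    · have h5 : lam = neumannEig L n := mul_right_cancel₀ h0 h4
      have hn : n ≠ 0 := by
        rintro rfl
        exact hlam (h5.trans (neumannEig_zero L))
      have h6 := wmSymbol_pos κ α β (neumannEig_pos hL hn)
      rw [ha_def, wmCoeff, if_neg hn, h5]
      field_simp

end Existence

/-! ## Uniqueness of the variogram on the cube -/

section Uniqueness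

variable {d : ℕ} {L : ℝ}

/-- Needed so that continuous functions agreeing almost everywhere on the cube agree everywhere on
it, faces included. -/
lemma cube_subset_closure_interior (hL : 0 < L) : cube d L ⊆ closure (interior (cube d L)) := by
  have hconv : Convex ℝ (cube d L) := by
    intro x hx y hy a b ha hb hab i
    exact (convex_Icc (-(L / 2)) (L / 2)) (hx i) (hy i) ha hb hab
  have hne : (interior (cube d L)).Nonempty :=
    ⟨0, setOf_forall_mem_Ioo_subset_interior_cube fun i => by
      simp only [PiLp.zero_apply, Set.mem_Ioo]; constructor <;> linarith⟩
  rw [hconv.closure_interior_eq_closure_of_nonempty_interior hne]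
  exact subset_closure

lemma volume_restrict_cube_ne_zero (hL : 0 < L) : volume.restrict (cube d L) ≠ 0 := by
  rw [Ne, Measure.restrict_eq_zero]
  refine (Measure.measure_pos_of_nonempty_interior _ ?_).ne'
  exact ⟨0, setOf_forall_mem_Ioo_subset_interior_cube fun i => by
      simp only [PiLp.zero_apply, Set.mem_Ioo]; constructor <;> linarith⟩

variable {Ω : Type*} [MeasurableSpace Ω] {P : Measure Ω}

lemma memLp_two_of_map_eq_gaussianReal {X : Ω → ℝ} {m : ℝ} {v : ℝ≥0}
    (h : P.map X = gaussianReal m v) : MemLp X 2 P := by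
  have hX : AEMeasurable X P := aemeasurable_of_map_neZero (by rw [h]; infer_instance)
  have h2 := memLp_id_gaussianReal' (μ := m) (v := v) 2 (by simp)
  rw [← h, memLp_map_measure_iff measurable_id.aestronglyMeasurable hX] at h2
  exact h2

lemma integral_of_map_eq_gaussianReal {X : Ω → ℝ} {m : ℝ} {v : ℝ≥0}
    (h : P.map X = gaussianReal m v) : ∫ ω, X ω ∂P = m := by
  have hX : AEMeasurable X P := aemeasurable_of_map_neZero (by rw [h]; infer_instance)
  have h2 := integral_id_gaussianReal (μ := m) (v := v)
  rw [← h, integral_map hX measurable_id'.aestronglyMeasurable] at h2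
  exact h2

lemma variance_of_map_eq_gaussianReal {X : Ω → ℝ} {m : ℝ} {v : ℝ≥0}
    (h : P.map X = gaussianReal m v) : variance X P = v := by
  have hX : AEMeasurable X P := aemeasurable_of_map_neZero (by rw [h]; infer_instance)
  rw [← variance_id_map hX, h, variance_id_gaussianReal]

lemma IsIntrinsicGaussianField.exists_map_sub {D : Set (EuclideanSpace ℝ (Fin d))}
    {u : EuclideanSpace ℝ (Fin d) → Ω → ℝ} (h : IsIntrinsicGaussianField D P u)
    {s t : EuclideanSpace ℝ (Fin d)} (hs : s ∈ D) (ht : t ∈ D) (hst : s ≠ t) :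
    ∃ v : ℝ≥0, P.map (fun ω => u s ω - u t ω) = gaussianReal 0 v := by
  obtain ⟨v, -, hv⟩ := h 2 ![s, t] ![1, -1] (by simp [Fin.forall_fin_two, hs, ht])
    (by
      intro i j hij
      fin_cases i <;> fin_cases j <;> simp_all [eq_comm])
    (by simp) (fun h0 => by simpa using congrFun h0 0)
  refine ⟨v, ?_⟩
  rw [← hv]
  congr 1
  funext ω
  simp [Fin.sum_univ_two, sub_eq_add_neg]

lemma IsIntrinsicGaussianField.integral_sub_eq_zero {D : Set (EuclideanSpace ℝ (Fin d))}
    {u : EuclideanSpace ℝ (Fin d) → Ω → ℝ} (h : IsIntrinsicGaussianField D P u)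
    {s t : EuclideanSpace ℝ (Fin d)} (hs : s ∈ D) (ht : t ∈ D) :
    ∫ ω, (u s ω - u t ω) ∂P = 0 := by
  rcases eq_or_ne s t with rfl | hst
  · simp
  · obtain ⟨v, hv⟩ := h.exists_map_sub hs ht hst
    exact integral_of_map_eq_gaussianReal hv

/-- Square integrability is only assumed jointly in space and chance, so Fubini yields it at some
point `x`. Any other value differs from `u x` by a Gaussian contrast. -/
lemma IsIntrinsicWhittleMatern.memLp_apply [IsProbabilityMeasure P] {κ τ α β : ℝ} (hL : 0 < L)
    {u : EuclideanSpace ℝ (Fin d) → Ω → ℝ}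
    (hu : IsIntrinsicWhittleMatern (cube d L) κ τ α β P u) {s : EuclideanSpace ℝ (Fin d)}
    (hs : s ∈ cube d L) : MemLp (u s) 2 P := by
  have h1 := hu.memLp.1.prodMk_left
  have h2 := hu.memLp.integrable_sq.prod_right_ae
  have : (ae (volume.restrict (cube d L))).NeBot := ae_neBot.2 (volume_restrict_cube_ne_zero hL)
  obtain ⟨x, hx1, hx2, hx⟩ := (h1.and (h2.and (ae_restrict_mem (measurableSet_cube d L)))).exists
  have hux : MemLp (u x) 2 P := (memLp_two_iff_integrable_sq hx1).2 hx2
  rcases eq_or_ne s x with rfl | hsx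
  · exact hux
  · obtain ⟨v, hv⟩ := hu.intrinsic.exists_map_sub hs hx hsx
    have := (memLp_two_of_map_eq_gaussianReal hv).add hux
    refine this.ae_eq (ae_of_all _ fun ω => ?_)
    simp

lemma IsGaussianWhiteNoise.norm_apply {D : Set (EuclideanSpace ℝ (Fin d))}
    {W : Lp ℝ 2 (volume.restrict D) →ₗ[ℝ] Lp ℝ 2 P} (hW : IsGaussianWhiteNoise D P W)
    (f : Lp ℝ 2 (volume.restrict D)) : ‖W f‖ = ‖f‖ := by
  have h1 : ‖W f‖ ^ 2 = ‖f‖ ^ 2 := by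
    have h2 := variance_of_map_eq_gaussianReal (hW f)
    rw [variance_of_integral_eq_zero (Lp.aestronglyMeasurable _).aemeasurable
      (integral_of_map_eq_gaussianReal (hW f))] at h2
    have h3 := Lp.integral_sub_sq (W f) 0
    rw [sub_zero] at h3
    rw [← h3]
    have h4 : ∫ ω, (W f ω - (0 : Lp ℝ 2 P) ω) ^ 2 ∂P = ∫ ω, W f ω ^ 2 ∂P := by
      refine integral_congr_ae ?_
      filter_upwards [Lp.coeFn_zero ℝ 2 P] with ω h
      rw [h]; simp
    rw [h4, h2]
    simp
  exact (sq_eq_sq₀ (norm_nonneg _) (norm_nonneg _)).1 h1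

/-- For each `Y ∈ L²(P)` the function `x ↦ ⟪Y, u x⟫` is continuous, and the equation prescribes its
cosine coefficients `a_n ⟪Y, W (b n)⟫` for `n ≠ 0`. By completeness it is the corresponding series
up to an additive constant, which cancels in `u s - u t`. This places the increment in the closed
span of the noise with known coordinates, and Parseval gives the variance. -/
theorem IsIntrinsicWhittleMatern.variance_eq [IsProbabilityMeasure P] {κ τ α β : ℝ} (hτ : 0 < τ)
    (hαβ : (d : ℝ) / 2 < α + β) (hL : 0 < L) {u : EuclideanSpace ℝ (Fin d) → Ω → ℝ}
    (hu : IsIntrinsicWhittleMatern (cube d L) κ τ α β P u) {s t : EuclideanSpace ℝ (Fin d)}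
    (hs : s ∈ cube d L) (ht : t ∈ cube d L) :
    variance (fun ω => u s ω - u t ω) P = wmVariogram κ τ α β L s t := by
  classical
  obtain ⟨b, hb⟩ := exists_hilbertBasis_neumannCos (d := d) hL
  obtain ⟨W, hW, hsol⟩ := hu.solves
  let G : Lp ℝ 2 (volume.restrict (cube d L)) →ₗᵢ[ℝ] Lp ℝ 2 P := ⟨W, hW.norm_apply⟩
  have hon : Orthonormal ℝ fun n => W (b n) := b.orthonormal.comp_linearIsometry G
  set a : (Fin d → ℕ) → ℝ := wmCoeff κ τ α β L with ha_def
  have ha : Summable fun n => a n ^ 2 := summable_wmCoeff_sq κ τ α β hαβ hL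
  let V : EuclideanSpace ℝ (Fin d) → Lp ℝ 2 P := fun x =>
    if hx : x ∈ cube d L then (hu.memLp_apply hL hx).toLp else 0
  have hV : ∀ x ∈ cube d L, V x =ᵐ[P] u x := fun x hx => by
    simp only [V, dif_pos hx]
    exact (hu.memLp_apply hL hx).coeFn_toLp
  have hVcont : ContinuousOn V (cube d L) := by
    intro x hx
    rw [ContinuousWithinAt, tendsto_iff_norm_sub_tendsto_zero]
    have h1 : Tendsto (fun y => ‖V y - V x‖ ^ 2) (𝓝[cube d L] x) (𝓝 0) := by
      refine (hu.meanSquare_continuous x hx).congr' ?_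
      filter_upwards [self_mem_nhdsWithin] with y hy
      rw [← Lp.integral_sub_sq]
      refine integral_congr_ae ?_
      filter_upwards [hV x hx, hV y hy] with ω h2 h3
      rw [h2, h3]
    have h2 := h1.sqrt
    simpa [Real.sqrt_sq (norm_nonneg _)] using h2
  -- the components of `u` along the eigenfunctions
  have hcoef : ∀ n, n ≠ 0 → ∀ᵐ ω ∂P, ∫ x in cube d L, u x ω * neumannCos L n x =
      a n * W (b n) ω := by
    intro n hn
    have hpos := wmSymbol_pos κ α β (neumannEig_pos hL hn)
    filter_upwards [hsol (b n) (neumannEig L n)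
      ((isNeumannEigenfunction_neumannCos hL n).congr (hb n).symm) (neumannEig_pos hL hn).ne']
      with ω hω
    have h1 : ∫ x in cube d L, (τ * u x ω) * (b n : EuclideanSpace ℝ (Fin d) → ℝ) x =
        τ * ∫ x in cube d L, u x ω * neumannCos L n x := by
      rw [← integral_const_mul]
      refine integral_congr_ae ?_
      filter_upwards [hb n] with x hx
      rw [hx]; ring
    rw [h1] at hω
    change wmSymbol κ α β (neumannEig L n) * _ = _ at hω
    rw [← hω, ha_def, wmCoeff, if_neg hn]
    field_simp
  have key : ∀ Y : Lp ℝ 2 P, HasSum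
      (fun n => a n * (neumannCos L n s - neumannCos L n t) * inner ℝ Y (W (b n)))
      (inner ℝ Y (V s - V t)) := by
    intro Y
    set y : (Fin d → ℕ) → ℝ := fun n => inner ℝ Y (W (b n)) with hy_def
    have hy : Summable fun n => y n ^ 2 := by
      refine (hon.inner_products_summable Y).congr fun n => ?_
      rw [Real.norm_eq_abs, sq_abs, real_inner_comm]
    have hay : Summable fun n => |a n * y n| := ha.abs_mul_of_sq hy
    have hg : ContinuousOn (fun x => inner ℝ Y (V x)) (cube d L) :=
      (innerSL ℝ Y).continuous.comp_continuousOn hVcont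
    set h : EuclideanSpace ℝ (Fin d) → ℝ := fun x => ∑' n, a n * y n * neumannCos L n x with hh
    have hhc : Continuous h := continuous_tsum_mul_neumannCos hay
    have hF : ContinuousOn (fun x => inner ℝ Y (V x) - h x) (cube d L) := hg.sub hhc.continuousOn
    have hLp : ∀ f : EuclideanSpace ℝ (Fin d) → ℝ, ContinuousOn f (cube d L) →
        MemLp f 2 (volume.restrict (cube d L)) := fun f hf => by
      obtain ⟨C, hC⟩ := (isCompact_cube d L).exists_bound_of_continuousOn hf
      exact MemLp.of_bound (hf.aestronglyMeasurable (measurableSet_cube d L)) C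
        ((ae_restrict_iff' (measurableSet_cube d L)).2 (ae_of_all _ hC))
    have he : ∀ n, MemLp (neumannCos L n) 2 (volume.restrict (cube d L)) := fun n =>
      hLp _ (continuous_neumannCos L n).continuousOn
    have hI : ∀ (f : EuclideanSpace ℝ (Fin d) → ℝ) (n), ContinuousOn f (cube d L) →
        Integrable (fun x => f x * neumannCos L n x) (volume.restrict (cube d L)) := fun f n hf =>
      (hLp f hf).integrable_mul (he n)
    have hgn : ∀ n, n ≠ 0 → ∫ x in cube d L, inner ℝ Y (V x) * neumannCos L n x = a n * y n := by
      intro n hn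
      have hprod : Integrable (fun p : EuclideanSpace ℝ (Fin d) × Ω =>
          u p.1 p.2 * (neumannCos L n p.1 * Y p.2)) ((volume.restrict (cube d L)).prod P) := by
        have h1 : MemLp (fun p : EuclideanSpace ℝ (Fin d) × Ω => neumannCos L n p.1 * Y p.2) 2
            ((volume.restrict (cube d L)).prod P) := by
          refine (memLp_two_iff_integrable_sq ((he n).1.comp_fst.mul
            (Lp.aestronglyMeasurable Y).comp_snd)).2 ?_
          exact ((he n).integrable_sq.mul_prod (Lp.memLp Y).integrable_sq).congr
            (ae_of_all _ fun p => (mul_pow _ _ 2).symm)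
        exact hu.memLp.integrable_mul h1
      have h1 : ∫ x in cube d L, inner ℝ Y (V x) * neumannCos L n x =
          ∫ x in cube d L, ∫ ω, u x ω * (neumannCos L n x * Y ω) ∂P := by
        refine setIntegral_congr_fun (measurableSet_cube d L) fun x hx => ?_
        rw [L2.inner_def, ← integral_mul_const]
        refine integral_congr_ae ?_
        filter_upwards [hV x hx] with ω hω
        simp only [RCLike.inner_apply, conj_trivial, hω]
        ring
      rw [h1, integral_integral_swap hprod, hy_def]
      simp only
      rw [L2.inner_def, ← integral_const_mul]
      refine integral_congr_ae ?_
      filter_upwards [hcoef n hn] with ω hω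
      simp only [RCLike.inner_apply, conj_trivial]
      simp_rw [← mul_assoc, integral_mul_const]
      rw [hω]
    have hhn : ∀ m, ∫ x in cube d L, neumannCos L m x * h x = a m * y m := by
      intro m
      have h1 := hasSum_integral_mul_tsum_neumannCos hay (he m)
      simp_rw [integral_neumannCos_mul hL] at h1
      refine h1.unique ?_
      convert! hasSum_ite_eq m (a m * y m) using 2 with n
      by_cases hnm : n = m
      · subst hnm; simp
      · simp [hnm, Ne.symm hnm]
    -- The component along the constant mode, which the equation leaves free.
    set c : ℝ := ∫ x in cube d L, (inner ℝ Y (V x) - h x) * neumannCos L 0 x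
    have h0 : ∀ x, neumannCos (d := d) L 0 x = √(1 / L) ^ d := fun x => by
      simp [neumannCos, prodFun, cosFactor]
    have hzero : (fun x => inner ℝ Y (V x) - h x - c * neumannCos L 0 x)
        =ᵐ[volume.restrict (cube d L)] 0 := by
      have hc0 : Continuous fun x => c * neumannCos (d := d) L 0 x :=
        (continuous_neumannCos L 0).const_mul c
      refine ae_eq_zero_of_forall_integral_mul_neumannCos hL
        (hLp _ (hF.sub hc0.continuousOn)) fun n => ?_
      simp_rw [sub_mul _ (c * _)]
      rw [integral_sub (hI _ n hF) (hI _ n hc0.continuousOn)]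
      simp_rw [mul_assoc c, integral_const_mul, integral_neumannCos_mul hL]
      by_cases hn : n = 0
      · subst hn; simp [c]
      · rw [if_neg (Ne.symm hn)]
        simp_rw [sub_mul (inner ℝ Y _)]
        rw [integral_sub (hI _ n hg) (hI _ n hhc.continuousOn), hgn n hn]
        simp_rw [mul_comm (h _)]
        rw [hhn]
        ring
    have heq := Measure.eqOn_of_ae_eq hzero
      (hF.sub ((continuous_neumannCos L 0).const_mul c).continuousOn) continuousOn_const
      (cube_subset_closure_interior hL)
    have h1 := heq hs
    have h2 := heq ht
    simp only [h0, Pi.zero_apply] at h1 h2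
    have h3 : inner ℝ Y (V s - V t) = h s - h t := by
      rw [inner_sub_right]; linarith
    rw [h3]
    refine (((summable_mul_neumannCos hay s).hasSum.sub
      (summable_mul_neumannCos hay t).hasSum)).congr_fun fun n => ?_
    simp only [hy_def]
    ring
  -- First `Y = W (b m)` identifies the coordinates of the increment; then `Y = V s - V t` gives its
  -- squared norm.
  have hinner : ∀ m, inner ℝ (W (b m)) (V s - V t) =
      a m * (neumannCos L m s - neumannCos L m t) := by
    intro m
    refine (key (W (b m))).unique ?_
    convert! hasSum_ite_eq m (a m * (neumannCos L m s - neumannCos L m t)) using 2 with n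
    rw [orthonormal_iff_ite.1 hon m n]
    by_cases hnm : n = m
    · subst hnm; simp
    · simp [hnm, Ne.symm hnm]
  have hfin := key (V s - V t)
  rw [real_inner_self_eq_norm_sq] at hfin
  have h1 : ∫ ω, (u s ω - u t ω) ^ 2 ∂P = ‖V s - V t‖ ^ 2 := by
    rw [← Lp.integral_sub_sq]
    refine integral_congr_ae ?_
    filter_upwards [hV s hs, hV t ht] with ω h2 h3
    rw [h2, h3]
  have hm : AEMeasurable (fun ω => u s ω - u t ω) P :=
    ((hu.memLp_apply hL hs).sub (hu.memLp_apply hL ht)).1.aemeasurable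
  rw [variance_of_integral_eq_zero hm (hu.intrinsic.integral_sub_eq_zero hs ht), h1,
    ← hfin.tsum_eq, wmVariogram]
  refine tsum_congr fun n => ?_
  rw [real_inner_comm, hinner]
  ring

theorem isWhittleMaternVariogram_wmVariogram {κ τ α β : ℝ} (hτ : 0 < τ)
    (hαβ : (d : ℝ) / 2 < α + β) (hL : 0 < L) :
    IsWhittleMaternVariogram.{w} (cube d L) κ τ α β (wmVariogram κ τ α β L) :=
  ⟨exists_isIntrinsicWhittleMatern hτ hαβ hL, fun _ _ _ _ _ hu _ hs _ ht =>
    hu.variance_eq hτ hαβ hL hs ht⟩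

end Uniqueness

/-! ## The spectral density -/

section SpectralDensity

/-- The spectral density `r ↦ 1 / (r^(2β) (κ² + r²)^α)`. -/
noncomputable def spectralDensity (κ α β r : ℝ) : ℝ := (r ^ (2 * β) * (κ ^ 2 + r ^ 2) ^ α)⁻¹

lemma spectralDensity_nonneg (κ α β : ℝ) {r : ℝ} (hr : 0 ≤ r) : 0 ≤ spectralDensity κ α β r := by
  unfold spectralDensity; positivity

lemma spectralDensity_pos (κ α β : ℝ) {r : ℝ} (hr : 0 < r) : 0 < spectralDensity κ α β r := by
  unfold spectralDensity; positivity

lemma continuousOn_spectralDensity (κ α β : ℝ) :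
    ContinuousOn (spectralDensity κ α β) (Set.Ioi 0) := by
  refine ContinuousOn.inv₀ (ContinuousOn.mul ?_ ?_) fun r hr => ?_
  · exact continuousOn_id.rpow_const fun r hr => Or.inl (Set.mem_Ioi.1 hr).ne'
  · refine ContinuousOn.rpow_const (by fun_prop) fun r hr => Or.inl ?_
    have := Set.mem_Ioi.1 hr
    positivity
  · have := Set.mem_Ioi.1 hr
    positivity

/-- A radial majorant behaving like `r^(-a)` at `0` and like `r^(-b)` at infinity. -/
noncomputable def radialMajorant (a b r : ℝ) : ℝ := if r ≤ 1 then r ^ (-a) else r ^ (-b)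

lemma radialMajorant_nonneg (a b : ℝ) {r : ℝ} (hr : 0 ≤ r) : 0 ≤ radialMajorant a b r := by
  unfold radialMajorant; split_ifs <;> positivity

/-- Monotonicity allows a bound at a rounded frequency to be replaced by one at a shorter vector
that does not depend on `L`. -/
lemma radialMajorant_antitoneOn {a b : ℝ} (ha : 0 ≤ a) (hab : a ≤ b) :
    AntitoneOn (radialMajorant a b) (Set.Ioi 0) := by
  intro x hx y hy hxy
  have hx' : 0 < x := hx
  have hy' : 0 < y := hy
  unfold radialMajorant
  split_ifs with h1 h2 h2
  · exact Real.rpow_le_rpow_of_nonpos hx' hxy (by linarith)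
  · exact absurd (hxy.trans h1) h2
  · calc y ^ (-b) ≤ 1 := Real.rpow_le_one_of_one_le_of_nonpos (by linarith) (by linarith)
      _ ≤ x ^ (-a) := Real.one_le_rpow_of_pos_of_le_one_of_nonpos hx' h2 (by linarith)
  · exact Real.rpow_le_rpow_of_nonpos hx' hxy (by linarith)

lemma integrableOn_rpow_mul_radialMajorant {a b e : ℝ} (ha : a < e + 1) (hb : e + 1 < b) :
    IntegrableOn (fun r => r ^ e * radialMajorant a b r) (Set.Ioi 0) := by
  rw [← Set.Ioc_union_Ioi_eq_Ioi zero_le_one]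
  refine IntegrableOn.union ?_ ?_
  · have h1 : IntegrableOn (fun r : ℝ => r ^ (e - a)) (Set.Ioc 0 1) :=
      (intervalIntegrable_iff_integrableOn_Ioc_of_le zero_le_one).1
        (intervalIntegral.intervalIntegrable_rpow' (by linarith))
    refine h1.congr_fun (fun r hr => ?_) measurableSet_Ioc
    simp only [radialMajorant, if_pos hr.2]
    rw [← Real.rpow_add hr.1, sub_eq_add_neg]
  · have h1 : IntegrableOn (fun r : ℝ => r ^ (e - b)) (Set.Ioi 1) :=
      integrableOn_Ioi_rpow_of_lt (by linarith) one_pos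
    refine h1.congr_fun (fun r hr => ?_) measurableSet_Ioi
    have hr' : (1 : ℝ) < r := hr
    simp only [radialMajorant, if_neg (not_le.2 hr')]
    rw [← Real.rpow_add (by linarith), sub_eq_add_neg]

lemma integrable_radialMajorant_norm {d : ℕ} (hd : 1 ≤ d) {a b : ℝ} (ha : a < d) (hb : d < b) :
    Integrable fun x : EuclideanSpace ℝ (Fin d) => radialMajorant a b ‖x‖ := by
  have : Nonempty (Fin d) := ⟨⟨0, hd⟩⟩
  rw [integrable_fun_norm_addHaar volume (f := radialMajorant a b)]
  refine (integrableOn_rpow_mul_radialMajorant (e := (d : ℝ) - 1) (a := a) (b := b) (by linarith)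
    (by linarith)).congr_fun (fun r _ => ?_) measurableSet_Ioi
  rw [finrank_euclideanSpace_fin, smul_eq_mul, ← Real.rpow_natCast, Nat.cast_sub hd, Nat.cast_one]

/-- The factor `min 1 (r ^ 2)` stands for the squared increment of a bounded Lipschitz function of
frequency. The order at the origin is `2β - 2` if `κ > 0` and `2(α + β) - 2` if `κ = 0`, which is
less than `d` by hypothesis; at infinity the decay exponent is `2(α + β) > d`. -/
lemma exists_spectralDensity_mul_le {d : ℕ} (hd : 1 ≤ d) {κ α β : ℝ} (hκ : 0 ≤ κ)
    (hβd : β < 1 + (d : ℝ) / 2) (hαβ : (d : ℝ) / 2 < α + β)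
    (hκ0 : κ = 0 → α + β < 1 + (d : ℝ) / 2) :
    ∃ C a b : ℝ, 0 ≤ C ∧ 0 ≤ a ∧ a < d ∧ d < b ∧
      ∀ r, 0 < r → spectralDensity κ α β r * min 1 (r ^ 2) ≤ C * radialMajorant a b r := by
  have hd' : (1 : ℝ) ≤ d := by exact_mod_cast hd
  have hsmall : ∃ C a : ℝ, 0 ≤ C ∧ 0 ≤ a ∧ a < d ∧
      ∀ r, 0 < r → r ≤ 1 → spectralDensity κ α β r * r ^ 2 ≤ C * r ^ (-a) := by
    have key : ∀ e : ℝ, e < 1 + (d : ℝ) / 2 → ∃ a : ℝ, 0 ≤ a ∧ a < d ∧ ∀ r : ℝ, 0 < r → r ≤ 1 →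
        r ^ (-(2 * e)) * r ^ 2 ≤ r ^ (-a) := by
      intro e he
      -- The exponent is truncated at `0` so that the majorant stays nonincreasing even when the
      -- density itself vanishes at the origin.
      refine ⟨max 0 (2 * e - 2), le_max_left _ _, max_lt (by linarith) (by linarith),
        fun r h0 h1 => ?_⟩
      rw [← Real.rpow_natCast r 2, ← Real.rpow_add h0]
      refine Real.rpow_le_rpow_of_exponent_ge h0 h1 ?_
      have := le_max_right 0 (2 * e - 2)
      push_cast
      linarith
    rcases hκ.eq_or_lt with h | h
    · obtain ⟨a, ha0, had, ha⟩ := key (α + β) (hκ0 h.symm)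
      refine ⟨1, a, zero_le_one, ha0, had, fun r h0 h1 => ?_⟩
      refine le_trans (le_of_eq ?_) ((ha r h0 h1).trans_eq (one_mul _).symm)
      rw [spectralDensity, ← h, ← Real.rpow_natCast r 2]
      simp only [ne_eq, OfNat.ofNat_ne_zero, not_false_eq_true, zero_pow, zero_add]
      rw [← Real.rpow_mul h0.le, ← Real.rpow_add h0, ← Real.rpow_neg h0.le]
      push_cast
      ring_nf
    · obtain ⟨a, ha0, had, ha⟩ := key β hβd
      have hκ2 : 0 < κ ^ 2 := by positivity
      -- The power is monotone in `r` on `(0, 1]`, in a direction depending on the sign of `α`; the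
      -- sum of its two end values bounds it in either case.
      refine ⟨(κ ^ 2) ^ (-α) + (κ ^ 2 + 1) ^ (-α), a, by positivity, ha0, had, fun r h0 h1 => ?_⟩
      have h2 : (κ ^ 2 + r ^ 2) ^ (-α) ≤ (κ ^ 2) ^ (-α) + (κ ^ 2 + 1) ^ (-α) := by
        rcases le_total 0 α with hα | hα
        · have : (κ ^ 2 + r ^ 2) ^ (-α) ≤ (κ ^ 2) ^ (-α) :=
            Real.rpow_le_rpow_of_nonpos hκ2 (by nlinarith) (by linarith)
          have h3 : 0 ≤ (κ ^ 2 + 1) ^ (-α) := by positivity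
          linarith
        · have : (κ ^ 2 + r ^ 2) ^ (-α) ≤ (κ ^ 2 + 1) ^ (-α) :=
            Real.rpow_le_rpow (by positivity) (by nlinarith) (by linarith)
          have h3 : 0 ≤ (κ ^ 2) ^ (-α) := by positivity
          linarith
      have h3 : 0 < κ ^ 2 + r ^ 2 := by positivity
      rw [spectralDensity, mul_inv, ← Real.rpow_neg h0.le, ← Real.rpow_neg h3.le]
      calc r ^ (-(2 * β)) * (κ ^ 2 + r ^ 2) ^ (-α) * r ^ 2
          = (κ ^ 2 + r ^ 2) ^ (-α) * (r ^ (-(2 * β)) * r ^ 2) := by ring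
        _ ≤ _ := mul_le_mul h2 (ha r h0 h1) (by positivity) (by positivity)
  obtain ⟨C, a, hC, ha0, had, hs⟩ := hsmall
  have hlarge : ∀ r, 1 < r →
      spectralDensity κ α β r ≤ (κ ^ 2 + 1) ^ |α| * r ^ (-(2 * (α + β))) := by
    intro r hr
    have h0 : 0 < r := by linarith
    have h3 : 0 < κ ^ 2 + r ^ 2 := by positivity
    have hr2 : 1 ≤ r ^ 2 := one_le_pow₀ hr.le
    have hα : (κ ^ 2 + r ^ 2) ^ (-α) ≤ (κ ^ 2 + 1) ^ |α| * (r ^ 2) ^ (-α) := by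
      rcases le_total 0 α with h | h
      · calc (κ ^ 2 + r ^ 2) ^ (-α) ≤ (r ^ 2) ^ (-α) :=
              Real.rpow_le_rpow_of_nonpos (by positivity) (by nlinarith [sq_nonneg κ]) (by linarith)
          _ ≤ (κ ^ 2 + 1) ^ |α| * (r ^ 2) ^ (-α) :=
            le_mul_of_one_le_left (by positivity)
              (Real.one_le_rpow (by nlinarith [sq_nonneg κ]) (abs_nonneg _))
      · rw [abs_of_nonpos h, ← Real.mul_rpow (by positivity) (by positivity)]
        exact Real.rpow_le_rpow h3.le (by nlinarith [sq_nonneg κ]) (by linarith)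
    rw [spectralDensity, mul_inv, ← Real.rpow_neg h0.le, ← Real.rpow_neg h3.le]
    calc r ^ (-(2 * β)) * (κ ^ 2 + r ^ 2) ^ (-α)
        ≤ r ^ (-(2 * β)) * ((κ ^ 2 + 1) ^ |α| * (r ^ 2) ^ (-α)) := by gcongr
      _ = _ := by
        rw [← Real.rpow_natCast r 2, ← Real.rpow_mul h0.le, mul_left_comm, ← Real.rpow_add h0]
        push_cast
        ring_nf
  refine ⟨max C ((κ ^ 2 + 1) ^ |α|), a, 2 * (α + β), le_max_of_le_left hC, ha0, had, by linarith,
    fun r hr => ?_⟩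
  have hsd := spectralDensity_nonneg κ α β hr.le
  unfold radialMajorant
  split_ifs with h1
  · calc spectralDensity κ α β r * min 1 (r ^ 2) ≤ spectralDensity κ α β r * r ^ 2 := by
          gcongr; exact min_le_right _ _
      _ ≤ C * r ^ (-a) := hs r hr h1
      _ ≤ _ := by gcongr; exact le_max_left _ _
  · calc spectralDensity κ α β r * min 1 (r ^ 2) ≤ spectralDensity κ α β r :=
          mul_le_of_le_one_right hsd (min_le_left _ _)
      _ ≤ _ := hlarge r (not_le.1 h1)
      _ ≤ _ := by gcongr; exact le_max_right _ _

/-- Functions dominated by the spectral density times `min 1 ‖x‖²` are integrable. -/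
lemma integrable_spectralDensity_mul {d : ℕ} (hd : 1 ≤ d) {κ α β : ℝ} (hκ : 0 ≤ κ)
    (hβd : β < 1 + (d : ℝ) / 2) (hαβ : (d : ℝ) / 2 < α + β)
    (hκ0 : κ = 0 → α + β < 1 + (d : ℝ) / 2) {q : EuclideanSpace ℝ (Fin d) → ℝ}
    (hq : Measurable q) {K : ℝ} (hqK : ∀ x, |q x| ≤ K * min 1 (‖x‖ ^ 2)) :
    Integrable fun x => spectralDensity κ α β ‖x‖ * q x := by
  have : Nonempty (Fin d) := ⟨⟨0, hd⟩⟩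
  obtain ⟨C, a, b, hC, ha0, had, hdb, h⟩ := exists_spectralDensity_mul_le hd hκ hβd hαβ hκ0
  refine ((integrable_radialMajorant_norm hd had hdb).const_mul (|K| * C)).mono' ?_ ?_
  · refine Measurable.aestronglyMeasurable (Measurable.mul ?_ hq)
    unfold spectralDensity
    fun_prop
  · have h0 : ∀ᵐ x : EuclideanSpace ℝ (Fin d), x ≠ 0 := by
      simp [ae_iff]
    filter_upwards [h0] with x hx
    have hx' : 0 < ‖x‖ := norm_pos_iff.2 hx
    have hs := spectralDensity_nonneg κ α β hx'.le
    rw [Real.norm_eq_abs, abs_mul, abs_of_nonneg hs]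
    calc spectralDensity κ α β ‖x‖ * |q x|
        ≤ spectralDensity κ α β ‖x‖ * (|K| * min 1 (‖x‖ ^ 2)) := by
          gcongr
          exact (hqK x).trans (by gcongr; exact le_abs_self K)
      _ = |K| * (spectralDensity κ α β ‖x‖ * min 1 (‖x‖ ^ 2)) := by ring
      _ ≤ |K| * (C * radialMajorant a b ‖x‖) :=
          mul_le_mul_of_nonneg_left (h _ hx') (abs_nonneg K)
      _ = _ := by ring

end SpectralDensity

/-! ## Rounding to shifted lattices -/

section Rounding

/-- An integer of the same parity as `q` nearest to `2 * y`. -/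
noncomputable def roundInt (q : Bool) (y : ℝ) : ℤ :=
  2 * ⌊y + (bif q then 0 else 1 / 2)⌋ + (bif q then 1 else 0)

lemma abs_two_mul_sub_roundInt_le (q : Bool) (y : ℝ) : |2 * y - roundInt q y| ≤ 1 := by
  cases q
  · have h1 := Int.floor_le (y + 1 / 2)
    have h2 := Int.lt_floor_add_one (y + 1 / 2)
    simp only [roundInt, cond_false]
    push_cast
    rw [abs_le]; constructor <;> linarith
  · have h1 := Int.floor_le (y + 0)
    have h2 := Int.lt_floor_add_one (y + 0)
    simp only [roundInt, cond_true]
    push_cast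
    rw [abs_le]; constructor <;> linarith

lemma measurable_roundInt (q : Bool) : Measurable (roundInt q) := by
  unfold roundInt
  have : Measurable fun y : ℝ => ⌊y + (bif q then 0 else 1 / 2)⌋ :=
    Int.measurable_floor.comp (measurable_id.add_const _)
  exact (measurable_of_countable fun k : ℤ => 2 * k + (bif q then 1 else 0)).comp this

lemma volume_setOf_roundInt_eq (q : Bool) (m : ℤ) :
    volume {y | roundInt q y = m} = if decide (m % 2 = 1) = q then 1 else 0 := by
  split_ifs with h
  · have : {y | roundInt q y = m} = Set.Ico (((m / 2 : ℤ) : ℝ) - (bif q then 0 else 1 / 2))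
        (((m / 2 : ℤ) : ℝ) + 1 - (bif q then 0 else 1 / 2)) := by
      ext y
      have h2 : roundInt q y = m ↔ ⌊y + (bif q then 0 else 1 / 2)⌋ = m / 2 := by
        cases q <;> simp only [roundInt, cond_false, cond_true, decide_eq_false_iff_not,
          decide_eq_true_eq] at h ⊢ <;> omega
      rw [Set.mem_ofPred_eq, h2, Int.floor_eq_iff, Set.mem_Ico]
      constructor <;> rintro ⟨h3, h4⟩ <;> constructor <;> linarith
    rw [this, Real.volume_Ico]
    ring_nf
    simp
  · have : {y | roundInt q y = m} = ∅ := by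
      ext y
      simp only [Set.mem_ofPred_eq, Set.mem_empty_iff_false, iff_false]
      intro hy
      refine h ?_
      cases q <;> simp only [roundInt, cond_false, cond_true, decide_eq_false_iff_not,
          decide_eq_true_eq] at hy ⊢ <;> omega
    rw [this, measure_empty]

/-- The parity of a natural number, `true` for odd numbers. -/
def parity (n : ℕ) : Bool := decide (n % 2 = 1)

/-- The integers `n` and `-n` own one unit cell each and coincide for `n = 0`. This reproduces the
factors `2` and `1` in the normalisation of the cosines. -/
lemma volume_setOf_natAbs_roundInt_eq (q : Bool) (n : ℕ) :
    volume {y | (roundInt q y).natAbs = n} =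
      if parity n = q then (if n = 0 then 1 else 2) else 0 := by
  have h1 : {y | (roundInt q y).natAbs = n} =
      {y | roundInt q y = n} ∪ {y | roundInt q y = -n} := by
    ext y
    simp only [Set.mem_ofPred_eq, Set.mem_union]
    omega
  rcases eq_or_ne n 0 with rfl | hn
  · rw [h1]
    simp only [CharP.cast_eq_zero, neg_zero, Set.union_self, volume_setOf_roundInt_eq, parity]
    simp
  · rw [h1, measure_union, volume_setOf_roundInt_eq, volume_setOf_roundInt_eq, if_neg hn, parity]
    · have h2 : (decide ((n : ℤ) % 2 = 1)) = decide (n % 2 = 1) := by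
        rw [decide_eq_decide]; omega
      have h3 : (decide ((-n : ℤ) % 2 = 1)) = decide (n % 2 = 1) := by
        rw [decide_eq_decide]; omega
      rw [h2, h3]
      split_ifs
      · exact one_add_one_eq_two
      · exact add_zero 0
    · rw [Set.disjoint_left]
      intro y hy hy'
      simp only [Set.mem_ofPred_eq] at hy hy'
      omega
    · exact measurable_roundInt q (measurableSet_singleton _)

variable {d : ℕ}

/-- The rounding map `ℝ^d → ℕ^d` in units of `π / L`, with prescribed parities, up to signs. -/
noncomputable def latticeMap (p : Fin d → Bool) (L : ℝ) (x : EuclideanSpace ℝ (Fin d)) :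
    Fin d → ℕ := fun j => (roundInt (p j) (L / (2 * Real.pi) * x j)).natAbs

lemma measurable_latticeMap (p : Fin d → Bool) (L : ℝ) : Measurable (latticeMap p L) := by
  refine measurable_pi_lambda _ fun j => ?_
  have h1 : Measurable fun x : EuclideanSpace ℝ (Fin d) => L / (2 * Real.pi) * x j := by fun_prop
  exact (measurable_of_countable Int.natAbs).comp ((measurable_roundInt (p j)).comp h1)

/-- Frequencies of fixed parity are spaced by `2π/L` in each coordinate, so the cell volume is
`(2π)^d` times the squared normalising constant of `neumannCos L n`, exactly and not only
asymptotically. -/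
lemma measureReal_latticeMap_preimage (p : Fin d → Bool) {L : ℝ} (hL : 0 < L) (n : Fin d → ℕ) :
    volume.real (latticeMap p L ⁻¹' {n}) =
      if (fun j => parity (n j)) = p then
        (2 * Real.pi) ^ d * ∏ j, ((if n j = 0 then 1 else 2) / L) else 0 := by
  have hpi := Real.pi_pos
  have h1 : latticeMap p L ⁻¹' {n} = (WithLp.ofLp : EuclideanSpace ℝ (Fin d) → Fin d → ℝ) ⁻¹'
      (Set.univ.pi fun j => (fun y => L / (2 * Real.pi) * y) ⁻¹'
        {y | (roundInt (p j) y).natAbs = n j}) := by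
    ext x
    simp only [Set.mem_preimage, Set.mem_singleton_iff, Set.mem_univ_pi, Set.mem_ofPred_eq,
      latticeMap, funext_iff]
  have hms : ∀ j, MeasurableSet {y | (roundInt (p j) y).natAbs = n j} := fun j =>
    ((measurable_of_countable Int.natAbs).comp (measurable_roundInt (p j)))
      (measurableSet_singleton (n j))
  have hc : L / (2 * Real.pi) ≠ 0 := by positivity
  rw [h1, measureReal_def, (PiLp.volume_preserving_ofLp (Fin d)).measure_preimage
    (MeasurableSet.univ_pi fun j => (hms j).preimage (by fun_prop)).nullMeasurableSet, volume_pi_pi]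
  simp_rw [Real.volume_preimage_mul_left hc, volume_setOf_natAbs_roundInt_eq]
  rw [ENNReal.toReal_prod]
  have h2 : ∀ j, (ENNReal.ofReal |(L / (2 * Real.pi))⁻¹| *
      if parity (n j) = p j then (if n j = 0 then 1 else 2) else 0).toReal =
      if parity (n j) = p j then (2 * Real.pi) * ((if n j = 0 then 1 else 2) / L) else 0 := by
    intro j
    rw [ENNReal.toReal_mul, ENNReal.toReal_ofReal (abs_nonneg _), abs_of_pos (by positivity)]
    split_ifs <;> simp <;> ring
  simp_rw [h2]
  split_ifs with h
  · have : ∀ j, parity (n j) = p j := fun j => congrFun h j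
    simp only [this, if_true, Finset.prod_mul_distrib, Finset.prod_const, Finset.card_univ,
      Fintype.card_fin, mul_pow]
  · obtain ⟨j, hj⟩ := Function.ne_iff.1 h
    exact Finset.prod_eq_zero (Finset.mem_univ j) (if_neg hj)

lemma integral_comp_latticeMap (p : Fin d → Bool) {L : ℝ} (hL : 0 < L) {g : (Fin d → ℕ) → ℝ}
    (hg : Integrable fun x => g (latticeMap p L x)) :
    ∫ x, g (latticeMap p L x) = ∑' n, (if (fun j => parity (n j)) = p then
        (2 * Real.pi) ^ d * ∏ j, ((if n j = 0 then 1 else 2) / L) else 0) * g n := by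
  have hm := measurable_latticeMap p L
  have hgm : AEStronglyMeasurable g (volume.map (latticeMap p L)) :=
    (measurable_of_countable g).aestronglyMeasurable
  rw [← integral_map hm.aemeasurable hgm, integral_countable
    ((integrable_map_measure hgm hm.aemeasurable).2 hg)]
  refine tsum_congr fun n => ?_
  rw [measureReal_def, Measure.map_apply hm (measurableSet_singleton n), ← measureReal_def,
    measureReal_latticeMap_preimage p hL, smul_eq_mul]

/-- The frequency vector `π n / L`. -/
noncomputable def freq (L : ℝ) (n : Fin d → ℕ) : EuclideanSpace ℝ (Fin d) :=
  WithLp.toLp 2 fun j => n j * Real.pi / L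

lemma neumannEig_eq_norm_freq_sq (L : ℝ) (n : Fin d → ℕ) : neumannEig L n = ‖freq L n‖ ^ 2 := by
  rw [EuclideanSpace.norm_sq_eq, neumannEig]
  simp only [freq, Real.norm_eq_abs, sq_abs]

lemma abs_freq_latticeMap_sub_abs_le (p : Fin d → Bool) {L : ℝ} (hL : 0 < L)
    (x : EuclideanSpace ℝ (Fin d)) (j : Fin d) :
    |freq L (latticeMap p L x) j - abs (x j)| ≤ Real.pi / L := by
  have hpi := Real.pi_pos
  have h1 := abs_two_mul_sub_roundInt_le (p j) (L / (2 * Real.pi) * x j)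
  have h2 := (abs_abs_sub_abs_le _ _).trans h1
  have h3 : freq L (latticeMap p L x) j =
      |(roundInt (p j) (L / (2 * Real.pi) * x j) : ℝ)| * (Real.pi / L) := by
    simp only [freq, latticeMap]
    rw [Nat.cast_natAbs]
    push_cast
    ring
  have h4 : |x j| = |2 * (L / (2 * Real.pi) * x j)| * (Real.pi / L) := by
    have e : x j = 2 * (L / (2 * Real.pi) * x j) * (Real.pi / L) := by field_simp
    calc |x j| = |2 * (L / (2 * Real.pi) * x j) * (Real.pi / L)| := by rw [← e]
      _ = _ := by rw [abs_mul, abs_of_pos (a := Real.pi / L) (by positivity)]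
  rw [h3, h4, ← sub_mul, abs_mul, abs_sub_comm, abs_of_pos (by positivity : 0 < Real.pi / L)]
  exact mul_le_of_le_one_left (by positivity) h2

/-- A nonzero rounded frequency has norm at least `π/L`, which already dominates the rounding error
in every coordinate. Hence `|xⱼ|` is at most twice that norm, and the factor `d` is a crude passage
to the Euclidean norm. -/
lemma norm_le_mul_norm_freq_latticeMap (p : Fin d → Bool) {L : ℝ} (hL : 0 < L)
    {x : EuclideanSpace ℝ (Fin d)} (hx : latticeMap p L x ≠ 0) :
    ‖x‖ ≤ 2 * d * ‖freq L (latticeMap p L x)‖ := by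
  have hpi := Real.pi_pos
  set N := ‖freq L (latticeMap p L x)‖ with hN
  have hcoord : ∀ j, |freq L (latticeMap p L x) j| ≤ N := fun j => by
    rw [← Real.norm_eq_abs]; exact PiLp.norm_apply_le _ j
  have h1 : Real.pi / L ≤ N := by
    obtain ⟨j, hj⟩ := Function.ne_iff.1 hx
    refine le_trans ?_ (hcoord j)
    have h2 : (1 : ℝ) ≤ latticeMap p L x j := by exact_mod_cast Nat.pos_of_ne_zero hj
    simp only [freq]
    rw [abs_of_nonneg (by positivity), mul_div_assoc]
    exact le_mul_of_one_le_left (by positivity) h2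
  have h3 : ∀ j, |x j| ≤ 2 * N := fun j => by
    have h4 := (abs_le.1 (abs_freq_latticeMap_sub_abs_le p hL x j)).1
    have h5 := (abs_le.1 (hcoord j)).2
    linarith
  have hN0 : 0 ≤ N := norm_nonneg _
  refine abs_le_of_sq_le_sq' ?_ (by positivity) |>.2
  rw [EuclideanSpace.norm_sq_eq]
  calc ∑ j, ‖x j‖ ^ 2 ≤ ∑ _j : Fin d, (2 * N) ^ 2 := by
        refine Finset.sum_le_sum fun j _ => ?_
        exact pow_le_pow_left₀ (norm_nonneg _) (h3 j) 2
    _ = d * (2 * N) ^ 2 := by simp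
    _ ≤ (d : ℝ) ^ 2 * (2 * N) ^ 2 := by
      gcongr
      have : (d : ℝ) ≤ (d : ℝ) ^ 2 := by exact_mod_cast Nat.le_self_pow two_ne_zero d
      exact this
    _ = (2 * d * N) ^ 2 := by ring

end Rounding

/-! ## The limit of the variograms on cubes -/

section Limit

variable {d : ℕ}

lemma Finset.abs_prod_sub_prod_le {ι : Type*} (S : Finset ι) {a b : ι → ℝ} (ha : ∀ i, |a i| ≤ 1)
    (hb : ∀ i, |b i| ≤ 1) : |∏ i ∈ S, a i - ∏ i ∈ S, b i| ≤ ∑ i ∈ S, |a i - b i| := by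
  classical
  induction S using Finset.induction_on with
  | empty => simp
  | insert i S hi ih =>
    rw [Finset.prod_insert hi, Finset.prod_insert hi, Finset.sum_insert hi]
    have h1 : |∏ i ∈ S, a i| ≤ 1 := by
      rw [Finset.abs_prod]
      exact Finset.prod_le_one (fun _ _ => abs_nonneg _) fun i _ => ha i
    calc |a i * ∏ i ∈ S, a i - b i * ∏ i ∈ S, b i|
        = |(a i - b i) * ∏ i ∈ S, a i + b i * (∏ i ∈ S, a i - ∏ i ∈ S, b i)| := by ring_nf
      _ ≤ |a i - b i| * |∏ i ∈ S, a i| + |b i| * |∏ i ∈ S, a i - ∏ i ∈ S, b i| := by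
        rw [← abs_mul, ← abs_mul]; exact abs_add_le _ _
      _ ≤ |a i - b i| * 1 + 1 * ∑ i ∈ S, |a i - b i| := by
        gcongr
        exact hb i
      _ = _ := by ring

/-- The sine (for `true`) or the cosine (for `false`). -/
noncomputable def trigFactor (q : Bool) (y : ℝ) : ℝ := bif q then Real.sin y else Real.cos y

lemma continuous_trigFactor (q : Bool) : Continuous (trigFactor q) := by
  cases q
  · exact Real.continuous_cos
  · exact Real.continuous_sin

lemma abs_trigFactor_le (q : Bool) (y : ℝ) : |trigFactor q y| ≤ 1 := by
  cases q
  · exact Real.abs_cos_le_one y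
  · exact Real.abs_sin_le_one y

lemma abs_trigFactor_sub_le (q : Bool) (x y : ℝ) :
    |trigFactor q x - trigFactor q y| ≤ |x - y| := by
  cases q
  · exact Real.abs_cos_sub_cos_le x y
  · exact Real.abs_sin_sub_sin_le x y

/-- Quarter turns permute `±cos` and `±sin`. Only `ε ^ 2 = 1` matters, since the sign is common to
`s` and `t` and disappears in the squared increment. -/
lemma exists_cos_add_nat_mul_pi_div_two (n : ℕ) : ∃ ε : ℝ, ε ^ 2 = 1 ∧
    ∀ y, Real.cos (y + n * (Real.pi / 2)) = ε * trigFactor (parity n) y := by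
  rcases Nat.even_or_odd' n with ⟨k, rfl | rfl⟩
  · refine ⟨(-1) ^ k, by rw [← pow_mul, mul_comm, pow_mul]; simp, fun y => ?_⟩
    have h1 : parity (2 * k) = false := by simp [parity]
    rw [h1, trigFactor, cond_false, ← Real.cos_add_nat_mul_pi]
    push_cast
    ring_nf
  · refine ⟨-(-1) ^ k, by rw [neg_sq, ← pow_mul, mul_comm, pow_mul]; simp, fun y => ?_⟩
    have h1 : parity (2 * k + 1) = true := by simp [parity, Nat.add_mod]
    rw [h1, trigFactor, cond_true, neg_mul, ← Real.sin_add_nat_mul_pi, ← Real.cos_add_pi_div_two]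
    push_cast
    ring_nf

/-- Products of sines and cosines of `ξ j * s j`. -/
noncomputable def trigProd (p : Fin d → Bool) (s ξ : EuclideanSpace ℝ (Fin d)) : ℝ :=
  ∏ j, trigFactor (p j) (ξ j * s j)

lemma continuous_trigProd (p : Fin d → Bool) (s : EuclideanSpace ℝ (Fin d)) :
    Continuous (trigProd p s) :=
  continuous_finsetProd _ fun j _ => (continuous_trigFactor (p j)).comp (by fun_prop)

lemma abs_trigProd_le (p : Fin d → Bool) (s ξ : EuclideanSpace ℝ (Fin d)) :
    |trigProd p s ξ| ≤ 1 := by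
  rw [trigProd, Finset.abs_prod]
  exact Finset.prod_le_one (fun _ _ => abs_nonneg _) fun i _ => abs_trigFactor_le _ _

/-- The difference is at most `2`, and at most `d ‖s - t‖ ‖ξ‖` because the factors are `1`-Lipschitz
and bounded by `1`; the constant is the sum of the two squared bounds. -/
lemma sq_trigProd_sub_le (p : Fin d → Bool) (s t ξ : EuclideanSpace ℝ (Fin d)) :
    (trigProd p s ξ - trigProd p t ξ) ^ 2 ≤ (4 + (d * ‖s - t‖) ^ 2) * min 1 (‖ξ‖ ^ 2) := by
  have h1 : |trigProd p s ξ - trigProd p t ξ| ≤ 2 := by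
    have := abs_sub (trigProd p s ξ) (trigProd p t ξ)
    have := abs_trigProd_le p s ξ
    have := abs_trigProd_le p t ξ
    linarith
  have h2 : |trigProd p s ξ - trigProd p t ξ| ≤ d * ‖s - t‖ * ‖ξ‖ := by
    refine (Finset.abs_prod_sub_prod_le _ (fun _ => abs_trigFactor_le _ _)
      fun _ => abs_trigFactor_le _ _).trans ?_
    calc ∑ j, |trigFactor (p j) (ξ j * s j) - trigFactor (p j) (ξ j * t j)|
        ≤ ∑ _j : Fin d, ‖ξ‖ * ‖s - t‖ := by
          refine Finset.sum_le_sum fun j _ => (abs_trigFactor_sub_le _ _ _).trans ?_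
          rw [← mul_sub, abs_mul]
          gcongr
          · exact PiLp.norm_apply_le ξ j
          · exact PiLp.norm_apply_le (s - t) j
      _ = d * ‖s - t‖ * ‖ξ‖ := by simp; ring
  rw [← sq_abs]
  have h0 := abs_nonneg (trigProd p s ξ - trigProd p t ξ)
  rcases min_choice 1 (‖ξ‖ ^ 2) with h | h <;> rw [h]
  · nlinarith [sq_nonneg ((d : ℝ) * ‖s - t‖)]
  · have := pow_le_pow_left₀ h0 h2 2
    nlinarith [sq_nonneg ‖ξ‖]

/-- The spectral density times the squared difference of two trigonometric products. -/
noncomputable def trigDensity (κ α β : ℝ) (s t : EuclideanSpace ℝ (Fin d)) (p : Fin d → Bool)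
    (ξ : EuclideanSpace ℝ (Fin d)) : ℝ :=
  spectralDensity κ α β ‖ξ‖ * (trigProd p s ξ - trigProd p t ξ) ^ 2

lemma trigDensity_nonneg (κ α β : ℝ) (s t : EuclideanSpace ℝ (Fin d)) (p : Fin d → Bool)
    (ξ : EuclideanSpace ℝ (Fin d)) : 0 ≤ trigDensity κ α β s t p ξ :=
  mul_nonneg (spectralDensity_nonneg _ _ _ (norm_nonneg _)) (sq_nonneg _)

lemma trigDensity_zero (κ α β : ℝ) (s t : EuclideanSpace ℝ (Fin d)) (p : Fin d → Bool) :
    trigDensity κ α β s t p 0 = 0 := by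
  simp [trigDensity, trigProd]

lemma freq_zero (L : ℝ) : freq L (0 : Fin d → ℕ) = 0 := by
  ext j; simp [freq]

lemma exists_neumannCos_eq (L : ℝ) (n : Fin d → ℕ) : ∃ ε : ℝ, ε ^ 2 = 1 ∧
    ∀ s, 0 < L → neumannCos L n s = ε * (∏ j, √((if n j = 0 then 1 else 2) / L)) *
      trigProd (fun j => parity (n j)) s (freq L n) := by
  choose ε hε1 hε using fun j => exists_cos_add_nat_mul_pi_div_two (n j)
  refine ⟨∏ j, ε j, by rw [← Finset.prod_pow]; simp [hε1], fun s hL => ?_⟩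
  simp only [neumannCos, prodFun, trigProd, ← Finset.prod_mul_distrib, cosFactor]
  refine Finset.prod_congr rfl fun j _ => ?_
  have : (n j : ℝ) * Real.pi * (s j / L + 1 / 2) = freq L n j * s j + n j * (Real.pi / 2) := by
    simp only [freq]; ring
  rw [this, hε]
  ring

/-- The term `n = 0` fits the formula too: the left side vanishes by the choice of `wmCoeff`, the
right side because trigonometric products at frequency `0` do not depend on the point. -/
lemma sq_wmCoeff_mul_sub (κ τ α β : ℝ) {L : ℝ} (hL : 0 < L) (s t : EuclideanSpace ℝ (Fin d))
    (n : Fin d → ℕ) :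
    (wmCoeff κ τ α β L n * (neumannCos L n s - neumannCos L n t)) ^ 2 =
      τ⁻¹ ^ 2 * ((∏ j, ((if n j = 0 then 1 else 2) / L)) *
        trigDensity κ α β s t (fun j => parity (n j)) (freq L n)) := by
  rcases eq_or_ne n 0 with rfl | hn
  · rw [freq_zero, trigDensity_zero]
    simp [wmCoeff]
  · obtain ⟨ε, hε1, hε⟩ := exists_neumannCos_eq L n
    have h1 : (∏ j, √((if n j = 0 then 1 else 2) / L)) ^ 2 =
        ∏ j, ((if n j = 0 then 1 else 2) / L) := by
      rw [← Finset.prod_pow]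
      refine Finset.prod_congr rfl fun j _ => Real.sq_sqrt ?_
      split_ifs <;> positivity
    have h2 : (wmSymbol κ α β (neumannEig L n))⁻¹ ^ 2 = spectralDensity κ α β ‖freq L n‖ := by
      rw [inv_pow, wmSymbol_sq _ _ _ (neumannEig_nonneg L n), spectralDensity,
        neumannEig_eq_norm_freq_sq, Real.rpow_mul (norm_nonneg _), Real.rpow_two]
    rw [hε s hL, hε t hL, wmCoeff, if_neg hn, trigDensity, ← h1, ← h2]
    linear_combination (τ⁻¹ ^ 2 * (wmSymbol κ α β (neumannEig L n))⁻¹ ^ 2 *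
      (∏ j, √((if n j = 0 then 1 else 2) / L)) ^ 2 *
      (trigProd (fun j => parity (n j)) s (freq L n) -
        trigProd (fun j => parity (n j)) t (freq L n)) ^ 2) * hε1

/-- The common majorant of the rounded densities. -/
lemma exists_trigDensity_freq_latticeMap_le (hd : 1 ≤ d) {κ α β : ℝ} (hκ : 0 ≤ κ)
    (hβd : β < 1 + (d : ℝ) / 2) (hαβ : (d : ℝ) / 2 < α + β)
    (hκ0 : κ = 0 → α + β < 1 + (d : ℝ) / 2) (s t : EuclideanSpace ℝ (Fin d)) :
    ∃ B : EuclideanSpace ℝ (Fin d) → ℝ, Integrable B ∧ ∀ p : Fin d → Bool, ∀ L : ℝ, 0 < L →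
      ∀ x, x ≠ 0 → |trigDensity κ α β s t p (freq L (latticeMap p L x))| ≤ B x := by
  have hd' : (0 : ℝ) < d := by exact_mod_cast hd
  obtain ⟨C, a, b, hC, ha0, had, hdb, h⟩ := exists_spectralDensity_mul_le hd hκ hβd hαβ hκ0
  -- The dilation by `(2d)⁻¹` makes the argument shorter than any nonzero rounding of `x`, uniformly
  -- in `L` and `p`. In the cell of `0` the density vanishes.
  refine ⟨fun x => (4 + (d * ‖s - t‖) ^ 2) * (C * radialMajorant a b ‖(2 * (d : ℝ))⁻¹ • x‖),
    (((integrable_radialMajorant_norm hd had hdb).comp_smul (by positivity)).const_mul C).const_mul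
      _, fun p L hL x hx => ?_⟩
  rw [abs_of_nonneg (trigDensity_nonneg _ _ _ _ _ _ _)]
  rcases eq_or_ne (latticeMap p L x) 0 with h0 | h0
  · rw [h0, freq_zero, trigDensity_zero]
    have := radialMajorant_nonneg a b (norm_nonneg ((2 * (d : ℝ))⁻¹ • x))
    positivity
  · have h1 := norm_le_mul_norm_freq_latticeMap p hL h0
    set ξ := freq L (latticeMap p L x)
    have hx' : 0 < ‖x‖ := norm_pos_iff.2 hx
    have h2 : ‖(2 * (d : ℝ))⁻¹ • x‖ ≤ ‖ξ‖ := by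
      rw [norm_smul, Real.norm_of_nonneg (by positivity), inv_mul_le_iff₀ (by positivity)]
      exact h1
    have h3 : 0 < ‖(2 * (d : ℝ))⁻¹ • x‖ := by
      rw [norm_smul, Real.norm_of_nonneg (by positivity)]; positivity
    have h4 : 0 < ‖ξ‖ := h3.trans_le h2
    calc spectralDensity κ α β ‖ξ‖ * (trigProd p s ξ - trigProd p t ξ) ^ 2
        ≤ spectralDensity κ α β ‖ξ‖ * ((4 + (d * ‖s - t‖) ^ 2) * min 1 (‖ξ‖ ^ 2)) :=
          mul_le_mul_of_nonneg_left (sq_trigProd_sub_le p s t ξ)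
            (spectralDensity_nonneg _ _ _ h4.le)
      _ = (4 + (d * ‖s - t‖) ^ 2) * (spectralDensity κ α β ‖ξ‖ * min 1 (‖ξ‖ ^ 2)) := by ring
      _ ≤ _ := by
        refine mul_le_mul_of_nonneg_left ((h _ h4).trans ?_) (by positivity)
        exact mul_le_mul_of_nonneg_left
          (radialMajorant_antitoneOn ha0 (had.trans hdb).le h3 h4 h2) hC

lemma measurable_comp_latticeMap (g : (Fin d → ℕ) → ℝ) (p : Fin d → Bool) (L : ℝ) :
    Measurable fun x => g (latticeMap p L x) :=
  (measurable_of_countable g).comp (measurable_latticeMap p L)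

lemma ae_ne_zero (hd : 1 ≤ d) : ∀ᵐ x : EuclideanSpace ℝ (Fin d), x ≠ 0 := by
  have : Nonempty (Fin d) := ⟨⟨0, hd⟩⟩
  simp [ae_iff]

/-- The parity classes partition the indices, and on each the series is the integral of a step
function, with no error term for any `L > 0`. -/
lemma wmVariogram_eq_sum_integral (hd : 1 ≤ d) {κ τ α β : ℝ} (hτ : 0 < τ) (hκ : 0 ≤ κ)
    (hβd : β < 1 + (d : ℝ) / 2) (hαβ : (d : ℝ) / 2 < α + β)
    (hκ0 : κ = 0 → α + β < 1 + (d : ℝ) / 2) {L : ℝ} (hL : 0 < L)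
    (s t : EuclideanSpace ℝ (Fin d)) :
    wmVariogram κ τ α β L s t = τ⁻¹ ^ 2 * ((2 * Real.pi) ^ d)⁻¹ *
      ∑ p : Fin d → Bool, ∫ x, trigDensity κ α β s t p (freq L (latticeMap p L x)) := by
  classical
  have hpi := Real.pi_pos
  obtain ⟨B, hB, hle⟩ := exists_trigDensity_freq_latticeMap_le hd hκ hβd hαβ hκ0 s t
  have hint : ∀ p, Integrable fun x => trigDensity κ α β s t p (freq L (latticeMap p L x)) :=
    fun p => hB.mono'
      (measurable_comp_latticeMap (fun n => trigDensity κ α β s t p (freq L n)) p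
        L).aestronglyMeasurable
      ((ae_ne_zero hd).mono fun x hx => hle p L hL x hx)
  have hsum := summable_sq_wmCoeff_mul (κ := κ) (τ := τ) hαβ hL
    (fun n => abs_neumannCos_sub_le (L := L) n s t)
  set T : (Fin d → ℕ) → ℝ := fun n =>
    (wmCoeff κ τ α β L n * (neumannCos L n s - neumannCos L n t)) ^ 2 with hT
  have hterm : ∀ p n, (if (fun j => parity (n j)) = p then
        (2 * Real.pi) ^ d * ∏ j, ((if n j = 0 then 1 else 2) / L) else 0) *
        trigDensity κ α β s t p (freq L n) =
      τ ^ 2 * (2 * Real.pi) ^ d * (if (fun j => parity (n j)) = p then T n else 0) := by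
    intro p n
    split_ifs with h
    · rw [hT]
      simp only [sq_wmCoeff_mul_sub κ τ α β hL, ← h]
      field_simp
    · simp
  have hsum' : ∀ p : Fin d → Bool,
      Summable fun n : Fin d → ℕ => if (fun j => parity (n j)) = p then T n else 0 := by
    intro p
    refine Summable.of_nonneg_of_le (fun n => ?_) (fun n => ?_) hsum
    · split_ifs
      · exact sq_nonneg _
      · exact le_rfl
    · split_ifs
      · exact le_rfl
      · exact sq_nonneg _
  have h1 : ∀ p, ∫ x, trigDensity κ α β s t p (freq L (latticeMap p L x)) =
      τ ^ 2 * (2 * Real.pi) ^ d *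
        ∑' n : Fin d → ℕ, (if (fun j => parity (n j)) = p then T n else 0) := by
    intro p
    rw [integral_comp_latticeMap (g := fun n => trigDensity κ α β s t p (freq L n)) p hL (hint p),
      ← tsum_mul_left]
    exact tsum_congr (hterm p)
  simp_rw [h1]
  rw [← Finset.mul_sum, ← Summable.tsum_finsetSum fun p _ => hsum' p]
  simp only [Finset.sum_ite_eq, Finset.mem_univ, if_true]
  change tsum T = _
  field_simp

/-- The vector of absolute values of coordinates. -/
noncomputable def absVec (x : EuclideanSpace ℝ (Fin d)) : EuclideanSpace ℝ (Fin d) :=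
  WithLp.toLp 2 fun j => |x j|

lemma norm_absVec (x : EuclideanSpace ℝ (Fin d)) : ‖absVec x‖ = ‖x‖ := by
  simp [EuclideanSpace.norm_eq, absVec]

lemma continuous_absVec : Continuous (absVec : EuclideanSpace ℝ (Fin d) → _) := by
  unfold absVec
  fun_prop

lemma tendsto_freq_latticeMap (p : Fin d → Bool) (x : EuclideanSpace ℝ (Fin d)) :
    Tendsto (fun L => freq L (latticeMap p L x)) atTop (𝓝 (absVec x)) := by
  have h1 : Tendsto (fun L : ℝ => fun j => freq L (latticeMap p L x) j) atTop
      (𝓝 fun j => abs (x j)) := by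
    refine tendsto_pi_nhds.2 fun j => ?_
    rw [tendsto_iff_dist_tendsto_zero]
    refine squeeze_zero' (Eventually.of_forall fun _ => dist_nonneg) ?_
      ((tendsto_const_nhds (x := Real.pi)).div_atTop tendsto_id)
    filter_upwards [eventually_gt_atTop 0] with L hL
    rw [Real.dist_eq]
    exact abs_freq_latticeMap_sub_abs_le p hL x j
  exact ((PiLp.continuous_toLp 2 _).tendsto _).comp h1

lemma continuousAt_trigDensity (κ α β : ℝ) (s t : EuclideanSpace ℝ (Fin d)) (p : Fin d → Bool)
    {ξ : EuclideanSpace ℝ (Fin d)} (hξ : ξ ≠ 0) : ContinuousAt (trigDensity κ α β s t p) ξ := by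
  refine ContinuousAt.mul ?_ ?_
  · exact ContinuousAt.comp (f := fun ξ : EuclideanSpace ℝ (Fin d) => ‖ξ‖)
      ((continuousOn_spectralDensity κ α β).continuousAt (Ioi_mem_nhds (norm_pos_iff.2 hξ)))
      continuous_norm.continuousAt
  · exact (((continuous_trigProd p s).sub (continuous_trigProd p t)).pow 2).continuousAt

lemma tendsto_integral_trigDensity (hd : 1 ≤ d) {κ α β : ℝ} (hκ : 0 ≤ κ)
    (hβd : β < 1 + (d : ℝ) / 2) (hαβ : (d : ℝ) / 2 < α + β)
    (hκ0 : κ = 0 → α + β < 1 + (d : ℝ) / 2) (s t : EuclideanSpace ℝ (Fin d))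
    (p : Fin d → Bool) :
    Tendsto (fun L => ∫ x, trigDensity κ α β s t p (freq L (latticeMap p L x))) atTop
      (𝓝 (∫ x, trigDensity κ α β s t p (absVec x))) := by
  obtain ⟨B, hB, hle⟩ := exists_trigDensity_freq_latticeMap_le hd hκ hβd hαβ hκ0 s t
  refine tendsto_integral_filter_of_dominated_convergence B ?_ ?_ hB ?_
  · exact Eventually.of_forall fun L => (measurable_comp_latticeMap
      (fun n => trigDensity κ α β s t p (freq L n)) p L).aestronglyMeasurable
  · filter_upwards [eventually_gt_atTop 0] with L hL
    exact (ae_ne_zero hd).mono fun x hx => hle p L hL x hx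
  · refine (ae_ne_zero hd).mono fun x hx => ?_
    have h1 : absVec x ≠ 0 := by
      rw [← norm_pos_iff, norm_absVec]; exact norm_pos_iff.2 hx
    exact (continuousAt_trigDensity κ α β s t p h1).tendsto.comp (tendsto_freq_latticeMap p x)

/-- A sum over all parities factorises over coordinates, each factor being `cos cos + sin sin = cos`
of the difference. This is applied to the pairs `(s, s)`, `(t, t)` and `(s, t)` after expanding the
square. -/
lemma sum_sq_trigProd_sub (s t x : EuclideanSpace ℝ (Fin d)) :
    ∑ p : Fin d → Bool, (trigProd p s x - trigProd p t x) ^ 2 =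
      2 * (1 - ∏ j, Real.cos (x j * (s j - t j))) := by
  have key : ∀ u v : EuclideanSpace ℝ (Fin d), ∑ p : Fin d → Bool, trigProd p u x * trigProd p v x =
      ∏ j, Real.cos (x j * (u j - v j)) := by
    intro u v
    have h := Finset.prod_univ_sum (fun _ : Fin d => (Finset.univ : Finset Bool))
      fun j q => trigFactor q (x j * u j) * trigFactor q (x j * v j)
    rw [Fintype.piFinset_univ] at h
    simp only [trigProd, ← Finset.prod_mul_distrib]
    rw [← h]
    refine Finset.prod_congr rfl fun j _ => ?_
    simp only [Fintype.univ_bool, Finset.mem_singleton, Bool.true_eq_false, not_false_eq_true,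
      Finset.sum_insert, Finset.sum_singleton, trigFactor, cond_true, cond_false]
    rw [mul_sub, Real.cos_sub]
    ring
  have h2 : ∀ p : Fin d → Bool, (trigProd p s x - trigProd p t x) ^ 2 =
      trigProd p s x * trigProd p s x + trigProd p t x * trigProd p t x -
        2 * (trigProd p s x * trigProd p t x) := fun p => by ring
  simp only [h2, Finset.sum_sub_distrib, Finset.sum_add_distrib, ← Finset.mul_sum, key]
  simp
  ring

theorem tendsto_wmVariogram (hd : 1 ≤ d) {κ τ α β : ℝ} (hτ : 0 < τ) (hκ : 0 ≤ κ)
    (hβd : β < 1 + (d : ℝ) / 2) (hαβ : (d : ℝ) / 2 < α + β)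
    (hκ0 : κ = 0 → α + β < 1 + (d : ℝ) / 2) (s t : EuclideanSpace ℝ (Fin d)) :
    Tendsto (fun L => wmVariogram κ τ α β L s t) atTop
      (𝓝 (τ⁻¹ ^ 2 * ((2 * Real.pi) ^ d)⁻¹ * ∫ x : EuclideanSpace ℝ (Fin d),
        spectralDensity κ α β ‖x‖ * (2 * (1 - ∏ j, Real.cos (x j * (s j - t j)))))) := by
  have h1 : ∫ x : EuclideanSpace ℝ (Fin d),
      spectralDensity κ α β ‖x‖ * (2 * (1 - ∏ j, Real.cos (x j * (s j - t j)))) =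
      ∑ p : Fin d → Bool, ∫ x, trigDensity κ α β s t p (absVec x) := by
    rw [← integral_finsetSum]
    · refine integral_congr_ae (ae_of_all _ fun x => ?_)
      simp only [trigDensity, norm_absVec]
      rw [← Finset.mul_sum, sum_sq_trigProd_sub]
      congr 3
      refine Finset.prod_congr rfl fun j _ => ?_
      -- Rounding loses the signs of the coordinates, whence `absVec`; the cosine is even, so they
      -- can be restored.
      rw [← Real.cos_abs, abs_mul, ← Real.cos_abs (absVec x j * _), abs_mul]
      simp [absVec]
    · intro p _
      simp only [trigDensity, norm_absVec]
      refine integrable_spectralDensity_mul hd hκ hβd hαβ hκ0 (K := 4 + (d * ‖s - t‖) ^ 2)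
        (q := fun x => (trigProd p s (absVec x) - trigProd p t (absVec x)) ^ 2) ?_ fun x => ?_
      · exact ((((continuous_trigProd p s).sub (continuous_trigProd p t)).comp
          continuous_absVec).pow 2).measurable
      · rw [abs_of_nonneg (sq_nonneg _), ← norm_absVec x]
        exact sq_trigProd_sub_le p s t _
  rw [h1]
  refine Tendsto.congr' ?_ ((tendsto_finsetSum _ fun p _ =>
    tendsto_integral_trigDensity hd hκ hβd hαβ hκ0 s t p).const_mul _)
  filter_upwards [eventually_gt_atTop 0] with L hL
  rw [wmVariogram_eq_sum_integral hd hτ hκ hβd hαβ hκ0 hL]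

end Limit

/-! ## Spherical averages -/

section Sphere

lemma integral_volumeIoiPow (n : ℕ) (g : ℝ → ℝ) :
    ∫ r : Set.Ioi (0 : ℝ), g r ∂Measure.volumeIoiPow n = ∫ r in Set.Ioi (0 : ℝ), r ^ n * g r := by
  simp only [Measure.volumeIoiPow, ENNReal.ofReal]
  rw [integral_withDensity_eq_integral_smul,
    integral_subtype_comap measurableSet_Ioi fun a ↦ Real.toNNReal (a ^ n) • g a,
    setIntegral_congr_fun measurableSet_Ioi fun x hx ↦ ?_]
  · rw [NNReal.smul_def, Real.coe_toNNReal _ (pow_nonneg hx.out.le _), smul_eq_mul]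
  · exact (measurable_subtype_coe.pow_const _).real_toNNReal

lemma integrable_volumeIoiPow_iff (n : ℕ) (g : ℝ → ℝ) :
    Integrable (fun r : Set.Ioi (0 : ℝ) => g r) (Measure.volumeIoiPow n) ↔
      IntegrableOn (fun r => r ^ n * g r) (Set.Ioi 0) := by
  rw [integrableOn_iff_comap_subtypeVal measurableSet_Ioi, Measure.volumeIoiPow,
    integrable_withDensity_iff_integrable_smul' (by fun_prop) (by simp)]
  refine integrable_congr (.of_forall ?_)
  rintro ⟨x, hx : 0 < x⟩
  simp (disch := positivity) [ENNReal.toReal_ofReal]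

variable {E : Type*} [NormedAddCommGroup E] [InnerProductSpace ℝ E] [MeasurableSpace E]
  [BorelSpace E] [FiniteDimensional ℝ E] [Nontrivial E]

lemma integral_eq_integral_toSphere_prod (f : E → ℝ) :
    ∫ x, f x = ∫ z : Metric.sphere (0 : E) 1 × Set.Ioi (0 : ℝ), f (z.2.1 • z.1.1)
      ∂((volume : Measure E).toSphere.prod (Measure.volumeIoiPow (Module.finrank ℝ E - 1))) := by
  have h0 : ∫ x, f x = ∫ x : ({0}ᶜ : Set E), f x ∂((volume : Measure E).comap (↑)) := by
    rw [integral_subtype_comap (measurableSet_singleton (0 : E)).compl f, restrict_compl_singleton]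
  rw [h0, ← (volume : Measure E).measurePreserving_homeomorphUnitSphereProd.integral_comp
    (Homeomorph.measurableEmbedding _)
    fun z : Metric.sphere (0 : E) 1 × Set.Ioi (0 : ℝ) => f (z.2.1 • z.1.1)]
  refine integral_congr_ae (ae_of_all _ fun x => ?_)
  have h := homeomorphUnitSphereProd_symm_apply_coe E (homeomorphUnitSphereProd E x)
  rw [Homeomorph.symm_apply_apply] at h
  exact congrArg f h

lemma integrable_toSphere_prod_iff (f : E → ℝ) :
    Integrable (fun z : Metric.sphere (0 : E) 1 × Set.Ioi (0 : ℝ) => f (z.2.1 • z.1.1))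
      ((volume : Measure E).toSphere.prod (Measure.volumeIoiPow (Module.finrank ℝ E - 1))) ↔
    Integrable f := by
  rw [← (volume : Measure E).measurePreserving_homeomorphUnitSphereProd.integrable_comp_emb
    (Homeomorph.measurableEmbedding _)]
  conv_rhs => rw [← restrict_compl_singleton (μ := (volume : Measure E)) 0, ← IntegrableOn,
    integrableOn_iff_comap_subtypeVal (measurableSet_singleton _).compl]
  refine integrable_congr (ae_of_all _ fun x => ?_)
  have h := homeomorphUnitSphereProd_symm_apply_coe E (homeomorphUnitSphereProd E x)
  rw [Homeomorph.symm_apply_apply] at h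
  exact congrArg f h.symm

end Sphere

/-! ### Moments of the sphere and the Bessel function as a spherical mean -/

section Moments

lemma integral_pow_mul_exp_neg_sq (m : ℕ) :
    ∫ y : ℝ, y ^ (2 * m) * Real.exp (-y ^ 2) = Real.Gamma (m + 1 / 2) := by
  have h1 : ∫ y : ℝ, y ^ (2 * m) * Real.exp (-y ^ 2) =
      ∫ y : ℝ, (fun y => y ^ (2 * m) * Real.exp (-y ^ 2)) |y| := by
    refine integral_congr_ae (ae_of_all _ fun y => ?_)
    simp only [sq_abs, pow_mul]
  have h2 := integral_rpow_mul_exp_neg_rpow (p := 2) (q := 2 * m) two_pos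
    (by have : (0 : ℝ) ≤ m := Nat.cast_nonneg m
        linarith)
  rw [h1, integral_comp_abs (f := fun y => y ^ (2 * m) * Real.exp (-y ^ 2))]
  have h3 : ∫ x in Set.Ioi (0 : ℝ), x ^ (2 * m) * Real.exp (-x ^ 2) =
      ∫ x in Set.Ioi (0 : ℝ), x ^ (2 * (m : ℝ)) * Real.exp (-x ^ (2 : ℝ)) := by
    refine setIntegral_congr_fun measurableSet_Ioi fun x hx => ?_
    rw [← Real.rpow_natCast x (2 * m), Real.rpow_two]
    push_cast
    rfl
  rw [h3, h2, ← mul_assoc]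
  norm_num
  congr 1
  ring

lemma integral_Ioi_pow_mul_pow_mul_exp_neg_sq {d : ℕ} (hd : 1 ≤ d) (m : ℕ) :
    ∫ r in Set.Ioi (0 : ℝ), r ^ (d - 1) * (r ^ (2 * m) * Real.exp (-r ^ 2)) =
      1 / 2 * Real.Gamma (m + d / 2) := by
  have hm : (0 : ℝ) ≤ m := Nat.cast_nonneg m
  have hd' : (1 : ℝ) ≤ d := by exact_mod_cast hd
  have h2 := integral_rpow_mul_exp_neg_rpow (p := 2) (q := 2 * m + (d - 1)) two_pos
    (by linarith)
  have h3 : ∫ r in Set.Ioi (0 : ℝ), r ^ (d - 1) * (r ^ (2 * m) * Real.exp (-r ^ 2)) =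
      ∫ x in Set.Ioi (0 : ℝ), x ^ (2 * (m : ℝ) + (d - 1)) * Real.exp (-x ^ (2 : ℝ)) := by
    refine setIntegral_congr_fun measurableSet_Ioi fun x hx => ?_
    rw [Real.rpow_add hx, Real.rpow_two, ← mul_assoc, mul_comm (x ^ (d - 1)),
      ← Real.rpow_natCast x (2 * m), ← Real.rpow_natCast x (d - 1), Nat.cast_sub hd]
    push_cast
    rfl
  rw [h3, h2]
  congr 2
  ring

/-- Gamma at half-integers, needed to match the factorials in the cosine series with those of the
Bessel series. -/
lemma gamma_natCast_add_half (m : ℕ) :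
    Real.Gamma (m + 1 / 2) * (4 ^ m * (m.factorial : ℝ)) =
      ((2 * m).factorial : ℝ) * √Real.pi := by
  induction m with
  | zero => simp [-one_div, Real.Gamma_one_half_eq]
  | succ k ih =>
    have h1 : Real.Gamma ((k + 1 : ℕ) + 1 / 2) = (k + 1 / 2) * Real.Gamma (k + 1 / 2) := by
      rw [← Real.Gamma_add_one (by positivity)]
      push_cast
      ring_nf
    have h2 : 2 * (k + 1) = (2 * k + 1) + 1 := by ring
    rw [h1, h2, Nat.factorial_succ, Nat.factorial_succ, Nat.factorial_succ]
    push_cast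
    linear_combination (4 * (k + 1) * (k + 1 / 2)) * ih

variable {d : ℕ}

lemma integral_inner_single_pow_mul_exp (j₀ : Fin d) (h : ℝ) (m : ℕ) :
    ∫ x : EuclideanSpace ℝ (Fin d), inner ℝ x (EuclideanSpace.single j₀ h) ^ (2 * m) *
        Real.exp (-‖x‖ ^ 2) =
      h ^ (2 * m) * (Real.Gamma (m + 1 / 2) / √Real.pi) * √Real.pi ^ d := by
  have hpi : √Real.pi ≠ 0 := (Real.sqrt_pos.2 Real.pi_pos).ne'
  set F : Fin d → ℝ → ℝ := fun j y =>
    (if j = j₀ then (h * y) ^ (2 * m) else 1) * Real.exp (-y ^ 2) with hF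
  have h1 : ∀ x : EuclideanSpace ℝ (Fin d), inner ℝ x (EuclideanSpace.single j₀ h) ^ (2 * m) *
      Real.exp (-‖x‖ ^ 2) = ∏ j, F j (x.ofLp j) := by
    intro x
    simp only [hF]
    rw [Finset.prod_mul_distrib, ← Real.exp_sum, EuclideanSpace.norm_sq_eq,
      Finset.prod_ite_eq' Finset.univ j₀, if_pos (Finset.mem_univ _)]
    simp [EuclideanSpace.inner_single_right]
  simp_rw [h1]
  rw [(PiLp.volume_preserving_ofLp (Fin d)).integral_comp
    (MeasurableEquiv.toLp 2 (Fin d → ℝ)).symm.measurableEmbedding (fun y => ∏ j, F j (y j)),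
    integral_fintype_prod_volume_eq_prod]
  have h2 : ∫ y : ℝ, Real.exp (-y ^ 2) = √Real.pi := by
    simpa using integral_gaussian 1
  have h3 : ∀ j, ∫ y, F j y = √Real.pi *
      (if j = j₀ then h ^ (2 * m) * (Real.Gamma (m + 1 / 2) / √Real.pi) else 1) := by
    intro j
    simp only [hF]
    split_ifs
    · simp_rw [mul_pow, mul_assoc]
      rw [integral_const_mul, integral_pow_mul_exp_neg_sq]
      field_simp
    · simp [h2]
  simp_rw [h3]
  rw [Finset.prod_mul_distrib, Finset.prod_ite_eq' Finset.univ j₀, if_pos (Finset.mem_univ _)]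
  simp
  ring

lemma integral_inner_pow_mul_exp (hd : 1 ≤ d) (δ : EuclideanSpace ℝ (Fin d)) (m : ℕ) :
    ∫ x : EuclideanSpace ℝ (Fin d), inner ℝ x δ ^ (2 * m) * Real.exp (-‖x‖ ^ 2) =
      ‖δ‖ ^ (2 * m) * (Real.Gamma (m + 1 / 2) / √Real.pi) * √Real.pi ^ d := by
  set e : EuclideanSpace ℝ (Fin d) := EuclideanSpace.single ⟨0, hd⟩ ‖δ‖ with he
  -- As `δ` and `e` have equal norm, this reflection exchanges them; the Gaussian integral is
  -- invariant under it, so `δ` may be taken along an axis.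
  set R := (ℝ ∙ (δ - e))ᗮ.reflection with hR
  have hRδ : R δ = e := Submodule.reflection_sub (by simp [he])
  rw [← integral_inner_single_pow_mul_exp ⟨0, hd⟩ ‖δ‖ m, ← he,
    ← R.measurePreserving.integral_comp R.toHomeomorph.measurableEmbedding
      fun x => inner ℝ x e ^ (2 * m) * Real.exp (-‖x‖ ^ 2)]
  refine integral_congr_ae (ae_of_all _ fun x => ?_)
  rw [← hRδ]
  simp only [LinearIsometryEquiv.inner_map_map, LinearIsometryEquiv.norm_map]

/-- The even moments of the surface measure of the unit sphere. -/
lemma integral_toSphere_inner_pow (hd : 1 ≤ d) (δ : EuclideanSpace ℝ (Fin d)) (m : ℕ) :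
    (∫ ω, inner ℝ ω.1 δ ^ (2 * m) ∂(volume : Measure (EuclideanSpace ℝ (Fin d))).toSphere) *
        (1 / 2 * Real.Gamma (m + d / 2)) =
      ‖δ‖ ^ (2 * m) * (Real.Gamma (m + 1 / 2) / √Real.pi) * √Real.pi ^ d := by
  have : Nonempty (Fin d) := ⟨⟨0, hd⟩⟩
  -- In polar coordinates the Gaussian moment splits into the spherical moment and a radial Gamma
  -- integral.
  rw [← integral_inner_pow_mul_exp hd, integral_eq_integral_toSphere_prod,
    ← integral_Ioi_pow_mul_pow_mul_exp_neg_sq hd, ← integral_volumeIoiPow,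
    finrank_euclideanSpace_fin, ← integral_prod_mul]
  refine integral_congr_ae (ae_of_all _ fun z => ?_)
  have h1 : ‖z.1.1‖ = 1 := by simp
  simp only [norm_smul, h1, mul_one, real_inner_smul_left, mul_pow, Real.norm_eq_abs, sq_abs]
  ring

lemma measureReal_toSphere_univ (hd : 1 ≤ d) :
    (volume : Measure (EuclideanSpace ℝ (Fin d))).toSphere.real Set.univ =
      2 * Real.pi ^ ((d : ℝ) / 2) / Real.Gamma (d / 2) := by
  have h := integral_toSphere_inner_pow hd 0 0
  have hd' : (0 : ℝ) < d := by exact_mod_cast hd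
  have hG := Real.Gamma_pos_of_pos (half_pos hd')
  have hpi : √Real.pi ≠ 0 := (Real.sqrt_pos.2 Real.pi_pos).ne'
  have h2 : √Real.pi ^ d = Real.pi ^ ((d : ℝ) / 2) := by
    rw [Real.sqrt_eq_rpow, ← Real.rpow_natCast, ← Real.rpow_mul Real.pi_pos.le]
    ring_nf
  simp only [mul_zero, pow_zero, integral_const, smul_eq_mul, mul_one, Nat.cast_zero, zero_add,
    Real.Gamma_one_half_eq, div_self hpi, one_mul, h2] at h
  rw [← h]
  field_simp

lemma besselLambda_eq_tsum (hd : 1 ≤ d) {z : ℝ} (hz : 0 ≤ z) :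
    besselLambda d z = ∑' m : ℕ, Real.Gamma (d / 2) *
      ((-1) ^ m / (m.factorial * Real.Gamma (m + d / 2)) * (z / 2) ^ (2 * m)) := by
  have hd' : (0 : ℝ) < d := by exact_mod_cast hd
  have hG := Real.Gamma_pos_of_pos (half_pos hd')
  rcases hz.eq_or_lt with rfl | hz
  · rw [besselLambda, if_pos rfl, tsum_eq_single 0]
    · simp [hG.ne']
    · intro m hm
      simp [hm]
  · rw [besselLambda, if_neg hz.ne', besselJ, tsum_mul_left, mul_comm (2 ^ _) (Real.Gamma _),
      mul_assoc, mul_div_assoc', ← tsum_mul_left, ← tsum_div_const]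
    congr 1
    refine tsum_congr fun m => ?_
    have h1 : (m : ℝ) + ((d : ℝ) - 2) / 2 + 1 = m + d / 2 := by ring
    have h2 : (z / 2) ^ (2 * (m : ℝ) + ((d : ℝ) - 2) / 2) =
        (z / 2) ^ (2 * m) * (z ^ (((d : ℝ) - 2) / 2) / 2 ^ (((d : ℝ) - 2) / 2)) := by
      rw [Real.rpow_add (by positivity), Real.div_rpow hz.le two_pos.le (((d : ℝ) - 2) / 2),
        ← Real.rpow_natCast (z / 2)]
      push_cast
      rfl
    rw [h1, h2]
    have h3 : z ^ (((d : ℝ) - 2) / 2) ≠ 0 := by positivity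
    have h4 : (2 : ℝ) ^ (((d : ℝ) - 2) / 2) ≠ 0 := by positivity
    field_simp

/-- The average of a plane wave over a sphere is a Bessel function. -/
theorem integral_toSphere_cos (hd : 1 ≤ d) (δ : EuclideanSpace ℝ (Fin d)) :
    ∫ ω, Real.cos (inner ℝ ω.1 δ) ∂(volume : Measure (EuclideanSpace ℝ (Fin d))).toSphere =
      (volume : Measure (EuclideanSpace ℝ (Fin d))).toSphere.real Set.univ *
        besselLambda d ‖δ‖ := by
  have hd' : (0 : ℝ) < d := by exact_mod_cast hd
  have hG := Real.Gamma_pos_of_pos (half_pos hd')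
  have hpi : √Real.pi ≠ 0 := (Real.sqrt_pos.2 Real.pi_pos).ne'
  have hin : Continuous fun ω : Metric.sphere (0 : EuclideanSpace ℝ (Fin d)) 1 =>
      inner ℝ ω.1 δ := by fun_prop
  have hsum : HasSum (fun m : ℕ => ∫ ω, (-1) ^ m * inner ℝ ω.1 δ ^ (2 * m) / ((2 * m).factorial : ℝ)
      ∂(volume : Measure (EuclideanSpace ℝ (Fin d))).toSphere)
      (∫ ω, Real.cos (inner ℝ ω.1 δ)
        ∂(volume : Measure (EuclideanSpace ℝ (Fin d))).toSphere) := by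
    -- On the unit sphere the absolute values of the terms are bounded by those of the series of
    -- `cosh ‖δ‖`.
    refine hasSum_integral_of_dominated_convergence
      (fun m _ => ‖δ‖ ^ (2 * m) / ((2 * m).factorial : ℝ)) (fun m => ?_)
      (fun m => ae_of_all _ fun ω => ?_) (ae_of_all _ fun _ => (Real.hasSum_cosh ‖δ‖).summable)
      (integrable_const _) (ae_of_all _ fun ω => Real.hasSum_cos _)
    · exact Continuous.aestronglyMeasurable (by fun_prop)
    · have h1 : ‖ω.1‖ = 1 := by simp
      have h2 := abs_real_inner_le_norm ω.1 δ
      rw [h1, one_mul] at h2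
      rw [norm_div, norm_mul, norm_pow, norm_neg, norm_one, one_pow, one_mul, norm_pow,
        Real.norm_eq_abs, Real.norm_natCast]
      gcongr
  rw [← hsum.tsum_eq, besselLambda_eq_tsum hd (norm_nonneg δ), ← tsum_mul_left]
  refine tsum_congr fun m => ?_
  have hGm : 0 < Real.Gamma (m + d / 2) := Real.Gamma_pos_of_pos (by positivity)
  have h1 := integral_toSphere_inner_pow hd δ m
  have h2 := integral_toSphere_inner_pow hd δ 0
  have h3 := gamma_natCast_add_half m
  simp only [mul_zero, pow_zero, integral_const, smul_eq_mul, mul_one, Nat.cast_zero, zero_add,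
    Real.Gamma_one_half_eq, div_self hpi, one_mul] at h2
  have h4 : ∫ ω, (-1) ^ m * inner ℝ ω.1 δ ^ (2 * m) / ((2 * m).factorial : ℝ)
      ∂(volume : Measure (EuclideanSpace ℝ (Fin d))).toSphere =
      (-1) ^ m / ((2 * m).factorial : ℝ) * ∫ ω, inner ℝ ω.1 δ ^ (2 * m)
        ∂(volume : Measure (EuclideanSpace ℝ (Fin d))).toSphere := by
    rw [← integral_const_mul]
    refine integral_congr_ae (ae_of_all _ fun ω => ?_)
    simp only
    ring
  have h5 : Real.Gamma (m + 1 / 2) / √Real.pi = ((2 * m).factorial : ℝ) / (4 ^ m * m.factorial) := by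
    rw [div_eq_div_iff hpi (by positivity), h3]
  rw [← h2, h5] at h1
  have h6 : ∫ ω, inner ℝ ω.1 δ ^ (2 * m)
      ∂(volume : Measure (EuclideanSpace ℝ (Fin d))).toSphere = ‖δ‖ ^ (2 * m) *
      (((2 * m).factorial : ℝ) / (4 ^ m * m.factorial)) *
      ((volume : Measure (EuclideanSpace ℝ (Fin d))).toSphere.real Set.univ *
        Real.Gamma (d / 2)) / Real.Gamma (m + d / 2) := by
    rw [eq_div_iff hGm.ne']
    linear_combination 2 * h1
  have h7 : (‖δ‖ / 2) ^ (2 * m) = ‖δ‖ ^ (2 * m) / 4 ^ m := by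
    rw [div_pow, pow_mul 2 2 m]
    norm_num
  rw [h4, h6, h7]
  have : ((2 * m).factorial : ℝ) ≠ 0 := by positivity
  field_simp

end Moments

/-! ### Reduction of the limit to a radial integral -/

section Radial

variable {d : ℕ}

lemma limitIntegrand_eq (hd : 1 ≤ d) (κ α β h : ℝ) {r : ℝ} :
    limitIntegrand d κ α β h r =
      r ^ (d - 1) * (spectralDensity κ α β r * (1 - besselLambda d (h * r))) := by
  have : r ^ ((d : ℝ) - 1) = r ^ (d - 1) := by
    rw [← Real.rpow_natCast, Nat.cast_sub hd, Nat.cast_one]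
  rw [limitIntegrand, spectralDensity, this, div_eq_mul_inv]
  ring

lemma abs_one_sub_cos_inner_le (x δ : EuclideanSpace ℝ (Fin d)) :
    |1 - Real.cos (inner ℝ x δ)| ≤ (2 + ‖δ‖ ^ 2) * min 1 (‖x‖ ^ 2) := by
  rw [abs_of_nonneg (by linarith [Real.cos_le_one (inner ℝ x δ)])]
  have h2 := pow_le_pow_left₀ (abs_nonneg _) (abs_real_inner_le_norm x δ) 2
  rw [sq_abs, mul_pow] at h2
  rcases min_choice 1 (‖x‖ ^ 2) with h | h <;> rw [h]
  · nlinarith [Real.neg_one_le_cos (inner ℝ x δ), sq_nonneg ‖δ‖]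
  · nlinarith [Real.one_sub_sq_div_two_le_cos (x := inner ℝ x δ), sq_nonneg ‖x‖]

lemma integrable_spectralDensity_mul_one_sub_cos (hd : 1 ≤ d) {κ α β : ℝ} (hκ : 0 ≤ κ)
    (hβd : β < 1 + (d : ℝ) / 2) (hαβ : (d : ℝ) / 2 < α + β)
    (hκ0 : κ = 0 → α + β < 1 + (d : ℝ) / 2) (δ : EuclideanSpace ℝ (Fin d)) :
    Integrable fun x : EuclideanSpace ℝ (Fin d) =>
      spectralDensity κ α β ‖x‖ * (1 - Real.cos (inner ℝ x δ)) :=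
  integrable_spectralDensity_mul hd hκ hβd hαβ hκ0 (q := fun x => 1 - Real.cos (inner ℝ x δ))
    (Continuous.measurable (by fun_prop)) fun x => abs_one_sub_cos_inner_le x δ

lemma integral_toSphere_spectralDensity (hd : 1 ≤ d) (κ α β : ℝ) (δ : EuclideanSpace ℝ (Fin d))
    (r : Set.Ioi (0 : ℝ)) :
    ∫ ω : Metric.sphere (0 : EuclideanSpace ℝ (Fin d)) 1, spectralDensity κ α β ‖r.1 • ω.1‖ *
        (1 - Real.cos (inner ℝ (r.1 • ω.1) δ))
        ∂(volume : Measure (EuclideanSpace ℝ (Fin d))).toSphere =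
      (volume : Measure (EuclideanSpace ℝ (Fin d))).toSphere.real Set.univ *
        (spectralDensity κ α β r * (1 - besselLambda d (‖δ‖ * r))) := by
  have hr : (0 : ℝ) < r := r.2
  have h1 : ∀ ω : Metric.sphere (0 : EuclideanSpace ℝ (Fin d)) 1,
      spectralDensity κ α β ‖r.1 • ω.1‖ * (1 - Real.cos (inner ℝ (r.1 • ω.1) δ)) =
      spectralDensity κ α β r * (1 - Real.cos (inner ℝ ω.1 (r.1 • δ))) := by
    intro ω
    have h1 : ‖ω.1‖ = 1 := by simp
    rw [norm_smul, h1, mul_one, Real.norm_of_nonneg hr.le, real_inner_smul_left,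
      real_inner_smul_right]
  simp_rw [h1]
  have hint : Integrable (fun ω : Metric.sphere (0 : EuclideanSpace ℝ (Fin d)) 1 =>
      Real.cos (inner ℝ ω.1 (r.1 • δ)))
      (volume : Measure (EuclideanSpace ℝ (Fin d))).toSphere := by
    refine (integrable_const (1 : ℝ)).mono' (Continuous.aestronglyMeasurable (by fun_prop))
      (ae_of_all _ fun ω => Real.abs_cos_le_one _)
  rw [integral_const_mul, integral_sub (integrable_const _) hint, integral_toSphere_cos hd,
    norm_smul, Real.norm_of_nonneg hr.le, integral_const, smul_eq_mul, mul_comm r.1]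
  ring

theorem integral_spectralDensity_mul_one_sub_cos (hd : 1 ≤ d) {κ α β : ℝ} (hκ : 0 ≤ κ)
    (hβd : β < 1 + (d : ℝ) / 2) (hαβ : (d : ℝ) / 2 < α + β)
    (hκ0 : κ = 0 → α + β < 1 + (d : ℝ) / 2) (δ : EuclideanSpace ℝ (Fin d)) :
    ∫ x : EuclideanSpace ℝ (Fin d), spectralDensity κ α β ‖x‖ * (1 - Real.cos (inner ℝ x δ)) =
      2 * Real.pi ^ ((d : ℝ) / 2) / Real.Gamma (d / 2) *
        ∫ r in Set.Ioi (0 : ℝ), limitIntegrand d κ α β ‖δ‖ r := by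
  have : Nonempty (Fin d) := ⟨⟨0, hd⟩⟩
  have h := (integrable_toSphere_prod_iff _).2
    (integrable_spectralDensity_mul_one_sub_cos hd hκ hβd hαβ hκ0 δ)
  rw [integral_eq_integral_toSphere_prod, integral_prod_symm _ h]
  simp only [integral_toSphere_spectralDensity hd]
  rw [integral_const_mul, measureReal_toSphere_univ hd, integral_volumeIoiPow _
    (fun r => spectralDensity κ α β r * (1 - besselLambda d (‖δ‖ * r))),
    finrank_euclideanSpace_fin]
  simp only [limitIntegrand_eq hd]

/-- Fubini in polar coordinates: the integrand is, up to a constant, the spherical integral of an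
integrable function on `ℝ^d`. No estimate of Bessel functions is involved. -/
theorem integrableOn_limitIntegrand (hd : 1 ≤ d) {κ α β : ℝ} (hκ : 0 ≤ κ)
    (hβd : β < 1 + (d : ℝ) / 2) (hαβ : (d : ℝ) / 2 < α + β)
    (hκ0 : κ = 0 → α + β < 1 + (d : ℝ) / 2) {h : ℝ} (hh : 0 ≤ h) :
    IntegrableOn (limitIntegrand d κ α β h) (Set.Ioi 0) := by
  have : Nonempty (Fin d) := ⟨⟨0, hd⟩⟩
  have hδ : ‖EuclideanSpace.single (⟨0, hd⟩ : Fin d) h‖ = h := by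
    simp [abs_of_nonneg hh]
  have h1 := ((integrable_toSphere_prod_iff _).2 (integrable_spectralDensity_mul_one_sub_cos hd
    hκ hβd hαβ hκ0 (EuclideanSpace.single (⟨0, hd⟩ : Fin d) h))).integral_prod_right
  simp only [integral_toSphere_spectralDensity hd, hδ, finrank_euclideanSpace_fin] at h1
  have hd' : (0 : ℝ) < d := by exact_mod_cast hd
  have hG := Real.Gamma_pos_of_pos (half_pos hd')
  have hpi := Real.pi_pos
  have h2 : (volume : Measure (EuclideanSpace ℝ (Fin d))).toSphere.real Set.univ ≠ 0 := by
    rw [measureReal_toSphere_univ hd]; positivity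
  rw [integrable_const_mul_iff h2.isUnit] at h1
  have h3 := (integrable_volumeIoiPow_iff _
    (fun r => spectralDensity κ α β r * (1 - besselLambda d (h * r)))).1 h1
  simpa only [← limitIntegrand_eq hd] using h3

/-- The constants agree since `2 (2π)^(-d)` times the sphere area `2 π^(d/2) / Γ(d/2)` is `4 / (2^d
π^(d/2) Γ(d/2))`. -/
lemma limitVariogram_eq_integral (hd : 1 ≤ d) {κ τ α β : ℝ} (hτ : 0 < τ) (hκ : 0 ≤ κ)
    (hβd : β < 1 + (d : ℝ) / 2) (hαβ : (d : ℝ) / 2 < α + β)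
    (hκ0 : κ = 0 → α + β < 1 + (d : ℝ) / 2) (δ : EuclideanSpace ℝ (Fin d)) :
    limitVariogram d κ τ α β ‖δ‖ = 2 * (τ⁻¹ ^ 2 * ((2 * Real.pi) ^ d)⁻¹) *
      ∫ x : EuclideanSpace ℝ (Fin d),
        spectralDensity κ α β ‖x‖ * (1 - Real.cos (inner ℝ x δ)) := by
  have hd' : (0 : ℝ) < d := by exact_mod_cast hd
  have hG := Real.Gamma_pos_of_pos (half_pos hd')
  have hpi := Real.pi_pos
  rw [integral_spectralDensity_mul_one_sub_cos hd hκ hβd hαβ hκ0, limitVariogram, ← mul_assoc]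
  congr 1
  have h1 : Real.pi ^ d = Real.pi ^ ((d : ℝ) / 2) * Real.pi ^ ((d : ℝ) / 2) := by
    rw [← Real.rpow_add hpi, add_halves, Real.rpow_natCast]
  rw [mul_pow, h1]
  have : Real.pi ^ ((d : ℝ) / 2) ≠ 0 := by positivity
  field_simp
  norm_num

/-- The real part of the expanded product `∏ (exp(i aⱼ) + exp(-i aⱼ))`. -/
lemma sum_cos_sign (a : Fin d → ℝ) :
    ∑ ε : Fin d → Bool, Real.cos (∑ j, (bif ε j then 1 else -1) * a j) =
      2 ^ d * ∏ j, Real.cos (a j) := by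
  have h := Finset.prod_univ_sum (fun _ : Fin d => (Finset.univ : Finset Bool))
    fun j q => Complex.exp (((bif q then 1 else -1) * a j : ℝ) * Complex.I)
  rw [Fintype.piFinset_univ] at h
  simp only [← Complex.exp_sum, ← Finset.sum_mul, ← Complex.ofReal_sum] at h
  have h2 : ∀ j, ∑ q : Bool, Complex.exp (((bif q then 1 else -1) * a j : ℝ) * Complex.I) =
      ((2 * Real.cos (a j) : ℝ) : ℂ) := by
    intro j
    simp only [Fintype.univ_bool, Finset.mem_singleton, Bool.true_eq_false, not_false_eq_true,
      Finset.sum_insert, Finset.sum_singleton, cond_true, cond_false]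
    push_cast
    rw [Complex.cos]
    ring_nf
  simp only [h2, ← Complex.ofReal_prod] at h
  have h3 := congrArg Complex.re h
  rw [Complex.ofReal_re, Complex.re_sum, Finset.prod_mul_distrib] at h3
  simp only [Complex.exp_ofReal_mul_I_re] at h3
  rw [← h3]
  simp

/-- The product of cosines is not a function of `‖s - t‖`, but it is the mean of plane waves along
the reflected vectors `δ ε`. Isotropy appears only after integration, each `δ ε` contributing the
same amount because its norm is `‖s - t‖`. -/
theorem tendsto_wmVariogram_limitVariogram (hd : 1 ≤ d) {κ τ α β : ℝ} (hτ : 0 < τ) (hκ : 0 ≤ κ)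
    (hβd : β < 1 + (d : ℝ) / 2) (hαβ : (d : ℝ) / 2 < α + β)
    (hκ0 : κ = 0 → α + β < 1 + (d : ℝ) / 2) (s t : EuclideanSpace ℝ (Fin d)) :
    Tendsto (fun L => wmVariogram κ τ α β L s t) atTop
      (𝓝 (limitVariogram d κ τ α β ‖s - t‖)) := by
  have h := tendsto_wmVariogram hd hτ hκ hβd hαβ hκ0 s t
  set δ : (Fin d → Bool) → EuclideanSpace ℝ (Fin d) := fun ε =>
    WithLp.toLp 2 fun j => (bif ε j then 1 else -1) * (s j - t j) with hδ
  have hnorm : ∀ ε, ‖δ ε‖ = ‖s - t‖ := by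
    intro ε
    rw [EuclideanSpace.norm_eq, EuclideanSpace.norm_eq]
    congr 1
    refine Finset.sum_congr rfl fun j _ => ?_
    simp only [hδ, PiLp.sub_apply]
    cases ε j <;> simp
    ring
  have hpt : ∀ x : EuclideanSpace ℝ (Fin d),
      spectralDensity κ α β ‖x‖ * (2 * (1 - ∏ j, Real.cos (x j * (s j - t j)))) =
      2 * (2 ^ d)⁻¹ * ∑ ε, spectralDensity κ α β ‖x‖ * (1 - Real.cos (inner ℝ x (δ ε))) := by
    intro x
    have h1 : ∀ ε, inner ℝ x (δ ε) = ∑ j, (bif ε j then 1 else -1) * (x j * (s j - t j)) := by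
      intro ε
      rw [PiLp.inner_apply]
      refine Finset.sum_congr rfl fun j _ => ?_
      simp [hδ]
      ring
    simp only [h1, ← Finset.mul_sum, Finset.sum_sub_distrib, sum_cos_sign]
    simp
    field_simp
  have hlim : limitVariogram d κ τ α β ‖s - t‖ = τ⁻¹ ^ 2 * ((2 * Real.pi) ^ d)⁻¹ *
      ∫ x : EuclideanSpace ℝ (Fin d),
        spectralDensity κ α β ‖x‖ * (2 * (1 - ∏ j, Real.cos (x j * (s j - t j)))) := by
    simp_rw [hpt]
    rw [integral_const_mul, integral_finsetSum _ fun ε _ =>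
      integrable_spectralDensity_mul_one_sub_cos hd hκ hβd hαβ hκ0 (δ ε)]
    simp only [integral_spectralDensity_mul_one_sub_cos hd hκ hβd hαβ hκ0, hnorm]
    rw [limitVariogram_eq_integral hd hτ hκ hβd hαβ hκ0,
      integral_spectralDensity_mul_one_sub_cos hd hκ hβd hαβ hκ0]
    simp
    field_simp
  rw [hlim]
  exact h

end Radial

/-! ## The stationary field -/

section StationaryField

/-- The Hartley kernel `cos + sin`. -/
noncomputable def cas (a : ℝ) : ℝ := Real.cos a + Real.sin a

lemma continuous_cas : Continuous cas := Real.continuous_cos.add Real.continuous_sin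

lemma sq_cas_sub_one_le (a : ℝ) : (cas a - 1) ^ 2 ≤ 4 * (1 - Real.cos a) := by
  unfold cas
  nlinarith [Real.sin_sq_add_cos_sq a, sq_nonneg (Real.cos a - 1 - Real.sin a)]

/-- Passing to the opposite frequency reverses the sign of the cross terms between `cos` and `sin`,
so they cancel in the sum. This is what lets a real kernel replace complex exponentials. -/
lemma sq_cas_sub_add_neg (a b : ℝ) :
    (cas a - cas b) ^ 2 + (cas (-a) - cas (-b)) ^ 2 = 4 * (1 - Real.cos (a - b)) := by
  simp only [cas, Real.cos_neg, Real.sin_neg]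
  rw [Real.cos_sub]
  linear_combination 2 * Real.sin_sq_add_cos_sq a + 2 * Real.sin_sq_add_cos_sq b

variable {d : ℕ}

/-- The spectral kernel of the stationary intrinsic Whittle–Matérn field. -/
noncomputable def spectralKernel (κ τ α β : ℝ) (s ξ : EuclideanSpace ℝ (Fin d)) : ℝ :=
  τ⁻¹ * √((2 * Real.pi) ^ d)⁻¹ * √(spectralDensity κ α β ‖ξ‖) * (cas (inner ℝ ξ s) - 1)

lemma measurable_spectralKernel (κ τ α β : ℝ) (s : EuclideanSpace ℝ (Fin d)) :
    Measurable (spectralKernel κ τ α β s) := by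
  refine Measurable.mul ?_ ?_
  · unfold spectralDensity
    fun_prop
  · exact ((continuous_cas.comp (by fun_prop)).sub continuous_const).measurable

lemma sq_spectralKernel_mul (κ τ α β A : ℝ) (ξ : EuclideanSpace ℝ (Fin d)) :
    (τ⁻¹ * √((2 * Real.pi) ^ d)⁻¹ * √(spectralDensity κ α β ‖ξ‖) * A) ^ 2 =
      τ⁻¹ ^ 2 * ((2 * Real.pi) ^ d)⁻¹ * (spectralDensity κ α β ‖ξ‖ * A ^ 2) := by
  have hpi := Real.pi_pos
  rw [mul_pow, mul_pow, mul_pow, Real.sq_sqrt (by positivity),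
    Real.sq_sqrt (spectralDensity_nonneg _ _ _ (norm_nonneg _))]
  ring

/-- Subtracting `1` in the kernel pins the field to `0` at the origin. It supplies the factor
`O(‖ξ‖²)` in the square that tames the density at low frequency. -/
lemma memLp_spectralKernel (hd : 1 ≤ d) {κ α β : ℝ} (τ : ℝ) (hκ : 0 ≤ κ)
    (hβd : β < 1 + (d : ℝ) / 2) (hαβ : (d : ℝ) / 2 < α + β)
    (hκ0 : κ = 0 → α + β < 1 + (d : ℝ) / 2) (s : EuclideanSpace ℝ (Fin d)) :
    MemLp (spectralKernel κ τ α β s) 2 := by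
  rw [memLp_two_iff_integrable_sq (measurable_spectralKernel κ τ α β s).aestronglyMeasurable]
  simp only [spectralKernel, sq_spectralKernel_mul]
  refine (integrable_spectralDensity_mul hd hκ hβd hαβ hκ0 (K := 4 * (2 + ‖s‖ ^ 2))
    (q := fun x => (cas (inner ℝ x s) - 1) ^ 2) ?_ fun x => ?_).const_mul _
  · exact (((continuous_cas.comp (by fun_prop)).sub continuous_const).pow 2).measurable
  · rw [abs_of_nonneg (sq_nonneg _)]
    refine (sq_cas_sub_one_le _).trans ?_
    have := (le_abs_self _).trans (abs_one_sub_cos_inner_le x s)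
    linarith

lemma integral_sq_spectralKernel_sub (hd : 1 ≤ d) {κ τ α β : ℝ} (hτ : 0 < τ) (hκ : 0 ≤ κ)
    (hβd : β < 1 + (d : ℝ) / 2) (hαβ : (d : ℝ) / 2 < α + β)
    (hκ0 : κ = 0 → α + β < 1 + (d : ℝ) / 2) (s t : EuclideanSpace ℝ (Fin d)) :
    ∫ ξ, (spectralKernel κ τ α β s ξ - spectralKernel κ τ α β t ξ) ^ 2 =
      limitVariogram d κ τ α β ‖s - t‖ := by
  have hint := ((memLp_spectralKernel hd τ hκ hβd hαβ hκ0 s).sub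
    (memLp_spectralKernel hd τ hκ hβd hαβ hκ0 t)).integrable_sq
  simp only [Pi.sub_apply] at hint
  set F : EuclideanSpace ℝ (Fin d) → ℝ :=
    fun ξ => (spectralKernel κ τ α β s ξ - spectralKernel κ τ α β t ξ) ^ 2 with hF
  -- Lebesgue measure is invariant under `ξ ↦ -ξ`, so `F` may be symmetrised, which leaves only `1 -
  -- cos ⟪ξ, s - t⟫`.
  have h1 : ∀ ξ, F ξ + F (-ξ) = 4 * (τ⁻¹ ^ 2 * ((2 * Real.pi) ^ d)⁻¹) *
      (spectralDensity κ α β ‖ξ‖ * (1 - Real.cos (inner ℝ ξ (s - t)))) := by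
    intro ξ
    have h2 := sq_cas_sub_add_neg (inner ℝ ξ s) (inner ℝ ξ t)
    rw [← inner_sub_right] at h2
    simp only [hF, spectralKernel, norm_neg, inner_neg_left, ← mul_sub, sq_spectralKernel_mul,
      sub_sub_sub_cancel_right]
    linear_combination (τ⁻¹ ^ 2 * ((2 * Real.pi) ^ d)⁻¹ * spectralDensity κ α β ‖ξ‖) * h2
  have h2 : ∫ ξ, (F ξ + F (-ξ)) = 2 * ∫ ξ, F ξ := by
    rw [integral_add hint hint.comp_neg, integral_neg_eq_self F]
    ring
  simp_rw [h1] at h2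
  rw [integral_const_mul] at h2
  rw [limitVariogram_eq_integral hd hτ hκ hβd hαβ hκ0]
  linarith

/-- The character `ξ ↦ exp (i ⟪ξ, s⟫)`. -/
noncomputable def planeWave (s : EuclideanSpace ℝ (Fin d)) :
    Multiplicative (EuclideanSpace ℝ (Fin d)) →* ℂ where
  toFun ξ := Complex.exp ((inner ℝ ξ.toAdd s : ℝ) * Complex.I)
  map_one' := by simp
  map_mul' ξ η := by
    rw [← Complex.exp_add, toAdd_mul, inner_add_left]
    push_cast
    ring_nf

lemma planeWave_injective : Function.Injective (planeWave (d := d)) := by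
  intro s t hst
  by_contra hne
  have hv : 0 < ‖s - t‖ := norm_pos_iff.2 (sub_ne_zero.2 hne)
  -- At this frequency the phases at `s` and `t` differ by `π`, so the two exponentials are opposite
  -- and cannot be equal.
  have h := DFunLike.congr_fun hst (Multiplicative.ofAdd ((Real.pi / ‖s - t‖ ^ 2) • (s - t)))
  simp only [planeWave, MonoidHom.coe_mk, OneHom.coe_mk, toAdd_ofAdd] at h
  have h1 : inner ℝ ((Real.pi / ‖s - t‖ ^ 2) • (s - t)) s =
      inner ℝ ((Real.pi / ‖s - t‖ ^ 2) • (s - t)) t + Real.pi := by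
    rw [← sub_eq_iff_eq_add', ← inner_sub_right, real_inner_smul_left, real_inner_self_eq_norm_sq]
    field_simp
  rw [h1, Complex.ofReal_add, add_mul, Complex.exp_add, Complex.exp_pi_mul_I] at h
  have h2 := Complex.exp_ne_zero
    ((inner ℝ ((Real.pi / ‖s - t‖ ^ 2) • (s - t)) t : ℝ) * Complex.I)
  exact h2 (by linear_combination (-1 / 2 : ℂ) * h)

/-- The hypothesis at `ξ` and `-ξ` separates the cosine sum from the sine sum. Together they are a
vanishing combination of distinct characters, to which Dedekind's lemma applies. -/
lemma eq_zero_of_forall_sum_mul_cas {k : ℕ} {s : Fin k → EuclideanSpace ℝ (Fin d)}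
    (hs : Function.Injective s) {c : Fin k → ℝ}
    (h : ∀ ξ, ∑ i, c i * cas (inner ℝ ξ (s i)) = 0) : c = 0 := by
  have hli := (linearIndependent_monoidHom (Multiplicative (EuclideanSpace ℝ (Fin d))) ℂ).comp
    (fun i => planeWave (s i)) (planeWave_injective.comp hs)
  rw [Fintype.linearIndependent_iff] at hli
  have h1 := hli (fun i => (c i : ℂ)) ?_
  · funext i
    exact_mod_cast h1 i
  · funext ξ
    have h2 := h ξ.toAdd
    have h3 := h (-ξ.toAdd)
    simp only [cas, inner_neg_left, Real.cos_neg, Real.sin_neg, mul_add, mul_neg,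
      Finset.sum_add_distrib, Finset.sum_neg_distrib] at h2 h3
    have h4 : ∑ i, c i * Real.cos (inner ℝ ξ.toAdd (s i)) = 0 := by linarith
    have h5 : ∑ i, c i * Real.sin (inner ℝ ξ.toAdd (s i)) = 0 := by linarith
    simp only [Function.comp_apply, Finset.sum_apply, Pi.smul_apply, smul_eq_mul, planeWave,
      MonoidHom.coe_mk, OneHom.coe_mk, Pi.zero_apply]
    apply Complex.ext
    · simpa [Complex.exp_ofReal_mul_I_re] using h4
    · simpa [Complex.exp_ofReal_mul_I_im] using h5

/-- The field is the white noise integral of `spectralKernel`. In a contrast the subtracted `1`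
drops out, so zero variance forces `∑ c i cas ⟪ξ, s i⟫ = 0` almost everywhere by positivity of the
density, then everywhere by continuity. -/
theorem isStationaryIsotropicVariogram_limitVariogram (hd : 1 ≤ d) {κ τ α β : ℝ} (hτ : 0 < τ)
    (hκ : 0 ≤ κ) (hβd : β < 1 + (d : ℝ) / 2) (hαβ : (d : ℝ) / 2 < α + β)
    (hκ0 : κ = 0 → α + β < 1 + (d : ℝ) / 2) :
    IsStationaryIsotropicVariogram d (limitVariogram d κ τ α β) := by
  obtain ⟨Ω, mΩ, P, hP, G, hG⟩ :=
    exists_isonormal (Lp ℝ 2 (volume : Measure (EuclideanSpace ℝ (Fin d))))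
  have hk := memLp_spectralKernel hd τ hκ hβd hαβ hκ0
  refine ⟨Ω, mΩ, P, hP, fun s => G (hk s).toLp, fun k s c _ hs hc hc0 => ?_, fun s t => ?_⟩
  · set f := ∑ i, c i • (hk (s i)).toLp with hf
    have hlaw : P.map (fun ω => ∑ i, c i * G (hk (s i)).toLp ω) = P.map (G f) := by
      refine Measure.map_congr ?_
      have h1 : G f = ∑ i, c i • G (hk (s i)).toLp := by simp [hf]
      have h2 : ∀ᵐ ω ∂P, ∀ i, (c i • G (hk (s i)).toLp : Lp ℝ 2 P) ω =
          c i * G (hk (s i)).toLp ω := by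
        refine ae_all_iff.2 fun i => ?_
        filter_upwards [Lp.coeFn_smul (c i) (G (hk (s i)).toLp)] with ω hω
        rw [hω, Pi.smul_apply, smul_eq_mul]
      rw [h1]
      filter_upwards [Lp.coeFn_finsetSum Finset.univ fun i => c i • G (hk (s i)).toLp, h2]
        with ω h3 h4
      rw [h3, Finset.sum_apply]
      exact Finset.sum_congr rfl fun i _ => (h4 i).symm
    refine ⟨‖f‖₊ ^ 2, ?_, hlaw.trans (hG f)⟩
    intro h0
    have hf0 : f = 0 := by simpa using h0
    refine hc0 (eq_zero_of_forall_sum_mul_cas hs ?_)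
    have hcont : Continuous fun ξ : EuclideanSpace ℝ (Fin d) =>
        ∑ i, c i * cas (inner ℝ ξ (s i)) :=
      continuous_finsetSum _ fun i _ => continuous_const.mul (continuous_cas.comp (by fun_prop))
    have hae : (fun ξ : EuclideanSpace ℝ (Fin d) => ∑ i, c i * cas (inner ℝ ξ (s i)))
        =ᵐ[volume] fun _ => 0 := by
      have h2 : ∀ᵐ ξ : EuclideanSpace ℝ (Fin d), ∀ i, (c i • (hk (s i)).toLp : Lp ℝ 2 _) ξ =
          c i * spectralKernel κ τ α β (s i) ξ := by
        refine ae_all_iff.2 fun i => ?_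
        filter_upwards [Lp.coeFn_smul (c i) (hk (s i)).toLp, (hk (s i)).coeFn_toLp] with ω hω hω'
        rw [hω, Pi.smul_apply, smul_eq_mul, hω']
      have h3 := Lp.coeFn_finsetSum Finset.univ fun i => c i • (hk (s i)).toLp
      rw [← hf, hf0] at h3
      filter_upwards [h2, h3, Lp.coeFn_zero ℝ 2 (volume : Measure (EuclideanSpace ℝ (Fin d))),
        ae_ne_zero hd] with ξ h2 h3 h4 h5
      rw [h4, Finset.sum_apply, Pi.zero_apply, Finset.sum_congr rfl fun i _ => h2 i] at h3
      have hpi := Real.pi_pos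
      have h6 := Real.sqrt_pos.2 (spectralDensity_pos κ α β (norm_pos_iff.2 h5))
      have h7 : τ⁻¹ * √((2 * Real.pi) ^ d)⁻¹ * √(spectralDensity κ α β ‖ξ‖) ≠ 0 := by positivity
      refine (mul_eq_zero.1 ?_).resolve_left h7
      rw [h3, Finset.mul_sum, ← sub_eq_zero, ← Finset.sum_sub_distrib]
      have h8 : ∀ i, τ⁻¹ * √((2 * Real.pi) ^ d)⁻¹ * √(spectralDensity κ α β ‖ξ‖) *
          (c i * cas (inner ℝ ξ (s i))) - c i * spectralKernel κ τ α β (s i) ξ =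
          τ⁻¹ * √((2 * Real.pi) ^ d)⁻¹ * √(spectralDensity κ α β ‖ξ‖) * c i := by
        intro i
        rw [spectralKernel]
        ring
      simp only [h8, ← Finset.mul_sum, hc, mul_zero]
    exact fun ξ => congrFun ((hcont.ae_eq_iff_eq volume continuous_const).1 hae) ξ
  · have hlaw : P.map (fun ω => G (hk s).toLp ω - G (hk t).toLp ω) =
        gaussianReal 0 (‖(hk s).toLp - (hk t).toLp‖₊ ^ 2) := by
      rw [← hG, map_sub]
      exact Measure.map_congr (Lp.coeFn_sub _ _).symm
    rw [variance_of_map_eq_gaussianReal hlaw]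
    push_cast
    rw [← Lp.integral_sub_sq,
      ← integral_sq_spectralKernel_sub hd hτ hκ hβd hαβ hκ0]
    refine integral_congr_ae ?_
    filter_upwards [(hk s).coeFn_toLp, (hk t).coeFn_toLp] with ξ h1 h2
    rw [h1, h2]

end StationaryField

theorem mainTheorem3 (d : ℕ) (hd : 1 ≤ d) (κ τ α β : ℝ) (hκ : 0 ≤ κ) (hτ : 0 < τ)
    (hβ : 0 ≤ β) (hβd : β < 1 + (d : ℝ) / 2) (hαβ : (d : ℝ) / 2 < α + β)
    (hκ0 : κ = 0 → α + β < 1 + (d : ℝ) / 2) :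
    (∃ γL : ℝ → EuclideanSpace ℝ (Fin d) → EuclideanSpace ℝ (Fin d) → ℝ,
      (∀ L : ℝ, 0 < L → IsWhittleMaternVariogram.{w} (cube d L) κ τ α β (γL L)) ∧
      ∀ s t : EuclideanSpace ℝ (Fin d),
        Tendsto (fun L : ℝ => γL L s t) atTop (𝓝 (limitVariogram d κ τ α β ‖s - t‖))) ∧
    (∀ h : ℝ, 0 ≤ h → IntegrableOn (limitIntegrand d κ α β h) (Set.Ioi 0)) ∧
    IsStationaryIsotropicVariogram d (limitVariogram d κ τ α β) :=
  ⟨⟨wmVariogram κ τ α β, fun _ hL => isWhittleMaternVariogram_wmVariogram hτ hαβ hL,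
    fun s t => tendsto_wmVariogram_limitVariogram hd hτ hκ hβd hαβ hκ0 s t⟩,
    fun _ hh => integrableOn_limitIntegrand hd hκ hβd hαβ hκ0 hh,
    isStationaryIsotropicVariogram_limitVariogram hd hτ hκ hβd hαβ hκ0⟩
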